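/- **Theorem.** The practical partition-based O-RAM construction, described below, is oblivious: for any two data request sequences of the same length, the access patterns seen by the server are computationally indistinguishable. **Precise form.** Let $\kappa$ be the security parameter. All parameters may depend on $\kappa$, and $N=4^n$, $\varepsilon$, $B$ and $c$ are bounded by polynomials in $\kappa$. Let $F$ be a pseudo-random permutation: on every domain of polynomial size, $F_K$ for a random key $K$ is computationally indistinguishable from a uniformly random permutation, given its table of values. Let $E$ be a correct symmetric encryption scheme, with ciphertext length determined by the plaintext length, that has indistinguishable encryptions of multiple messages: encryptions under one random key of any two polynomially long lists of messages with the same lengths are computationally indistinguishable. Let $\vec y=(\vec y_\kappa)$ and $\vec z=(\vec z_\kappa)$ be families of sequences of requests $\mathsf{Read}(u)$, $\mathsf{Write}(u,\mathsf{data})$ with $|\vec y_\kappa|=|\vec z_\kappa|$ bounded by a polynomial in $\kappa$. Let $A(\vec y)$ be the random sequence of accesses to the server caused by $\vec y$, with the addresses and the ciphertexts written. Then $A(\vec y)$ and $A(\vec z)$ are computationally indistinguishable: for every family of Boolean circuits $C_\kappa$ of polynomial size, $|\Pr[C_\kappa(A(\vec y_\kappa))=1]-\Pr[C_\kappa(A(\vec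 z_\kappa))=1]|$ is negligible in $\kappa$. **The construction.** There are $N=4^n$ blocks of $B$ bits and $P=\sqrt N=2^n$ partitions, each with levels $\ell=0,\dots,n$. Level $\ell$ has $2\cdot 2^\ell$ places, plus $\varepsilon$ if $\ell=n$ (the top level); let $h_\ell$ be half of this number, rounded down. Every level is filled or unfilled. The blocks of a filled level (at most $h_\ell$ real ones, which get the first indices, the rest being dummies) are stored at the offsets obtained by applying $F_K$ to their indices, encrypted, with $K$ a key that is fresh at each construction of the level. The encryption key is fresh as well and independent of $K$. The client keeps the keys, a counter for the next unread dummy of each level, a cache with one slot per partition, and a position map giving for each block its cache slot, or its partition, level and index. *Setup.* Each block is zeroed and assigned to an independent uniformly random partition, where it is in the top level (in the partition's cache slot if the top level is full). The top level is always filled; which other levels are filled (with dummies) is uniformly random. Only this set of filled levels is sent to the server. *Request for block $u$.* Let $p$ be the partition of $u$ in the position map and choose a uniformly random slot $r$. If $u$ is in slot $p$, remove it from there and do $\mathsf{ReadPartition}(p,\bot)$; otherwise do $\mathsf{ReadPartition}(p,u)$. Put $u$ (with the new data if the request is a write) into slot $r$ and update the position map. Then do $\mathsf{Evict}(p)$.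 Finally draw $k\in\{0,\dots,c\}$ with probability proportional to $\rho^k$, where $0<\rho<1$, and do $\mathsf{Evict}$ for the next $k$ slots of a cyclic scan. *$\mathsf{Evict}(p)$* takes a block from slot $p$ and writes it to partition $p$ by $\mathsf{WritePartition}$; if the slot is empty it writes $\bot$. *$\mathsf{ReadPartition}(p,u)$* fetches one block from each filled level of $p$: block $u$ from the level containing it, and the next unread dummy from every other one. *$\mathsf{WritePartition}(p,b)$* does the following. For each of the consecutively filled levels $0,1,\dots$ of $p$, it fetches the metadata and exactly $h_\ell$ unread blocks including all unread real ones, in the order of their offsets, and marks the level unfilled. It then writes the unread real blocks together with $b$ (unless $b=\bot$), padded with dummies (zeros), under fresh keys into the first unfilled level, or into the top level if all levels were filled, together with the encrypted list of block identifiers. Should there be more real blocks than the top level can hold, the excess stays in slot $p$ of the cache. -/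

import Mathlib

open Filter

namespace ORAM

/-! ## Computational indistinguishability (against non-uniform polynomial-time adversaries) -/

/-- An operand of a gate: a bit of the input string, or the output of an earlier gate. -/
inductive Wire where
  | input (i : ℕ)
  | gate (j : ℕ)

/-- A Boolean circuit: a list of NAND gates, gate number `j` being the `j`-th entry. A gate may read
every input bit and every earlier gate; anything out of range reads as `false`.
The size of the circuit is the length of the list. -/
abbrev Circuit := List (Wire × Wire)

/-- The value of a wire on the input `x` when the gates so far have the values `vs`. -/
def Wire.read (x vs : List Bool) : Wire → Bool
  | .input i => x.getD i false
  | .gate j => vs.getD j false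

/-- The values of all gates on the input `x`. -/
def Circuit.values (C : Circuit) (x : List Bool) : List Bool :=
  C.foldl (fun vs g => vs ++ [!(g.1.read x vs && g.2.read x vs)]) []

/-- The output of the circuit: the value of the last gate. -/
def Circuit.eval (C : Circuit) (x : List Bool) : Bool := (C.values x).getLastD false

/-- A function of the security parameter that is bounded by a polynomial. -/
def PolyBounded (f : ℕ → ℕ) : Prop := ∃ r : Polynomial ℕ, ∀ κ, f κ ≤ r.eval κ

/-- A function of the security parameter that decays faster than every inverse polynomial. -/
def Negligible (f : ℕ → ℝ) : Prop :=
  Asymptotics.SuperpolynomialDecay atTop (fun κ : ℕ => (κ : ℝ)) f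

/-- The probability that the circuit `C` outputs `true` on a sample of `X`. -/
noncomputable def acceptProb (C : Circuit) (X : PMF (List Bool)) : ℝ :=
  ((X.map C.eval) true).toReal

/-- Computational indistinguishability of two ensembles of random bit strings: every family of
circuits of polynomial size has negligible distinguishing advantage. -/
def CompIndist (X Y : ℕ → PMF (List Bool)) : Prop :=
  ∀ C : ℕ → Circuit, PolyBounded (fun κ => (C κ).length) →
    Negligible (fun κ => |acceptProb (C κ) (X κ) - acceptProb (C κ) (Y κ)|)

/-- The number `i < n` in unary: `n` bits, of which exactly the `i`-th is set. -/
def oneHot (n i : ℕ) : List Bool := (List.range n).map (fun j => decide (j = i))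

/-! ## Pseudo-random permutations and encryption -/

/-- A keyed family of permutations, on the domain `{0, …, n - 1}` for every `n`. -/
structure KeyedPerm where
  Key : Type
  gen : PMF Key
  perm : (n : ℕ) → Key → Equiv.Perm (Fin n)

/-- The table of values of a permutation, as a bit string. -/
def permTable {n : ℕ} (π : Equiv.Perm (Fin n)) : List Bool :=
  (List.finRange n).flatMap (fun i => oneHot n (π i))

/-- A pseudo-random permutation: on every domain of polynomial size, the permutation given by a
random key is computationally indistinguishable from a uniformly random permutation. As the domain
has polynomial size, oracle access to a permutation amounts to the table of its values. -/
def Pseudorandom (F : ℕ → KeyedPerm) : Prop :=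
  ∀ n : ℕ → ℕ, PolyBounded n →
    CompIndist (fun κ => (F κ).gen.map (fun K => permTable ((F κ).perm (n κ) K)))
      (fun κ => (PMF.uniformOfFintype (Equiv.Perm (Fin (n κ)))).map permTable)

/-- A (randomized) symmetric encryption scheme for bit strings, in which the length of a ciphertext
depends only on the length of the plaintext. -/
structure SymEnc where
  Key : Type
  gen : PMF Key
  enc : Key → List Bool → PMF (List Bool)
  dec : Key → List Bool → List Bool
  clen : ℕ → ℕ
  length_enc : ∀ K m, ∀ c ∈ (enc K m).support, c.length = clen m.length
  dec_enc : ∀ K ∈ gen.support, ∀ m, ∀ c ∈ (enc K m).support, dec K c = m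

/-- Encrypt every message of a list under one key, with independent coins. -/
noncomputable def SymEnc.encAll (E : SymEnc) (K : E.Key) : List (List Bool) → PMF (List (List Bool))
  | [] => PMF.pure []
  | m :: ms => (E.enc K m).bind fun c => (E.encAll K ms).map fun cs => c :: cs

/-- Indistinguishability of encryptions of multiple messages: for any two polynomially long lists of
messages with the same lengths, the encryptions of the two lists under a random key are
computationally indistinguishable. -/
def SecureEnc (E : ℕ → SymEnc) : Prop :=
  ∀ ms ms' : ℕ → List (List Bool),
    (∀ κ, (ms κ).map List.length = (ms' κ).map List.length) →
    PolyBounded (fun κ => (ms κ).length) → PolyBounded (fun κ => (ms κ).flatten.length) →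
    CompIndist
      (fun κ => (E κ).gen.bind fun K => ((E κ).encAll K (ms κ)).map List.flatten)
      (fun κ => (E κ).gen.bind fun K => ((E κ).encAll K (ms' κ)).map List.flatten)

/-! ## Parameters and data -/

/-- The parameters of the construction: `√N = 2 ^ n`, the surplus `ε` of the top levels, the block
size `B` in bits, and the maximal number `c` and the ratio `ρ` of the bounded geometric
distribution of the number of background evictions per request. -/
structure Params where
  n : ℕ
  ε : ℕ
  B : ℕ
  c : ℕ
  ρ : NNReal
  ρ_pos : 0 < ρ
  ρ_lt_one : ρ < 1

namespace Params

/-- The number of partitions, `√N`. -/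
abbrev P (q : Params) : ℕ := 2 ^ q.n

/-- The capacity of the O-RAM. -/
abbrev N (q : Params) : ℕ := q.P * q.P

/-- The number of levels of a partition. -/
abbrev L (q : Params) : ℕ := q.n + 1

/-- The top level of a partition. -/
def top (q : Params) : Fin q.L := Fin.last q.n

/-- The number of blocks (real and dummy) of a level. -/
def size (q : Params) (ℓ : Fin q.L) : ℕ := 2 * 2 ^ (ℓ : ℕ) + if ℓ = q.top then q.ε else 0

/-- The number of real blocks that a level can hold, which is also the number of unread blocks that
are fetched from it when it is reshuffled. This is `2 ^ ℓ` below the top level. -/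
def half (q : Params) (ℓ : Fin q.L) : ℕ := q.size ℓ / 2

end Params

/-- The content of a block. -/
abbrev Data (q : Params) := Fin q.B → Bool

/-- A real block: identifier and content. -/
abbrev Block (q : Params) := Fin q.N × Data q

/-- A data request. -/
inductive Request (q : Params) where
  | read (u : Fin q.N)
  | write (u : Fin q.N) (d : Data q)

/-- The identifier of a request. -/
def Request.id {q : Params} : Request q → Fin q.N
  | .read u => u
  | .write u _ => u

/-- What the server observes. -/
inductive Event (q : Params) where
  /-- The client announces which levels are filled initially. -/
  | filling (f : Fin q.P → Fin q.L → Bool)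
  /-- The metadata of a level is fetched. -/
  | fetchMeta (p : Fin q.P) (ℓ : Fin q.L)
  /-- The blocks at the given offsets of a level are fetched, in the order of their offsets. -/
  | fetch (p : Fin q.P) (ℓ : Fin q.L) (offsets : Finset ℕ)
  /-- A level is overwritten with the given ciphertexts of its blocks, in the order of their
  offsets, and of its metadata. -/
  | write (p : Fin q.P) (ℓ : Fin q.L) (blocks : List (List Bool)) (metadata : List Bool)

/-- The encoding of an event as a bit string. It starts with the bit `true`, so that the end of a
sequence of events is visible to a circuit. -/
def Event.encode {q : Params} : Event q → List Bool
  | .filling f => [true, false, false] ++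
      (List.finRange q.P).flatMap (fun p => (List.finRange q.L).map (f p))
  | .fetchMeta p ℓ => [true, false, true] ++ oneHot q.P p ++ oneHot q.L ℓ
  | .fetch p ℓ S => [true, true, false] ++ oneHot q.P p ++ oneHot q.L ℓ ++
      (List.range (q.size ℓ)).map (fun o => decide (o ∈ S))
  | .write p ℓ bs md => [true, true, true] ++ oneHot q.P p ++ oneHot q.L ℓ ++ bs.flatten ++ md

/-! ## The client -/

/-- An entry of the position map: the block is in a slot of the client's cache, or on the server in
a given partition and level with a given index (before the pseudo-random permutation). -/
inductive Loc (q : Params) where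
  | cache (p : Fin q.P)
  | server (p : Fin q.P) (ℓ : Fin q.L) (i : ℕ)
  deriving DecidableEq

/-- The partition to which a block is assigned. -/
def Loc.partition {q : Params} : Loc q → Fin q.P
  | .cache p => p
  | .server p _ _ => p

/-- A filled level: its permutation key, the real blocks that were put there when it was last
constructed (the block number `i` has index `i`; all further indices are dummies), and the index of
the next unread dummy. The server returns what was last written and decryption is correct, so these
blocks are what the client obtains when it fetches and decrypts (for a level that has never been
reshuffled: zeroed blocks). -/
structure Level (K : Type) (q : Params) where
  key : K
  blocks : List (Block q)
  cnt : ℕ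

/-- The state of the system, including the sequence `trace` of the server's observations so far. -/
structure State (K : Type) (q : Params) where
  /-- the position map -/
  pos : Fin q.N → Loc q
  /-- the cache slots -/
  slot : Fin q.P → List (Block q)
  /-- the levels of the partitions; `none` is an unfilled level -/
  level : Fin q.P → Fin q.L → Option (Level K q)
  /-- the counter of the sequential scan -/
  ecnt : Fin q.P
  trace : List (Event q)

section Client

variable (F : KeyedPerm) (E : SymEnc) {q : Params}

/-- The offset in level `ℓ` of the block with index `i`. -/
def offset (ℓ : Fin q.L) (K : F.Key) (i : ℕ) : ℕ :=
  if h : i < q.size ℓ then (F.perm (q.size ℓ) K ⟨i, h⟩ : Fin (q.size ℓ)) else i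

/-- Replace a level. -/
def State.setLevel {K : Type} (s : State K q) (p : Fin q.P) (ℓ : Fin q.L)
    (lv : Option (Level K q)) : State K q :=
  { s with level := Function.update s.level p (Function.update (s.level p) ℓ lv) }

/-- Record an observation of the server. -/
def State.emit {K : Type} (s : State K q) (e : List (Event q)) : State K q :=
  { s with trace := s.trace ++ e }

/-- The part of `ReadPartition(p, u)` that concerns level `ℓ`: an unfilled level is skipped; if the
block `u` is in this level, it is fetched, and otherwise the next dummy is. -/
def readLevel (p : Fin q.P) (u : Option (Fin q.N)) (s : State F.Key q) (ℓ : Fin q.L) :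
    State F.Key q :=
  match s.level p ℓ with
  | none => s
  | some lv =>
    match u.map s.pos with
    | some (.server p' ℓ' i) =>
      if p' = p ∧ ℓ' = ℓ then s.emit [.fetch p ℓ {offset F ℓ lv.key i}]
      else (s.setLevel p ℓ (some { lv with cnt := lv.cnt + 1 })).emit
        [.fetch p ℓ {offset F ℓ lv.key lv.cnt}]
    | _ => (s.setLevel p ℓ (some { lv with cnt := lv.cnt + 1 })).emit
        [.fetch p ℓ {offset F ℓ lv.key lv.cnt}]

/-- `ReadPartition(p, u)`; `u = none` is a dummy read. -/
def readPartition (p : Fin q.P) (u : Option (Fin q.N)) (s : State F.Key q) : State F.Key q :=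
  (List.finRange q.L).foldl (readLevel F p u) s

/-- The content of the block at a location of the server. -/
def State.serverData {K : Type} (s : State K q) (p : Fin q.P) (ℓ : Fin q.L) (i : ℕ) : Data q :=
  match (s.level p ℓ).bind (fun lv => lv.blocks[i]?) with
  | some b => b.2
  | none => fun _ => false

/-- The content of the block `u` in slot `p` of the cache. -/
def State.cacheData {K : Type} (s : State K q) (p : Fin q.P) (u : Fin q.N) : Data q :=
  match (s.slot p).find? (fun b => decide (b.1 = u)) with
  | some b => b.2
  | none => fun _ => false

/-- The unread real blocks of level `ℓ` of partition `p`, with their indices: those whose most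
recent version is still in this place according to the position map. -/
def State.unreadReal {K : Type} (s : State K q) (p : Fin q.P) (ℓ : Fin q.L) (lv : Level K q) :
    List (Block q × ℕ) :=
  lv.blocks.zipIdx.filter (fun b => decide (s.pos b.1.1 = .server p ℓ b.2))

/-- The offsets of the blocks that are fetched when level `ℓ` of partition `p` is reshuffled: those
of all unread real blocks, and of as many unread dummies as needed for a total of `q.half ℓ`. -/
def reshuffleOffsets (s : State F.Key q) (p : Fin q.P) (ℓ : Fin q.L) (lv : Level F.Key q) :
    Finset ℕ :=
  let real := s.unreadReal p ℓ lv
  let dummies := List.range' lv.cnt (q.half ℓ - real.length)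
  ((real.map Prod.snd ++ dummies).map (offset F ℓ lv.key)).toFinset

/-- The consecutively filled levels of a partition, from level `0` on. -/
def State.run {K : Type} (s : State K q) (p : Fin q.P) : List (Fin q.L) :=
  (List.finRange q.L).takeWhile (fun ℓ => (s.level p ℓ).isSome)

/-- The level into which a write to partition `p` goes: the first unfilled one, or the top level if
all levels are filled. -/
def State.target {K : Type} (s : State K q) (p : Fin q.P) : Fin q.L :=
  ((List.finRange q.L).find? (fun ℓ => (s.level p ℓ).isNone)).getD q.top

/-- The plaintext of a block: its content, and zeros for a dummy. -/
def blockBits (b : Option (Block q)) : List Bool :=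
  List.ofFn (match b with | some b => b.2 | none => fun _ => false)

/-- An entry of the list of block identifiers of a level, in a fixed number of bits. -/
def idBits (b : Option (Block q)) : List Bool :=
  (List.range q.N.size).map (Nat.testBit (match b with | some b => (b.1 : ℕ) + 1 | none => 0))

/-- The plaintexts of the permuted blocks of a level that holds the real blocks `bs`. -/
def levelPlaintexts (ℓ : Fin q.L) (K : F.Key) (bs : List (Block q)) : List (List Bool) :=
  (List.finRange (q.size ℓ)).map fun o => blockBits bs[((F.perm (q.size ℓ) K).symm o : ℕ)]?

/-- The plaintext of the metadata of a level that holds the real blocks `bs`. -/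
def levelMetadata (ℓ : Fin q.L) (bs : List (Block q)) : List Bool :=
  (List.range (q.size ℓ)).flatMap fun i => idBits bs[i]?

/-- `WritePartition(p, b)`; `b = none` is a dummy write. Blocks in excess of what the target level
can hold stay in the client's cache. -/
noncomputable def writePartition (p : Fin q.P) (b : Option (Block q)) (s : State F.Key q) :
    PMF (State F.Key q) :=
  let run := s.run p
  let tgt := s.target p
  let filled : List (Fin q.L × Level F.Key q) :=
    run.filterMap (fun ℓ => (s.level p ℓ).map (fun lv => (ℓ, lv)))
  let fetches : List (Event q) := filled.flatMap fun x =>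
    [.fetchMeta p x.1, .fetch p x.1 (reshuffleOffsets F s p x.1 x.2)]
  let buffer : List (Block q) :=
    (filled.flatMap fun x => (s.unreadReal p x.1 x.2).map Prod.fst) ++ b.toList
  let kept := buffer.take (q.half tgt)
  let excess := buffer.drop (q.half tgt)
  let pos : Fin q.N → Loc q := fun u =>
    if u ∈ kept.map Prod.fst then .server p tgt ((kept.map Prod.fst).idxOf u)
    else if u ∈ excess.map Prod.fst then .cache p
    else s.pos u
  F.gen.bind fun K => E.gen.bind fun K' =>
    (E.encAll K' (levelPlaintexts F tgt K kept)).bind fun blocks =>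
      (E.enc K' (levelMetadata tgt kept)).map fun metadata =>
        { pos := pos
          slot := Function.update s.slot p (s.slot p ++ excess)
          level := Function.update s.level p fun ℓ =>
            if ℓ = tgt then some { key := K, blocks := kept, cnt := kept.length }
            else if ℓ ∈ run then none
            else s.level p ℓ
          ecnt := s.ecnt
          trace := s.trace ++ fetches ++ [.write p tgt blocks metadata] }

/-- `Evict(p)`: write a block of slot `p` to partition `p`, or a dummy block if the slot is empty. -/
noncomputable def evict (p : Fin q.P) (s : State F.Key q) : PMF (State F.Key q) :=
  match s.slot p with
  | [] => writePartition F E p none s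
  | b :: bs => writePartition F E p (some b) { s with slot := Function.update s.slot p bs }

/-- Scan the next `k` slots and evict from each of them. -/
noncomputable def scan : ℕ → State F.Key q → PMF (State F.Key q)
  | 0, s => PMF.pure s
  | k + 1, s =>
    (evict F E (s.ecnt + 1) { s with ecnt := s.ecnt + 1 }).bind (scan k)

/-- The bounded geometric distribution: `k ∈ {0, …, c}` has probability proportional to `ρ ^ k`. -/
noncomputable def boundedGeometric (q : Params) : PMF (Fin (q.c + 1)) :=
  PMF.normalize (fun k => (q.ρ : ENNReal) ^ (k : ℕ))
    (fun h => by simpa using ENNReal.tsum_eq_zero.1 h 0)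
    (by
      rw [tsum_fintype]
      exact ENNReal.sum_ne_top.2 fun k _ => ENNReal.pow_ne_top ENNReal.coe_ne_top)

/-- `SequentialEvict`. -/
noncomputable def seqEvict (s : State F.Key q) : PMF (State F.Key q) :=
  (boundedGeometric q).bind fun num => scan F E num s

/-- One data request: the new state and the content that the block had before the request. -/
noncomputable def access (y : Request q) (s : State F.Key q) : PMF (State F.Key q × Data q) :=
  (PMF.uniformOfFintype (Fin q.P)).bind fun r =>
    let u := y.id
    let p := (s.pos u).partition
    -- fetch the block and remove it from where it was
    let found : State F.Key q × Data q :=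
      match s.pos u with
      | .cache p =>
        (readPartition F p none
          { s with slot :=
              Function.update s.slot p ((s.slot p).filter fun b => decide (b.1 ≠ u)) },
          s.cacheData p u)
      | .server p ℓ i => (readPartition F p (some u) s, s.serverData p ℓ i)
    let data : Data q := match y with
      | .read _ => found.2
      | .write _ d => d
    -- put it into a fresh random cache slot
    let s₁ : State F.Key q :=
      { found.1 with
        pos := Function.update found.1.pos u (.cache r)
        slot := Function.update found.1.slot r (found.1.slot r ++ [(u, data)]) }
    -- piggy-backed eviction, then background eviction
    ((evict F E p s₁).bind (seqEvict F E)).map fun s₂ => (s₂, found.2)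

/-- The blocks that are assigned to partition `p` initially; they are zeroed. -/
def initialBlocks (a : Fin q.N → Fin q.P) (p : Fin q.P) : List (Block q) :=
  ((List.finRange q.N).filter fun u => decide (a u = p)).map fun u => (u, fun _ => false)

/-- The set of levels that are filled initially: the top level and an arbitrary set of others. -/
def initialFilling (f : Fin q.P → Fin q.n → Bool) (p : Fin q.P) (ℓ : Fin q.L) : Bool :=
  if h : (ℓ : ℕ) < q.n then f p ⟨ℓ, h⟩ else true

/-- Fill level `x.2` of partition `x.1` with the given real blocks, under a fresh key. -/
noncomputable def fillLevel (bs : Fin q.P → Fin q.L → Option (List (Block q))) (s : State F.Key q)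
    (x : Fin q.P × Fin q.L) : PMF (State F.Key q) :=
  match bs x.1 x.2 with
  | none => PMF.pure s
  | some b => F.gen.map fun K =>
      s.setLevel x.1 x.2 (some { key := K, blocks := b, cnt := b.length })

/-- The setup: every block is assigned to an independent uniformly random partition, where it is in
the top level (or in the client's cache, if the top level is full); which of the other levels are
filled (with dummies) is uniformly random. Only the filling is sent to the server. -/
noncomputable def setup (q : Params) : PMF (State F.Key q) :=
  (PMF.uniformOfFintype (Fin q.P → Fin q.n → Bool)).bind fun f =>
    (PMF.uniformOfFintype (Fin q.N → Fin q.P)).bind fun a =>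
      let cap := q.half q.top
      let bs : Fin q.P → Fin q.L → Option (List (Block q)) := fun p ℓ =>
        if ℓ = q.top then some ((initialBlocks a p).take cap)
        else if initialFilling f p ℓ then some []
        else none
      let s₀ : State F.Key q :=
        { pos := fun u =>
            let i := ((initialBlocks a (a u)).map Prod.fst).idxOf u
            if i < cap then .server (a u) q.top i else .cache (a u)
          slot := fun p => (initialBlocks a p).drop cap
          level := fun _ _ => none
          ecnt := 0
          trace := [.filling (initialFilling f)] }
      (List.product (List.finRange q.P) (List.finRange q.L)).foldlM (fillLevel F bs) s₀

/-- The state after a sequence of data requests. -/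
noncomputable def runRequests (q : Params) (y : List (Request q)) : PMF (State F.Key q) :=
  (setup F q).bind fun s =>
    y.foldlM (m := PMF) (fun s y => (access F E y s).map Prod.fst) s

/-- The access pattern `A(y)`: the random sequence of accesses to the server that the request
sequence `y` causes, as a bit string. -/
noncomputable def accessPattern (q : Params) (y : List (Request q)) : PMF (List Bool) :=
  (runRequests F E q y).map fun s => s.trace.flatMap Event.encode

end Client

/-! ## Security of an O-RAM -/

/-- An O-RAM, given by its access patterns `A κ`, is oblivious if for any two sequences of data
requests of the same (polynomial) length the access patterns are computationally
indistinguishable. -/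
def Oblivious {R : ℕ → Type} (A : (κ : ℕ) → List (R κ) → PMF (List Bool)) : Prop :=
  ∀ y z : (κ : ℕ) → List (R κ), (∀ κ, (y κ).length = (z κ).length) →
    PolyBounded (fun κ => (y κ).length) →
    CompIndist (fun κ => A κ (y κ)) (fun κ => A κ (z κ))

end ORAM

/-! The client decides what to access by looking at the position map, the cache, the filling of the
levels and its own coins, never at a key or a ciphertext. Hence the access pattern can be produced
in two stages: draw a random script of accesses, written in terms of indices before permutation, and
then show it to the server under fresh permutations and fresh encryptions (`accessPattern_eq`). The
theorem follows by comparing this with an ideal pattern whose distribution depends only on the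
number of requests.

The comparison is a hybrid argument over the accesses of a script. All blocks written are first
replaced by dummies, at the cost of one encryption advantage per write
(`abs_prob_observe_erase_le`). This comes first because plaintexts are listed in permuted order:
only after it are the ciphertexts independent of the permutation. Then each pseudo-random
permutation is exchanged for a uniform one (`abs_prob_observe_perm_le`); what is seen of a
permutation is whether offsets lie in images of sets, a disjunction of entries of its table, so a
small circuit can reproduce it. In both steps all other randomness is fixed by averaging and
hard-wired, which non-uniform adversaries allow. The total loss is the script length times
negligible advantages.

In the ideal world, suppose that no index of a level is fetched twice between two constructions of
the level. Then a uniform permutation turns the fetched sets into random disjoint sets of the same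
sizes, so the view depends only on the shape of the script: which levels are accessed, and how many
blocks are fetched (`observe_uniformPerm_eq`). The supposition requires that dummies never run out.
The filled levels below level `ℓ` are the digits of a binary counter, which each write that leaves
level `ℓ` alone increments. As the counter stays below `2 ^ ℓ` and every request reads a partition
once and then writes to it, fewer than `2 ^ ℓ` reads have been answered from a level, beyond those
already reflected in its real blocks, when the next read arrives. This is the budget in `Inv`,
preserved by `Inv.afterWrite` and `Inv.afterRead`.

Finally, the shape of a request depends on the request only through the partition of the requested
block. That partition is uniform and is replaced by a fresh uniform one, while evictions never move
a block to another partition. Exchanging the old value with the fresh one shows that successive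
requests visit independent uniform partitions, whatever the requests are (`bind_runShape`). -/

namespace ORAM

/-! ### Probabilities of Boolean tests -/

/-- The probability that the test `g` succeeds on a sample of `X`. -/
noncomputable def prob {α : Type*} (g : α → Bool) (X : PMF α) : ℝ := ((X.map g) true).toReal

theorem prob_map {α β : Type*} (g : β → Bool) (f : α → β) (X : PMF α) :
    prob g (X.map f) = prob (g ∘ f) X := by
  simp only [prob, PMF.map_comp]

theorem prob_nonneg {α : Type*} (g : α → Bool) (X : PMF α) : 0 ≤ prob g X := ENNReal.toReal_nonneg

theorem prob_le_one {α : Type*} (g : α → Bool) (X : PMF α) : prob g X ≤ 1 :=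
  ENNReal.toReal_mono ENNReal.one_ne_top (PMF.coe_le_one _ _)

theorem abs_prob_sub_le_one {α β : Type*} (g : α → Bool) (g' : β → Bool) (X : PMF α) (Y : PMF β) :
    |prob g X - prob g' Y| ≤ 1 := by
  rw [abs_le]
  constructor <;> linarith [prob_nonneg g X, prob_nonneg g' Y, prob_le_one g X, prob_le_one g' Y]

theorem prob_congr {α : Type*} {g g' : α → Bool} {X : PMF α} (h : ∀ a ∈ X.support, g a = g' a) :
    prob g X = prob g' X := by
  have : X.map g = X.map g' := by
    rw [PMF.map, PMF.map]
    ext b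
    simp only [PMF.bind_apply, Function.comp_apply]
    refine tsum_congr fun a => ?_
    by_cases ha : X a = 0
    · simp [ha]
    · rw [h a ((PMF.mem_support_iff _ _).2 ha)]
  rw [prob, this, prob]

theorem summable_toReal {α : Type*} (X : PMF α) : Summable fun a => (X a).toReal :=
  ENNReal.summable_toReal X.tsum_coe_ne_top

theorem tsum_toReal_eq_one {α : Type*} (X : PMF α) : ∑' a, (X a).toReal = 1 := by
  rw [← ENNReal.tsum_toReal_eq fun a => X.apply_ne_top a, X.tsum_coe, ENNReal.toReal_one]

theorem prob_bind {α β : Type*} (g : β → Bool) (X : PMF α) (f : α → PMF β) :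
    prob g (X.bind f) = ∑' a, (X a).toReal * prob g (f a) := by
  simp only [prob, PMF.map_bind, PMF.bind_apply]
  rw [ENNReal.tsum_toReal_eq]
  · simp [ENNReal.toReal_mul]
  · exact fun a => ENNReal.mul_ne_top (X.apply_ne_top a) (PMF.apply_ne_top _ _)

theorem summable_toReal_mul_prob {α β : Type*} (X : PMF α) (g : β → Bool) (f : α → PMF β) :
    Summable fun a => (X a).toReal * prob g (f a) :=
  (summable_toReal X).of_nonneg_of_le
    (fun _ => mul_nonneg ENNReal.toReal_nonneg (prob_nonneg _ _))
    (fun _ => mul_le_of_le_one_right ENNReal.toReal_nonneg (prob_le_one _ _))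

/-- Averaging: tests that differ by at most `δ` for every outcome of `X` differ by at most `δ`. -/
theorem abs_prob_bind_sub_le {α β γ : Type*} {g : β → Bool} {g' : γ → Bool} {X : PMF α}
    {f : α → PMF β} {f' : α → PMF γ} {δ : ℝ}
    (h : ∀ a ∈ X.support, |prob g (f a) - prob g' (f' a)| ≤ δ) :
    |prob g (X.bind f) - prob g' (X.bind f')| ≤ δ := by
  have hle : ∀ a, |(X a).toReal * prob g (f a) - (X a).toReal * prob g' (f' a)|
      ≤ (X a).toReal * δ := by
    intro a
    rw [← mul_sub, abs_mul, abs_of_nonneg ENNReal.toReal_nonneg]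
    by_cases ha : X a = 0
    · simp [ha]
    · exact mul_le_mul_of_nonneg_left (h a ((PMF.mem_support_iff _ _).2 ha)) ENNReal.toReal_nonneg
  have hδ : Summable fun a => (X a).toReal * δ := (summable_toReal X).mul_right δ
  have hd : Summable fun a => |(X a).toReal * prob g (f a) - (X a).toReal * prob g' (f' a)| :=
    hδ.of_nonneg_of_le (fun a => abs_nonneg _) hle
  rw [prob_bind, prob_bind,
    ← (summable_toReal_mul_prob X g f).tsum_sub (summable_toReal_mul_prob X g' f')]
  calc _ ≤ ∑' a, |(X a).toReal * prob g (f a) - (X a).toReal * prob g' (f' a)| := by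
        simpa [Real.norm_eq_abs] using norm_tsum_le_tsum_norm
          (f := fun a => (X a).toReal * prob g (f a) - (X a).toReal * prob g' (f' a)) hd
    _ ≤ ∑' a, (X a).toReal * δ := hd.tsum_le_tsum hle hδ
    _ = δ := by rw [tsum_mul_right, tsum_toReal_eq_one, one_mul]

/-! ### Negligible functions -/

theorem Negligible.of_abs_le {f g : ℕ → ℝ} (hf : Negligible f) (h : ∀ κ, |g κ| ≤ f κ) :
    Negligible g :=
  Asymptotics.SuperpolynomialDecay.trans_abs_le hf fun κ => (h κ).trans (le_abs_self _)

theorem Negligible.poly_mul {f : ℕ → ℝ} (hf : Negligible f) {m : ℕ → ℕ} (hm : PolyBounded m)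
    (h0 : ∀ κ, 0 ≤ f κ) : Negligible fun κ => (m κ : ℝ) * f κ := by
  obtain ⟨r, hr⟩ := hm
  refine Negligible.of_abs_le
    (Asymptotics.SuperpolynomialDecay.polynomial_mul hf (r.map (Nat.castRingHom ℝ))) fun κ => ?_
  rw [abs_of_nonneg (mul_nonneg (Nat.cast_nonneg _) (h0 κ))]
  refine mul_le_mul_of_nonneg_right ?_ (h0 κ)
  rw [Polynomial.eval_natCast_map]
  exact Nat.cast_le.2 (hr κ)

/-- If every choice of elements of the sets `S κ` gives a negligible function, then there is a
negligible bound that holds for all the elements at once. -/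
theorem exists_negligible_bound {ι : ℕ → Type*} (S : ∀ κ, Set (ι κ)) (f : ∀ κ, ι κ → ℝ)
    (h0 : ∀ κ x, 0 ≤ f κ x) (h1 : ∀ κ x, f κ x ≤ 1) (hne : ∀ κ, (S κ).Nonempty)
    (H : ∀ x : ∀ κ, ι κ, (∀ κ, x κ ∈ S κ) → Negligible fun κ => f κ (x κ)) :
    ∃ δ : ℕ → ℝ, Negligible δ ∧ (∀ κ, 0 ≤ δ κ) ∧ ∀ κ, ∀ x ∈ S κ, f κ x ≤ δ κ := by
  -- The supremum over `S κ` need not be attained, but some element reaches half of it. The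
  -- resulting factor 2 is harmless for negligibility.
  have key : ∀ κ, ∃ x ∈ S κ, ∀ y ∈ S κ, f κ y ≤ 2 * f κ x := by
    intro κ
    have hb : BddAbove (f κ '' S κ) := ⟨1, by rintro _ ⟨x, _, rfl⟩; exact h1 κ x⟩
    by_contra! hc
    obtain ⟨x₀, hx₀⟩ := hne κ
    obtain ⟨y₀, hy₀, hxy⟩ := hc x₀ hx₀
    have hpos : 0 < sSup (f κ '' S κ) := lt_of_lt_of_le
      (lt_of_le_of_lt (mul_nonneg zero_le_two (h0 κ x₀)) hxy) (le_csSup hb ⟨y₀, hy₀, rfl⟩)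
    obtain ⟨_, ⟨x, hx, rfl⟩, hlt⟩ :=
      exists_lt_of_lt_csSup ((hne κ).image _) (half_lt_self hpos)
    obtain ⟨y, hy, hlt'⟩ := hc x hx
    have := le_csSup hb ⟨y, hy, rfl⟩
    linarith
  choose x hx hmax using key
  refine ⟨fun κ => 2 * f κ (x κ), ?_, fun κ => mul_nonneg zero_le_two (h0 κ _), hmax⟩
  exact Asymptotics.SuperpolynomialDecay.const_mul (H x hx) 2

/-! ### Polynomially bounded functions -/

theorem PolyBounded.mono {f g : ℕ → ℕ} (hg : PolyBounded g) (h : ∀ κ, f κ ≤ g κ) :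
    PolyBounded f := hg.imp fun _ hr κ => (h κ).trans (hr κ)

theorem PolyBounded.const (c : ℕ) : PolyBounded fun _ => c := ⟨Polynomial.C c, by simp⟩

theorem PolyBounded.add {f g : ℕ → ℕ} (hf : PolyBounded f) (hg : PolyBounded g) :
    PolyBounded fun κ => f κ + g κ := by
  obtain ⟨r, hr⟩ := hf
  obtain ⟨s, hs⟩ := hg
  exact ⟨r + s, fun κ => by rw [Polynomial.eval_add]; exact add_le_add (hr κ) (hs κ)⟩

theorem PolyBounded.mul {f g : ℕ → ℕ} (hf : PolyBounded f) (hg : PolyBounded g) :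
    PolyBounded fun κ => f κ * g κ := by
  obtain ⟨r, hr⟩ := hf
  obtain ⟨s, hs⟩ := hg
  exact ⟨r * s, fun κ => by rw [Polynomial.eval_mul]; exact Nat.mul_le_mul (hr κ) (hs κ)⟩

/-! ### Circuits -/

theorem Circuit.values_concat (C : Circuit) (g : Wire × Wire) (x : List Bool) :
    Circuit.values (C ++ [g]) x =
      C.values x ++ [!(g.1.read x (C.values x) && g.2.read x (C.values x))] := by
  simp [Circuit.values]

theorem Circuit.length_values (C : Circuit) (x : List Bool) : (C.values x).length = C.length := by
  induction C using List.reverseRecOn with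
  | nil => rfl
  | append_singleton C g ih => simp [Circuit.values_concat, ih]

theorem Circuit.values_append (C D : Circuit) (x : List Bool) :
    ∃ vs, Circuit.values (C ++ D) x = C.values x ++ vs := by
  induction D using List.reverseRecOn with
  | nil => exact ⟨[], by simp⟩
  | append_singleton D g ih =>
    obtain ⟨vs, h⟩ := ih
    rw [← List.append_assoc, Circuit.values_concat, h, List.append_assoc]
    exact ⟨_, rfl⟩

/-- The wire `w` carries the value of `g` in the circuit `D` and in all its extensions. -/
def Carries (D : Circuit) (w : Wire) (g : List Bool → Bool) : Prop :=
  ∀ x vs, w.read x (D.values x ++ vs) = g x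

/-- Some wire carries the value of `g` in the circuit `D`. -/
def Avail (D : Circuit) (g : List Bool → Bool) : Prop := ∃ w, Carries D w g

theorem Avail.append {D : Circuit} {g : List Bool → Bool} (h : Avail D g) (D' : Circuit) :
    Avail (D ++ D') g := by
  obtain ⟨w, hw⟩ := h
  refine ⟨w, fun x vs => ?_⟩
  obtain ⟨us, hu⟩ := Circuit.values_append D D' x
  rw [hu, List.append_assoc]
  exact hw x _

theorem avail_input (D : Circuit) (i : ℕ) : Avail D fun x => x.getD i false :=
  ⟨.input i, fun _ _ => rfl⟩

theorem Avail.nand {D : Circuit} {g g' : List Bool → Bool} (h : Avail D g) (h' : Avail D g') :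
    ∃ e, Avail (D ++ [e]) fun x => !(g x && g' x) := by
  obtain ⟨w, hw⟩ := h
  obtain ⟨w', hw'⟩ := h'
  refine ⟨(w, w'), .gate D.length, fun x vs => ?_⟩
  have h1 := hw x []
  have h2 := hw' x []
  rw [List.append_nil] at h1 h2
  rw [Circuit.values_concat, Wire.read, List.append_assoc,
    List.getD_append_right _ _ _ _ (Circuit.length_values D x).le, Circuit.length_values]
  simp [h1, h2]

/-- The circuit `D` provides both constants. -/
def HasConsts (D : Circuit) : Prop := ∀ b, Avail D fun _ => b

theorem HasConsts.append {D : Circuit} (h : HasConsts D) (D' : Circuit) : HasConsts (D ++ D') :=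
  fun b => (h b).append D'

/-- A circuit has no constant gates, but the NAND of an input bit and its negation is `true`,
whatever the bit is, and the NAND of `true` with itself is `false`. -/
theorem exists_hasConsts : ∃ D : Circuit, D.length = 3 ∧ HasConsts D := by
  obtain ⟨e₁, h₁⟩ := (avail_input [] 0).nand (avail_input [] 0)
  obtain ⟨e₂, h₂⟩ := ((avail_input [] 0).append [e₁]).nand h₁
  obtain ⟨e₃, h₃⟩ := h₂.nand h₂
  refine ⟨[e₁, e₂, e₃], rfl, fun b => ?_⟩
  cases b
  · simpa using h₃
  · simpa using h₂.append [e₃]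

theorem Avail.or {D : Circuit} {g g' : List Bool → Bool} (h : Avail D g) (h' : Avail D g') :
    ∃ D' : Circuit, D'.length = 3 ∧ Avail (D ++ D') fun x => g x || g' x := by
  obtain ⟨e₁, h₁⟩ := h.nand h
  obtain ⟨e₂, h₂⟩ := (h'.append [e₁]).nand (h'.append [e₁])
  obtain ⟨e₃, h₃⟩ := (h₁.append [e₂]).nand h₂
  refine ⟨[e₁, e₂, e₃], rfl, ?_⟩
  simpa using h₃

/-- Each disjunction costs three gates by de Morgan. The constants serve the empty list. -/
theorem HasConsts.any {D : Circuit} (hD : HasConsts D) {ι : Type*} (l : List ι)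
    (g : ι → List Bool → Bool) (hg : ∀ i ∈ l, Avail D (g i)) :
    ∃ D' : Circuit, D'.length ≤ 3 * l.length ∧ Avail (D ++ D') fun x => l.any fun i => g i x := by
  induction l with
  | nil => exact ⟨[], by simp, by simpa using hD false⟩
  | cons i l ih =>
    obtain ⟨D₁, h₁, h₁'⟩ := ih fun j hj => hg j (List.mem_cons_of_mem _ hj)
    obtain ⟨D₂, h₂, h₂'⟩ := ((hg i List.mem_cons_self).append D₁).or h₁'
    refine ⟨D₁ ++ D₂, by simp; omega, ?_⟩
    simpa [List.any_cons] using h₂'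

/-- A circuit can be composed with a transformation of its input all of whose bits are available
in some other circuit. -/
theorem exists_comp_circuit (C D : Circuit) (h : List Bool → List Bool)
    (hD : ∀ j, Avail D fun x => (h x).getD j false) :
    ∃ C' : Circuit, C'.length ≤ D.length + C.length ∧ ∀ x, C'.eval x = C.eval (h x) := by
  choose w hw using hD
  -- Inputs of `C` are redirected to the wires of `D` that carry the transformed bits, and gate
  -- numbers are shifted past `D`.
  let sub : Wire → Wire := fun a => match a with
    | .input j => w j
    | .gate j => .gate (D.length + j)
  have key : ∀ (C : Circuit) (x : List Bool),
      Circuit.values (D ++ C.map fun g => (sub g.1, sub g.2)) x = D.values x ++ C.values (h x) := by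
    intro C x
    induction C using List.reverseRecOn with
    | nil => simp [Circuit.values]
    | append_singleton C g ih =>
      have hs : ∀ a : Wire, (sub a).read x (D.values x ++ Circuit.values C (h x)) =
          a.read (h x) (Circuit.values C (h x)) := by
        rintro (j | j)
        · exact hw j x _
        · change (D.values x ++ _).getD (D.length + j) false = _
          rw [List.getD_append_right _ _ _ _ (by rw [Circuit.length_values]; omega),
            Circuit.length_values, Nat.add_sub_cancel_left]
          rfl
      rw [List.map_append, ← List.append_assoc, List.map_singleton, Circuit.values_concat,
        Circuit.values_concat, ih, hs, hs, List.append_assoc]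
  -- The empty circuit outputs `false`, whereas appending nothing to `D` would output the last gate
  -- of `D`.
  by_cases hC : C = []
  · exact ⟨[], by simp, fun x => by simp [hC, Circuit.eval, Circuit.values]⟩
  · refine ⟨D ++ C.map fun g => (sub g.1, sub g.2), le_of_eq (by simp), fun x => ?_⟩
    rw [Circuit.eval, key, Circuit.eval]
    have hne : C.values (h x) ≠ [] := by
      rw [← List.length_pos_iff, Circuit.length_values]
      exact List.length_pos_iff.2 hC
    rw [List.getLastD_eq_getLast?, List.getLastD_eq_getLast?, List.getLast?_append,
      List.getLast?_eq_some_getLast hne]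
    rfl

/-- Hard-wiring a prefix and a suffix around an input of length `m`. -/
theorem exists_hardwired_circuit (C : Circuit) (pre suf : List Bool) (m : ℕ) :
    ∃ C' : Circuit, C'.length ≤ C.length + 3 ∧
      ∀ x : List Bool, x.length = m → C'.eval x = C.eval (pre ++ x ++ suf) := by
  obtain ⟨D, hD, hc⟩ := exists_hasConsts
  obtain ⟨C', h₁, h₂⟩ := exists_comp_circuit C D
    -- The input is cut or padded to exactly `m` bits, so that every position of the result has a
    -- fixed source: a constant or one input bit.
    (fun x => pre ++ (List.range m).map (fun i => x.getD i false) ++ suf) (by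
      intro j
      by_cases h1 : j < pre.length
      · convert hc (pre.getD j false) using 2 with x
        rw [List.append_assoc, List.getD_append _ _ _ _ h1]
      · by_cases h2 : j - pre.length < m
        · convert avail_input D (j - pre.length) using 2 with x
          rw [List.append_assoc, List.getD_append_right _ _ _ _ (by omega),
            List.getD_append _ _ _ _ (by simpa using h2)]
          simp [List.getD_eq_getElem?_getD, h2]
        · convert hc (suf.getD (j - pre.length - m) false) using 2 with x
          rw [List.append_assoc, List.getD_append_right _ _ _ _ (by omega),
            List.getD_append_right _ _ _ _ (by simpa using h2)]
          simp)
  refine ⟨C', by omega, fun x hx => ?_⟩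
  rw [h₂]
  congr 3
  subst hx
  apply List.ext_getElem <;> simp +contextual [List.getD_eq_getElem?_getD]

section Observation

/-! ### Scripts of server accesses -/

/-- An access to the server in terms of the indices of the blocks, before they are permuted and
encrypted. Here `fill` stands for the choice of a key in the setup, which the server does not
see. -/
inductive Op (q : Params) where
  | filling (f : Fin q.P → Fin q.L → Bool)
  | fill (p : Fin q.P) (ℓ : Fin q.L)
  | fetchMeta (p : Fin q.P) (ℓ : Fin q.L)
  | fetch (p : Fin q.P) (ℓ : Fin q.L) (I : Finset ℕ)
  | write (p : Fin q.P) (ℓ : Fin q.L) (bs : List (Block q))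

/-- The action of a permutation of an initial segment on all natural numbers. -/
def permOffset {m : ℕ} (σ : Equiv.Perm (Fin m)) (i : ℕ) : ℕ :=
  if h : i < m then (σ ⟨i, h⟩ : Fin m) else i

variable {q : Params}

/-- The permutations of all the levels. -/
abbrev Perms (q : Params) := (p : Fin q.P) → (ℓ : Fin q.L) → Equiv.Perm (Fin (q.size ℓ))

/-- Replace the permutation of one level. -/
def Perms.set (π : Perms q) (p : Fin q.P) (ℓ : Fin q.L) (σ : Equiv.Perm (Fin (q.size ℓ))) :
    Perms q :=
  Function.update π p (Function.update (π p) ℓ σ)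

theorem Perms.set_self (π : Perms q) (p ℓ) (σ) : π.set p ℓ σ p ℓ = σ := by simp [Perms.set]

theorem Perms.set_of_ne (π : Perms q) {p p' ℓ ℓ'} (σ) (h : ¬(p' = p ∧ ℓ' = ℓ)) :
    π.set p ℓ σ p' ℓ' = π p' ℓ' := by
  by_cases hp : p' = p
  · subst hp
    simp [Perms.set, Function.update_of_ne (fun hl => h ⟨rfl, hl⟩)]
  · simp [Perms.set, hp]

theorem Perms.set_set (π : Perms q) (p ℓ) (σ σ') : (π.set p ℓ σ).set p ℓ σ' = π.set p ℓ σ' := by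
  simp [Perms.set]

theorem Perms.set_comm (π : Perms q) {p p' ℓ ℓ'} (σ σ') (h : ¬(p' = p ∧ ℓ' = ℓ)) :
    (π.set p ℓ σ).set p' ℓ' σ' = (π.set p' ℓ' σ').set p ℓ σ := by
  funext a b
  by_cases h₁ : a = p ∧ b = ℓ
  · obtain ⟨rfl, rfl⟩ := h₁
    rw [Perms.set_self, Perms.set_of_ne _ _ fun h' => h ⟨h'.1.symm, h'.2.symm⟩, Perms.set_self]
  · rw [Perms.set_of_ne _ σ h₁]
    by_cases h₂ : a = p' ∧ b = ℓ'
    · obtain ⟨rfl, rfl⟩ := h₂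
      rw [Perms.set_self, Perms.set_self]
    · rw [Perms.set_of_ne _ σ' h₂, Perms.set_of_ne _ σ' h₂, Perms.set_of_ne _ σ h₁]

/-- The plaintexts that are written when a level is constructed: blocks and metadata. -/
def plaintexts (ℓ : Fin q.L) (σ : Equiv.Perm (Fin (q.size ℓ))) (bs : List (Block q)) :
    List (List Bool) :=
  ((List.finRange (q.size ℓ)).map fun o => blockBits bs[(σ.symm o : ℕ)]?) ++ [levelMetadata ℓ bs]

/-- The bits written when a level is constructed. -/
noncomputable def levelCipher (E : SymEnc) (ℓ : Fin q.L) (σ : Equiv.Perm (Fin (q.size ℓ)))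
    (bs : List (Block q)) : PMF (List Bool) :=
  E.gen.bind fun K => (E.encAll K (plaintexts ℓ σ bs)).map List.flatten

/-- The distribution of the bits that the server observes in a script, if fresh permutations of
level `ℓ` are drawn from `D ℓ`. -/
noncomputable def observe (E : SymEnc) (D : (ℓ : Fin q.L) → PMF (Equiv.Perm (Fin (q.size ℓ)))) :
    List (Op q) → Perms q → PMF (List Bool)
  | [], _ => PMF.pure []
  | .filling f :: os, π => (observe E D os π).map ((Event.filling f).encode ++ ·)
  | .fill p ℓ :: os, π => (D ℓ).bind fun σ => observe E D os (π.set p ℓ σ)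
  | .fetchMeta p ℓ :: os, π => (observe E D os π).map ((Event.fetchMeta p ℓ).encode ++ ·)
  | .fetch p ℓ I :: os, π =>
    (observe E D os π).map ((Event.fetch p ℓ (I.image (permOffset (π p ℓ)))).encode ++ ·)
  | .write p ℓ bs :: os, π => (D ℓ).bind fun σ => (levelCipher E ℓ σ bs).bind fun ct =>
    (observe E D os (π.set p ℓ σ)).map fun x => (Event.write p ℓ [ct] []).encode ++ x

/-- Forget the blocks that are written. -/
def Op.erase : Op q → Op q
  | .write p ℓ _ => .write p ℓ []
  | o => o

theorem encode_write_append (p : Fin q.P) (ℓ : Fin q.L) (ct x : List Bool) :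
    (Event.write p ℓ [ct] []).encode ++ x = (Event.write p ℓ [] []).encode ++ ct ++ x := by
  simp [Event.encode]

theorem SymEnc.encAll_concat (E : SymEnc) (K : E.Key) (ms : List (List Bool)) (m : List Bool) :
    E.encAll K (ms ++ [m]) =
      (E.encAll K ms).bind fun cs => (E.enc K m).map fun c => cs ++ [c] := by
  induction ms with
  | nil => simp [SymEnc.encAll, PMF.pure_bind, PMF.map, Function.comp_def]
  | cons m' ms ih =>
    simp only [List.cons_append, SymEnc.encAll, ih, PMF.map_bind, PMF.bind_bind, PMF.bind_map,
      PMF.map_comp, Function.comp_def]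

theorem SymEnc.length_flatten_encAll (E : SymEnc) (K : E.Key) (ms : List (List Bool)) :
    ∀ cs ∈ (E.encAll K ms).support, cs.flatten.length = (ms.map fun m => E.clen m.length).sum := by
  induction ms with
  | nil => simp [SymEnc.encAll]
  | cons m ms ih =>
    intro cs hcs
    simp only [SymEnc.encAll, PMF.mem_support_bind_iff, PMF.mem_support_map_iff] at hcs
    obtain ⟨c, hc, cs', hcs', rfl⟩ := hcs
    simp [ih cs' hcs', E.length_enc K m c hc]

/-- Dummies are encoded in as many bits as real blocks, and identifiers in a fixed number of bits.
This makes the contents of any two levels of the same size admissible in the definition of secure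
encryption. -/
theorem map_length_plaintexts (ℓ : Fin q.L) (σ σ' : Equiv.Perm (Fin (q.size ℓ)))
    (bs bs' : List (Block q)) :
    (plaintexts ℓ σ bs).map List.length = (plaintexts ℓ σ' bs').map List.length := by
  simp [plaintexts, blockBits, levelMetadata, idBits, Function.comp_def]

theorem length_plaintexts (ℓ : Fin q.L) (σ : Equiv.Perm (Fin (q.size ℓ))) (bs : List (Block q)) :
    (plaintexts ℓ σ bs).length = q.size ℓ + 1 := by
  simp [plaintexts]

theorem length_flatten_plaintexts (ℓ : Fin q.L) (σ : Equiv.Perm (Fin (q.size ℓ)))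
    (bs : List (Block q)) :
    (plaintexts ℓ σ bs).flatten.length = q.size ℓ * q.B + q.size ℓ * q.N.size := by
  simp [plaintexts, blockBits, levelMetadata, idBits, Function.comp_def, List.length_flatten]

/-- A fixed length of the ciphertexts places all later bits at fixed positions, which is what
hard-wiring a suffix requires. -/
theorem length_levelCipher (E : SymEnc) (ℓ : Fin q.L) : ∃ m : ℕ, ∀ σ (bs : List (Block q)),
    ∀ ct ∈ (levelCipher E ℓ σ bs).support, ct.length = m := by
  refine ⟨((plaintexts ℓ 1 ([] : List (Block q))).map fun m => E.clen m.length).sum,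
    fun σ bs ct hct => ?_⟩
  simp only [levelCipher, PMF.mem_support_bind_iff, PMF.mem_support_map_iff] at hct
  obtain ⟨K, -, cs, hcs, rfl⟩ := hct
  rw [E.length_flatten_encAll K _ cs hcs]
  have h : ∀ ms : List (List Bool),
      (ms.map fun m => E.clen m.length) = (ms.map List.length).map E.clen := by simp
  rw [h, h, map_length_plaintexts ℓ σ 1 bs []]

/-! ### Replacing the blocks by zeros -/

/-- The circuit `C` after a fixed prefix has nearly the same acceptance probability on two
distributions of cipher texts that are followed by the same further bits. -/
theorem abs_prob_cipher_bind_le {E : SymEnc} {C : Circuit} {δ : ℝ} {ℓ : Fin q.L}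
    {σ : Equiv.Perm (Fin (q.size ℓ))} {bs bs' : List (Block q)}
    (h : ∀ C' : Circuit, C'.length ≤ C.length + 3 →
      |acceptProb C' (levelCipher E ℓ σ bs) - acceptProb C' (levelCipher E ℓ σ bs')| ≤ δ)
    (pre : List Bool) (X : PMF (List Bool)) :
    |prob (fun x => C.eval (pre ++ x)) ((levelCipher E ℓ σ bs).bind fun ct => X.map (ct ++ ·))
      - prob (fun x => C.eval (pre ++ x)) ((levelCipher E ℓ σ bs').bind fun ct => X.map (ct ++ ·))|
      ≤ δ := by
  -- The ciphertext and the later bits are independent, so the later bits may be drawn first and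
  -- then be fixed by averaging.
  have hc : ∀ bs, ((levelCipher E ℓ σ bs).bind fun ct => X.map (ct ++ ·)) =
      X.bind fun x => (levelCipher E ℓ σ bs).map (· ++ x) := by
    intro bs
    simp only [PMF.map]
    rw [PMF.bind_comm]
    rfl
  obtain ⟨m, hm⟩ := length_levelCipher E ℓ
  rw [hc, hc]
  refine abs_prob_bind_sub_le fun x _ => ?_
  obtain ⟨C', hC', hev⟩ := exists_hardwired_circuit C pre x m
  have hp : ∀ bs, prob (fun x => C.eval (pre ++ x)) ((levelCipher E ℓ σ bs).map (· ++ x)) =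
      acceptProb C' (levelCipher E ℓ σ bs) := by
    intro bs
    rw [prob_map]
    refine prob_congr fun ct hct => ?_
    rw [hev ct (hm σ bs ct hct)]
    simp
  rw [hp, hp]
  exact h C' hC'

/-- Each construction of a level uses its own encryption key, which plays no role in the rest of the
observation. Hence the ciphertexts can be replaced one write at a time. The hypothesis is uniform in
the permutation, so that the permutation may be fixed beforehand; `pre` collects the bits observed
so far. -/
theorem abs_prob_observe_erase_le {E : SymEnc} {C : Circuit} {δ : ℝ}
    (D : (ℓ : Fin q.L) → PMF (Equiv.Perm (Fin (q.size ℓ))))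
    (h : ∀ C' : Circuit, C'.length ≤ C.length + 3 → ∀ (ℓ : Fin q.L) σ bs,
      |acceptProb C' (levelCipher E ℓ σ bs) - acceptProb C' (levelCipher E ℓ σ [])| ≤ δ)
    (h0 : 0 ≤ δ) (os : List (Op q)) (π : Perms q) (pre : List Bool) :
    |prob (fun x => C.eval (pre ++ x)) (observe E D os π)
      - prob (fun x => C.eval (pre ++ x)) (observe E D (os.map Op.erase) π)| ≤ os.length * δ := by
  induction os generalizing π pre with
  | nil => simp [observe]
  | cons o os ih =>
    have hle : (os.length : ℝ) * δ ≤ ((o :: os).length : ℝ) * δ := by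
      refine mul_le_mul_of_nonneg_right ?_ h0
      simp
    have hmap : ∀ (w : List Bool) (π : Perms q),
        |prob (fun x => C.eval (pre ++ x)) ((observe E D os π).map (w ++ ·))
        - prob (fun x => C.eval (pre ++ x)) ((observe E D (os.map Op.erase) π).map (w ++ ·))|
        ≤ os.length * δ := by
      intro w π
      rw [prob_map, prob_map]
      simpa [Function.comp_def] using ih π (pre ++ w)
    cases o with
    | filling f => exact (hmap _ _).trans hle
    | fetchMeta p ℓ => exact (hmap _ _).trans hle
    | fetch p ℓ I => exact (hmap _ _).trans hle
    | fill p ℓ => exact (abs_prob_bind_sub_le fun σ _ => ih _ _).trans hle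
    | write p ℓ bs =>
      refine abs_prob_bind_sub_le fun σ _ => ?_
      -- First the current ciphertext is replaced while the later writes stay real; the later ones
      -- are then left to the induction hypothesis.
      have h₁ : |prob (fun x => C.eval (pre ++ x)) ((levelCipher E ℓ σ bs).bind fun ct =>
            (observe E D os (π.set p ℓ σ)).map fun x => (Event.write p ℓ [ct] []).encode ++ x)
          - prob (fun x => C.eval (pre ++ x)) ((levelCipher E ℓ σ []).bind fun ct =>
            (observe E D os (π.set p ℓ σ)).map fun x => (Event.write p ℓ [ct] []).encode ++ x)|
          ≤ δ := by
        have := abs_prob_cipher_bind_le (fun C' hC' => h C' hC' ℓ σ bs)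
          (pre ++ (Event.write p ℓ [] []).encode) (observe E D os (π.set p ℓ σ))
        have he : ∀ bs, prob (fun x => C.eval (pre ++ (Event.write p ℓ [] []).encode ++ x))
              ((levelCipher E ℓ σ bs).bind fun ct => (observe E D os (π.set p ℓ σ)).map (ct ++ ·)) =
            prob (fun x => C.eval (pre ++ x)) ((levelCipher E ℓ σ bs).bind fun ct =>
              (observe E D os (π.set p ℓ σ)).map fun x =>
                (Event.write p ℓ [ct] []).encode ++ x) := by
          intro bs
          simp only [encode_write_append, prob_bind, prob_map, Function.comp_def,
            List.append_assoc]
        rwa [he, he] at this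
      have h₂ : |prob (fun x => C.eval (pre ++ x)) ((levelCipher E ℓ σ []).bind fun ct =>
            (observe E D os (π.set p ℓ σ)).map fun x => (Event.write p ℓ [ct] []).encode ++ x)
          - prob (fun x => C.eval (pre ++ x)) ((levelCipher E ℓ σ []).bind fun ct =>
            (observe E D (os.map Op.erase) (π.set p ℓ σ)).map fun x =>
              (Event.write p ℓ [ct] []).encode ++ x)| ≤ os.length * δ :=
        abs_prob_bind_sub_le fun ct _ => hmap _ _
      refine (abs_sub_le _ _ _).trans ((add_le_add h₁ h₂).trans (le_of_eq ?_))
      push_cast [List.length_cons]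
      ring

/-! ### Replacing the pseudo-random permutations by random ones -/

theorem getD_flatten {m : ℕ} (l : List (List Bool)) (hl : ∀ a ∈ l, a.length = m) (i o : ℕ)
    (ho : o < m) : l.flatten.getD (i * m + o) false = (l.getD i []).getD o false := by
  induction l generalizing i with
  | nil => simp
  | cons a l ih =>
    have ha : a.length = m := hl a List.mem_cons_self
    cases i with
    | zero =>
      rw [List.flatten_cons, List.getD_append _ _ _ _ (by omega)]
      simp
    | succ i =>
      rw [List.flatten_cons, List.getD_append_right _ _ _ _ (by rw [ha, Nat.succ_mul]; omega), ha,
        show (i + 1) * m + o - m = i * m + o by rw [Nat.succ_mul]; omega,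
        ih (fun b hb => hl b (List.mem_cons_of_mem _ hb))]
      rfl

theorem getD_permTable {m : ℕ} (σ : Equiv.Perm (Fin m)) (i : Fin m) (o : ℕ) (ho : o < m) :
    (permTable σ).getD (i * m + o) false = decide (permOffset σ i = o) := by
  rw [permTable, List.flatMap_def, getD_flatten _ (by simp [oneHot]) _ _ ho]
  simp [oneHot, permOffset, List.getD_eq_getElem?_getD, ho, eq_comm]

/-- A bit of what the server observes, as it depends on the permutation of one level: a constant,
or the information whether an offset belongs to a set of indices. -/
abbrev SymBit := Bool ⊕ (Finset ℕ × ℕ)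

/-- The value of a bit for a given permutation. -/
def SymBit.value {m : ℕ} (σ : Equiv.Perm (Fin m)) : SymBit → Bool
  | .inl b => b
  | .inr (I, o) => decide (o ∈ I.image (permOffset σ))

/-- An offset lies in the image of `I` if and only if, for some `i` in `I`, the table of the
permutation has its bit set in row `i` at that offset: a disjunction of at most `m` input bits. -/
theorem SymBit.exists_avail {m : ℕ} {D : Circuit} (hD : HasConsts D) (b : SymBit) :
    ∃ (D' : Circuit) (g : List Bool → Bool),
      D'.length ≤ (if b.isRight then 3 * m else 0) ∧ Avail (D ++ D') g ∧
      ∀ (σ : Equiv.Perm (Fin m)), (∀ I o, b = .inr (I, o) → o < m) →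
        g (permTable σ) = b.value σ := by
  rcases b with b | ⟨I, o⟩
  · exact ⟨[], fun _ => b, by simp, by simpa using hD b, fun σ _ => rfl⟩
  · obtain ⟨D', h₁, h₂⟩ := hD.any ((List.finRange m).filter fun i : Fin m => decide ((i : ℕ) ∈ I))
      (fun i x => x.getD (i * m + o) false) (fun i _ => avail_input D _)
    have hlen := List.length_filter_le (fun i : Fin m => decide ((i : ℕ) ∈ I)) (List.finRange m)
    rw [List.length_finRange] at hlen
    -- `permOffset` fixes all numbers from `m` on. An index outside the domain could therefore only
    -- produce an offset outside the domain, and then the claim about the value is vacuous.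
    by_cases hex : ∃ i ∈ I, m ≤ i ∧ i = o
    · refine ⟨[], fun _ => true, by simp, by simpa using hD true, fun σ ho => ?_⟩
      obtain ⟨i, _, hmi, rfl⟩ := hex
      exact absurd (ho _ _ rfl) (by omega)
    · refine ⟨D', _, by simp; omega, h₂, fun σ ho => ?_⟩
      have ho' : o < m := ho _ _ rfl
      simp only [getD_permTable _ _ _ ho', SymBit.value]
      rw [Bool.eq_iff_iff]
      simp only [List.any_eq_true, List.mem_filter, List.mem_finRange, true_and,
        decide_eq_true_eq, Finset.mem_image]
      constructor
      · rintro ⟨i, hi, h⟩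
        exact ⟨i, hi, h⟩
      · rintro ⟨i, hi, h⟩
        by_cases him : i < m
        · exact ⟨⟨i, him⟩, hi, h⟩
        · rw [permOffset, dif_neg him] at h
          exact absurd ⟨i, hi, by omega, h⟩ hex

/-- Constant bits need no new gates. The size thus involves only the bits that depend on the
permutation, and no bound on the length of the ciphertexts is needed. -/
theorem exists_symBits_circuit {m : ℕ} (z : List SymBit)
    (hz : ∀ I o, Sum.inr (I, o) ∈ z → o < m) (D : Circuit) (hD : HasConsts D) :
    ∃ (D' : Circuit) (h : List Bool → List Bool), D'.length ≤ (z.countP (·.isRight)) * (3 * m) ∧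
      (∀ j, Avail (D ++ D') fun x => (h x).getD j false) ∧
      ∀ σ : Equiv.Perm (Fin m), h (permTable σ) = z.map (SymBit.value σ) := by
  induction z with
  | nil => exact ⟨[], fun _ => [], by simp, fun j => by simpa using hD false, by simp⟩
  | cons b z ih =>
    obtain ⟨D₁, h, h₁, h₂, h₃⟩ := ih fun I o hI => hz I o (List.mem_cons_of_mem _ hI)
    obtain ⟨D₂, g, g₁, g₂, g₃⟩ := SymBit.exists_avail (m := m) (hD.append D₁) b
    refine ⟨D₁ ++ D₂, fun x => g x :: h x, ?_, ?_, fun σ => ?_⟩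
    · rw [List.length_append, List.countP_cons, Nat.add_mul]
      refine Nat.add_le_add h₁ (g₁.trans (le_of_eq ?_))
      split_ifs <;> simp
    · intro j
      rw [← List.append_assoc]
      cases j with
      | zero => simpa using g₂
      | succ j => simpa using (h₂ j).append D₂
    · change g _ :: h _ = _
      rw [h₃, List.map_cons, g₃ σ fun I o hI => hz I o (hI ▸ List.mem_cons_self)]

/-- What the server observes is, as a function of the current permutation of one level, given by a
random list of simple bits. -/
theorem exists_symBits_observe (E : SymEnc)
    (D : (ℓ : Fin q.L) → PMF (Equiv.Perm (Fin (q.size ℓ)))) (p₀ : Fin q.P) (ℓ₀ : Fin q.L)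
    (os : List (Op q)) (π : Perms q) :
    ∃ Z : PMF (List SymBit),
      (∀ z ∈ Z.support, z.countP (·.isRight) ≤ os.length * q.size ℓ₀ ∧
        ∀ I o, Sum.inr (I, o) ∈ z → o < q.size ℓ₀) ∧
      ∀ σ, observe E D os (π.set p₀ ℓ₀ σ) = Z.map (List.map (SymBit.value σ)) := by
  -- This covers what does not depend on `σ` at all, in particular everything after level `ℓ₀` of
  -- partition `p₀` has been constructed anew and `σ` is forgotten.
  have hconst : ∀ (X : PMF (List Bool)) (n : ℕ), (∀ z ∈ (X.map (List.map Sum.inl) :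
      PMF (List SymBit)).support, z.countP (·.isRight) ≤ n ∧
        ∀ I o, Sum.inr (I, o) ∈ z → o < q.size ℓ₀) ∧
      ∀ σ : Equiv.Perm (Fin (q.size ℓ₀)),
        X = (X.map (List.map Sum.inl)).map (List.map (SymBit.value σ)) := by
    intro X n
    refine ⟨fun z hz => ?_, fun σ => ?_⟩
    · rw [PMF.mem_support_map_iff] at hz
      obtain ⟨x, -, rfl⟩ := hz
      simp [List.countP_map, Function.comp_def]
    · rw [PMF.map_comp]
      convert (PMF.map_id X).symm
      simp [Function.comp_def, SymBit.value]
      rfl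
  induction os generalizing π with
  | nil => exact ⟨_, hconst (PMF.pure []) _⟩
  | cons o os ih =>
    have hprep : ∀ (w : List SymBit), w.countP (·.isRight) ≤ q.size ℓ₀ →
        (∀ I o, Sum.inr (I, o) ∈ w → o < q.size ℓ₀) → ∃ Z : PMF (List SymBit),
        (∀ z ∈ Z.support, z.countP (·.isRight) ≤ (o :: os).length * q.size ℓ₀ ∧
          ∀ I o, Sum.inr (I, o) ∈ z → o < q.size ℓ₀) ∧
        ∀ σ, (observe E D os (π.set p₀ ℓ₀ σ)).map (w.map (SymBit.value σ) ++ ·) =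
          Z.map (List.map (SymBit.value σ)) := by
      intro w hw hw'
      obtain ⟨Z, h₁, h₂⟩ := ih π
      refine ⟨Z.map (w ++ ·), fun z hz => ?_, fun σ => ?_⟩
      · rw [PMF.mem_support_map_iff] at hz
        obtain ⟨z, hz, rfl⟩ := hz
        refine ⟨?_, fun I o hI => ?_⟩
        · rw [List.countP_append, List.length_cons, Nat.succ_mul, Nat.add_comm]
          exact Nat.add_le_add (h₁ z hz).1 hw
        · rcases List.mem_append.1 hI with hI | hI
          exacts [hw' I o hI, (h₁ z hz).2 I o hI]
      · rw [h₂ σ, PMF.map_comp, PMF.map_comp]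
        simp [Function.comp_def]
    have hprep' : ∀ (w : List Bool), ∃ Z : PMF (List SymBit),
        (∀ z ∈ Z.support, z.countP (·.isRight) ≤ (o :: os).length * q.size ℓ₀ ∧
          ∀ I o, Sum.inr (I, o) ∈ z → o < q.size ℓ₀) ∧
        ∀ σ, (observe E D os (π.set p₀ ℓ₀ σ)).map (w ++ ·) =
          Z.map (List.map (SymBit.value σ)) := by
      intro w
      have := hprep (w.map Sum.inl) (by simp [List.countP_map, Function.comp_def]) (by simp)
      simpa [Function.comp_def, SymBit.value] using this
    have hmono : os.length * q.size ℓ₀ ≤ (o :: os).length * q.size ℓ₀ :=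
      Nat.mul_le_mul_right _ (by simp)
    cases o with
    | filling f => exact hprep' _
    | fetchMeta p ℓ => exact hprep' _
    | fetch p ℓ I =>
      by_cases h : p = p₀ ∧ ℓ = ℓ₀
      · obtain ⟨rfl, rfl⟩ := h
        -- A fetch from the level in question has one bit for each offset that depends on `σ`; its
        -- header is constant.
        have := hprep ((([true, true, false] ++ oneHot q.P p ++ oneHot q.L ℓ).map Sum.inl) ++
          (List.range (q.size ℓ)).map fun o => Sum.inr (I, o))
          (by
            rw [List.countP_append]
            refine (Nat.add_le_add (le_of_eq (List.countP_eq_zero.2 ?_)) List.countP_le_length).trans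
              (by simp)
            simp only [List.mem_map]
            rintro _ ⟨b, -, rfl⟩
            simp)
          (by simp +contextual)
        simpa [observe, Event.encode, Perms.set_self, Function.comp_def, SymBit.value] using this
      · have := hprep' (Event.fetch p ℓ (I.image (permOffset (π p ℓ)))).encode
        simpa only [observe, Perms.set_of_ne _ _ h] using this
    | fill p ℓ =>
      by_cases h : p = p₀ ∧ ℓ = ℓ₀
      · obtain ⟨rfl, rfl⟩ := h
        simp only [observe, Perms.set_set]
        exact ⟨_, hconst _ _⟩
      · simp only [observe]
        choose Z h₁ h₂ using fun σ => ih (π.set p ℓ σ)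
        refine ⟨(D ℓ).bind Z, fun z hz => ?_, fun σ => ?_⟩
        · rw [PMF.mem_support_bind_iff] at hz
          obtain ⟨σ, -, hz⟩ := hz
          exact ⟨(h₁ σ z hz).1.trans hmono, (h₁ σ z hz).2⟩
        · simp only [PMF.map_bind, ← h₂]
          congr 1
          funext σ'
          rw [Perms.set_comm _ _ _ h]
    | write p ℓ bs =>
      by_cases h : p = p₀ ∧ ℓ = ℓ₀
      · obtain ⟨rfl, rfl⟩ := h
        simp only [observe, Perms.set_set]
        exact ⟨_, hconst _ _⟩
      · simp only [observe]
        choose Z h₁ h₂ using fun σ => ih (π.set p ℓ σ)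
        refine ⟨(D ℓ).bind fun σ => (levelCipher E ℓ σ bs).bind fun ct =>
          (Z σ).map (((Event.write p ℓ [ct] []).encode.map Sum.inl) ++ ·),
          fun z hz => ?_, fun σ => ?_⟩
        · simp only [PMF.mem_support_bind_iff, PMF.mem_support_map_iff] at hz
          obtain ⟨σ, -, ct, -, z, hz, rfl⟩ := hz
          refine ⟨?_, fun I o hI => (h₁ σ z hz).2 I o (by simpa using hI)⟩
          rw [List.countP_append, List.countP_map]
          simpa [Function.comp_def] using (h₁ σ z hz).1.trans hmono
        · simp only [PMF.map_bind, PMF.map_comp]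
          congr 1
          funext σ'
          congr 1
          funext ct
          rw [Perms.set_comm _ _ _ h, h₂, PMF.map_comp]
          simp [Function.comp_def, SymBit.value]

/-- Only one draw of a permutation changes here. The symbolic description of the later bits is
independent of that draw and can be fixed by averaging; the circuit then recomputes the bits from
the table. At most `n * M` of them are not constant, each costs at most `3 * M` gates, and the
constants cost 3. -/
theorem abs_prob_bind_perm_le {E : SymEnc} {C : Circuit} {δ : ℝ} {M n : ℕ}
    {D D₁ D₂ : (ℓ : Fin q.L) → PMF (Equiv.Perm (Fin (q.size ℓ)))} (hM : ∀ ℓ, q.size ℓ ≤ M)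
    (h : ∀ C' : Circuit, C'.length ≤ C.length + 3 + n * M * (3 * M) → ∀ ℓ,
      |acceptProb C' ((D₁ ℓ).map permTable) - acceptProb C' ((D₂ ℓ).map permTable)| ≤ δ)
    (p : Fin q.P) (ℓ : Fin q.L) (os : List (Op q)) (hn : os.length ≤ n) (π : Perms q)
    (pre : List Bool) :
    |prob (fun x => C.eval (pre ++ x)) ((D₁ ℓ).bind fun σ => observe E D os (π.set p ℓ σ))
      - prob (fun x => C.eval (pre ++ x)) ((D₂ ℓ).bind fun σ => observe E D os (π.set p ℓ σ))|
      ≤ δ := by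
  obtain ⟨Z, h₁, h₂⟩ := exists_symBits_observe E D p ℓ os π
  have hc : ∀ X : PMF (Equiv.Perm (Fin (q.size ℓ))),
      (X.bind fun σ => observe E D os (π.set p ℓ σ)) =
        Z.bind fun z => X.map fun σ => z.map (SymBit.value σ) := by
    intro X
    simp only [h₂, PMF.map]
    rw [PMF.bind_comm]
    rfl
  rw [hc, hc]
  refine abs_prob_bind_sub_le fun z hz => ?_
  obtain ⟨D₀, hl₀, hD₀⟩ := exists_hasConsts
  obtain ⟨D', t, hl, hav, ht⟩ := exists_symBits_circuit (m := q.size ℓ)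
    (pre.map Sum.inl ++ z) (fun I o hI => (h₁ z hz).2 I o (by simpa using hI)) D₀ hD₀
  obtain ⟨C', hC', hev⟩ := exists_comp_circuit C _ t hav
  have hp : ∀ X : PMF (Equiv.Perm (Fin (q.size ℓ))),
      prob (fun x => C.eval (pre ++ x)) (X.map fun σ => z.map (SymBit.value σ)) =
        acceptProb C' (X.map permTable) := by
    intro X
    change _ = prob _ _
    rw [prob_map, prob_map]
    refine prob_congr fun σ _ => ?_
    simp [hev, ht, Function.comp_def, SymBit.value]
  rw [hp, hp]
  refine h C' (hC'.trans ?_) ℓ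
  have hcount : (pre.map Sum.inl ++ z : List SymBit).countP (·.isRight) ≤ n * M := by
    rw [List.countP_append, List.countP_map]
    simpa [Function.comp_def] using
      (h₁ z hz).1.trans (Nat.mul_le_mul hn (hM ℓ))
  have := hl.trans (Nat.mul_le_mul hcount (Nat.mul_le_mul_left 3 (hM ℓ)))
  rw [List.length_append]
  omega

/-- At a fresh draw, the later draws are exchanged first by the induction hypothesis, and then the
draw itself, followed by an observation that already uses `D₂`. -/
theorem abs_prob_observe_perm_le {E : SymEnc} {C : Circuit} {δ : ℝ} {M n : ℕ}
    {D₁ D₂ : (ℓ : Fin q.L) → PMF (Equiv.Perm (Fin (q.size ℓ)))} (hM : ∀ ℓ, q.size ℓ ≤ M)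
    (h : ∀ C' : Circuit, C'.length ≤ C.length + 3 + n * M * (3 * M) → ∀ ℓ,
      |acceptProb C' ((D₁ ℓ).map permTable) - acceptProb C' ((D₂ ℓ).map permTable)| ≤ δ)
    (h0 : 0 ≤ δ) (os : List (Op q)) (hn : os.length ≤ n) (π : Perms q) (pre : List Bool) :
    |prob (fun x => C.eval (pre ++ x)) (observe E D₁ (os.map Op.erase) π)
      - prob (fun x => C.eval (pre ++ x)) (observe E D₂ (os.map Op.erase) π)|
      ≤ os.length * δ := by
  induction os generalizing π pre with
  | nil => simp [observe]
  | cons o os ih =>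
    have hn' : os.length ≤ n := (Nat.le_succ _).trans hn
    have hle : (os.length : ℝ) * δ ≤ ((o :: os).length : ℝ) * δ := by
      refine mul_le_mul_of_nonneg_right ?_ h0
      simp
    have hmap : ∀ (w : List Bool) (π : Perms q),
        |prob (fun x => C.eval (pre ++ x)) ((observe E D₁ (os.map Op.erase) π).map (w ++ ·))
        - prob (fun x => C.eval (pre ++ x)) ((observe E D₂ (os.map Op.erase) π).map (w ++ ·))|
        ≤ os.length * δ := by
      intro w π
      rw [prob_map, prob_map]
      simpa [Function.comp_def] using ih hn' π (pre ++ w)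
    have hbind : ∀ (p ℓ) (pre : List Bool),
        |prob (fun x => C.eval (pre ++ x))
            ((D₁ ℓ).bind fun σ => observe E D₁ (os.map Op.erase) (π.set p ℓ σ))
          - prob (fun x => C.eval (pre ++ x))
            ((D₂ ℓ).bind fun σ => observe E D₂ (os.map Op.erase) (π.set p ℓ σ))|
        ≤ (o :: os).length * δ := by
      intro p ℓ pre
      have h₁ := abs_prob_bind_sub_le (X := D₁ ℓ) fun σ _ => ih hn' (π.set p ℓ σ) pre
      have h₂ := abs_prob_bind_perm_le (E := E) (D := D₂) hM h p ℓ (os.map Op.erase)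
        (by simpa using hn') π pre
      refine (abs_sub_le _ _ _).trans ((add_le_add h₁ h₂).trans (le_of_eq ?_))
      push_cast [List.length_cons]
      ring
    cases o with
    | filling f => exact (hmap _ _).trans hle
    | fetchMeta p ℓ => exact (hmap _ _).trans hle
    | fetch p ℓ I => exact (hmap _ _).trans hle
    | fill p ℓ => exact hbind p ℓ pre
    | write p ℓ bs =>
      -- With no real blocks the plaintexts are the same for every permutation. The ciphertext is
      -- then independent of `σ` and can be drawn before it; this is why the blocks had to be erased
      -- first.
      have hc : ∀ D : (ℓ : Fin q.L) → PMF (Equiv.Perm (Fin (q.size ℓ))),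
          observe E D ((Op.write p ℓ bs :: os).map Op.erase) π =
            (levelCipher E ℓ 1 []).bind fun ct =>
              ((D ℓ).bind fun σ => observe E D (os.map Op.erase) (π.set p ℓ σ)).map
                fun x => (Event.write p ℓ [ct] []).encode ++ x := by
        intro D
        simp only [PMF.map_bind]
        rw [PMF.bind_comm]
        rfl
      rw [hc, hc]
      refine abs_prob_bind_sub_le fun ct _ => ?_
      rw [prob_map, prob_map]
      simpa [Function.comp_def] using hbind p ℓ (pre ++ (Event.write p ℓ [ct] []).encode)

end Observation

section Uniform

variable {q : Params}

/-! ### Scripts under uniformly random permutations -/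

/-- The set of indices of each level that may not be fetched any more. -/
abbrev Used (q : Params) := Fin q.P → Fin q.L → Set ℕ

/-- Replace the set of a level. -/
def Used.set (U : Used q) (p : Fin q.P) (ℓ : Fin q.L) (S : Set ℕ) : Used q :=
  fun p' ℓ' => if p' = p ∧ ℓ' = ℓ then S else U p' ℓ'

/-- The sets of used indices after an access. -/
def Op.use (U : Used q) : Op q → Used q
  | .fill p ℓ => U.set p ℓ ∅
  | .write p ℓ _ => U.set p ℓ ∅
  | .fetch p ℓ I => U.set p ℓ (U p ℓ ∪ I)
  | _ => U

/-- The access only fetches indices of the level that have not been used yet. -/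
def Op.Fresh (U : Used q) : Op q → Prop
  | .fetch p ℓ I => Disjoint (I : Set ℕ) (U p ℓ) ∧ ∀ i ∈ I, i < q.size ℓ
  | _ => True

/-- No index is fetched twice before the level is constructed again. -/
def FreshScript : Used q → List (Op q) → Prop
  | _, [] => True
  | U, o :: os => o.Fresh U ∧ FreshScript (o.use U) os

theorem Used.set_mono {U V : Used q} (h : U ≤ V) (p ℓ) {S T : Set ℕ} (hST : S ⊆ T) :
    U.set p ℓ S ≤ V.set p ℓ T := by
  intro p' ℓ'
  unfold Used.set
  split_ifs
  exacts [hST, h p' ℓ']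

theorem Op.use_mono {U V : Used q} (h : U ≤ V) (o : Op q) : o.use U ≤ o.use V := by
  cases o with
  | filling => exact h
  | fetchMeta => exact h
  | fill p ℓ => exact Used.set_mono h p ℓ subset_rfl
  | write p ℓ => exact Used.set_mono h p ℓ subset_rfl
  | fetch p ℓ I => exact Used.set_mono h p ℓ (Set.union_subset_union_left _ (h p ℓ))

theorem FreshScript.anti {U V : Used q} (h : U ≤ V) {os : List (Op q)} (hV : FreshScript V os) :
    FreshScript U os := by
  induction os generalizing U V with
  | nil => trivial
  | cons o os ih =>
    refine ⟨?_, ih (Op.use_mono h o) hV.2⟩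
    have := hV.1
    cases o with
    | fetch p ℓ I => exact ⟨this.1.mono_right (h p ℓ), this.2⟩
    | _ => trivial

theorem FreshScript.append {U : Used q} {os os' : List (Op q)} (h : FreshScript U os)
    (h' : FreshScript (os.foldl Op.use U) os') : FreshScript U (os ++ os') := by
  induction os generalizing U with
  | nil => exact h'
  | cons o os ih => exact ⟨h.1, ih h.2 h'⟩

/-- The sets of indices that are fetched from a level before it is constructed again. -/
def fetched (p : Fin q.P) (ℓ : Fin q.L) : List (Op q) → List (Finset ℕ)
  | [] => []
  | .fill p' ℓ' :: os => if p = p' ∧ ℓ = ℓ' then [] else fetched p ℓ os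
  | .write p' ℓ' _ :: os => if p = p' ∧ ℓ = ℓ' then [] else fetched p ℓ os
  | .fetch p' ℓ' I :: os => if p = p' ∧ ℓ = ℓ' then I :: fetched p ℓ os else fetched p ℓ os
  | _ :: os => fetched p ℓ os

/-- The part of an access that is determined by the filling of the levels. -/
def Op.shape : Op q → Op q
  | .write p ℓ _ => .write p ℓ []
  | .fetch p ℓ I => .fetch p ℓ (Finset.range I.card)
  | o => o

/-- Every fetched set joins the used ones, from which all later sets up to the next construction
must be disjoint. -/
theorem FreshScript.fetched {U : Used q} {os : List (Op q)} (h : FreshScript U os) (p ℓ) :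
    (∀ I ∈ fetched p ℓ os, Disjoint (I : Set ℕ) (U p ℓ) ∧ ∀ i ∈ I, i < q.size ℓ) ∧
      (fetched p ℓ os).Pairwise Disjoint := by
  induction os generalizing U with
  | nil => simp [ORAM.fetched]
  | cons o os ih =>
    have hi := ih h.2
    cases o with
    | filling => exact hi
    | fetchMeta => exact hi
    | fill p' ℓ' =>
      by_cases hc : p = p' ∧ ℓ = ℓ'
      · simp [ORAM.fetched, hc]
      · simpa [ORAM.fetched, hc, Op.use, Used.set] using hi
    | write p' ℓ' =>
      by_cases hc : p = p' ∧ ℓ = ℓ'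
      · simp [ORAM.fetched, hc]
      · simpa [ORAM.fetched, hc, Op.use, Used.set] using hi
    | fetch p' ℓ' I =>
      by_cases hc : p = p' ∧ ℓ = ℓ'
      · obtain ⟨rfl, rfl⟩ := hc
        have h1 := h.1
        simp only [Op.Fresh] at h1
        simp only [Op.use, Used.set, and_self, if_true, Set.disjoint_union_right,
          Finset.disjoint_coe] at hi
        simp only [ORAM.fetched, and_self, if_true, List.mem_cons, List.pairwise_cons]
        refine ⟨?_, fun J hJ => (hi.1 J hJ).1.2.symm, hi.2⟩
        rintro J (rfl | hJ)
        exacts [h1, ⟨(hi.1 J hJ).1.1, (hi.1 J hJ).2⟩]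
      · simpa [ORAM.fetched, hc, Op.use, Used.set] using hi

theorem map_card_fetched {os os' : List (Op q)} (h : os.map Op.shape = os'.map Op.shape) (p ℓ) :
    (fetched p ℓ os).map Finset.card = (fetched p ℓ os').map Finset.card := by
  induction os generalizing os' with
  | nil =>
    obtain rfl : os' = [] := by simpa using h.symm
    rfl
  | cons o os ih =>
    cases os' with
    | nil => simp at h
    | cons o' os' =>
      simp only [List.map_cons, List.cons.injEq] at h
      have hi := ih h.2
      have h1 := h.1
      cases o <;> cases o' <;>
        simp only [Op.shape, Op.fetch.injEq, Op.write.injEq, Op.fill.injEq, reduceCtorEq] at h1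
      · exact hi
      · obtain ⟨rfl, rfl⟩ := h1
        simp only [fetched]
        split_ifs <;> simp [hi]
      · exact hi
      · obtain ⟨rfl, rfl, h1⟩ := h1
        have h1' := congrArg Finset.card h1
        simp only [Finset.card_range] at h1'
        simp only [fetched]
        split_ifs <;> simp [hi, h1']
      · obtain ⟨rfl, rfl, -⟩ := h1
        simp only [fetched]
        split_ifs <;> simp [hi]

/-! ### Permutations that match families of disjoint sets -/

theorem permOffset_of_lt {m : ℕ} (σ : Equiv.Perm (Fin m)) {i : ℕ} (h : i < m) :
    permOffset σ i = σ ⟨i, h⟩ := dif_pos h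

theorem permOffset_mul {m : ℕ} (σ τ : Equiv.Perm (Fin m)) (i : ℕ) :
    permOffset (σ * τ) i = permOffset σ (permOffset τ i) := by
  by_cases h : i < m
  · simp [permOffset_of_lt, h]
  · simp [permOffset, h]

/-- A permutation that is right on the tail is corrected at the head by one transposition. The tail
is not disturbed: its images avoid `a'` because `l'` has no duplicates, and avoid the image of `a`
by injectivity. -/
theorem exists_perm_map_eq {m : ℕ} (l l' : List ℕ) (hl : l.Nodup) (hl' : l'.Nodup)
    (hlt : ∀ i ∈ l, i < m) (hlt' : ∀ i ∈ l', i < m) (hlen : l.length = l'.length) :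
    ∃ τ : Equiv.Perm (Fin m), l.map (permOffset τ) = l' := by
  induction l generalizing l' with
  | nil => exact ⟨1, by simpa using hlen.symm⟩
  | cons a l ih =>
    cases l' with
    | nil => simp at hlen
    | cons a' l' =>
      rw [List.nodup_cons] at hl hl'
      simp only [List.mem_cons, forall_eq_or_imp] at hlt hlt'
      obtain ⟨τ, hτ⟩ := ih l' hl.2 hl'.2 hlt.2 hlt'.2 (by simpa using hlen)
      refine ⟨Equiv.swap (τ ⟨a, hlt.1⟩) ⟨a', hlt'.1⟩ * τ, ?_⟩
      simp only [List.map_cons, List.cons.injEq]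
      constructor
      · simp [permOffset_of_lt _ hlt.1]
      · refine Eq.trans (List.map_congr_left fun i hi => ?_) hτ
        have him := hlt.2 i hi
        have hmem : permOffset τ i ∈ l' := hτ ▸ List.mem_map_of_mem hi
        rw [permOffset_of_lt _ him] at hmem
        rw [permOffset_of_lt _ him, permOffset_of_lt _ him, Equiv.Perm.mul_apply,
          Equiv.swap_apply_of_ne_of_ne]
        · rw [Ne, τ.injective.eq_iff, Fin.mk.injEq]
          rintro rfl
          exact hl.1 hi
        · intro h
          rw [h] at hmem
          exact hl'.1 hmem

/-- Disjoint sets can be mapped to disjoint sets of the same sizes by one permutation. -/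
theorem exists_perm_image_eq {m : ℕ} (Is Js : List (Finset ℕ)) (hI : ∀ I ∈ Is, ∀ i ∈ I, i < m)
    (hJ : ∀ J ∈ Js, ∀ i ∈ J, i < m) (hId : Is.Pairwise Disjoint) (hJd : Js.Pairwise Disjoint)
    (hcard : Is.map Finset.card = Js.map Finset.card) :
    ∃ τ : Equiv.Perm (Fin m), Is.map (Finset.image (permOffset τ)) = Js := by
  have hnd : ∀ Is : List (Finset ℕ), Is.Pairwise Disjoint → (Is.flatMap Finset.toList).Nodup := by
    intro Is h
    rw [List.nodup_flatMap]
    refine ⟨fun I _ => I.nodup_toList, h.imp fun {I J} hIJ => ?_⟩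
    intro i hi hj
    exact Finset.disjoint_left.1 hIJ (Finset.mem_toList.1 hi) (Finset.mem_toList.1 hj)
  have hlen : ∀ Is : List (Finset ℕ),
      (Is.flatMap Finset.toList).length = (Is.map Finset.card).sum := by
    intro Is
    simp [List.length_flatMap]
  -- Disjointness makes the concatenated lists of elements free of duplicates, and equal
  -- cardinalities let both be cut at the same places afterwards.
  obtain ⟨τ, hτ⟩ := exists_perm_map_eq (m := m) _ _ (hnd Is hId) (hnd Js hJd)
    (by simpa using fun i I hI' hi => hI I hI' i hi)
    (by simpa using fun i I hI' hi => hJ I hI' i hi) (by rw [hlen, hlen, hcard])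
  refine ⟨τ, ?_⟩
  clear hI hJ hId hJd
  induction Is generalizing Js with
  | nil => simpa using hcard.symm
  | cons I Is ih =>
    cases Js with
    | nil => simp at hcard
    | cons J Js =>
      simp only [List.map_cons, List.cons.injEq, List.flatMap_cons, List.map_append] at hcard hτ ⊢
      obtain ⟨h₁, h₂⟩ := List.append_inj hτ (by simpa using hcard.1)
      refine ⟨?_, ih Js hcard.2 h₂⟩
      ext j
      rw [← Finset.mem_toList (s := J), ← h₁]
      simp

/-- The uniform distribution on the permutations of the levels. -/
noncomputable def uniformPerm (ℓ : Fin q.L) : PMF (Equiv.Perm (Fin (q.size ℓ))) :=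
  PMF.uniformOfFintype _

theorem PMF_map_uniformOfFintype_equiv {α β : Type*} [Fintype α] [Nonempty α] [Fintype β]
    [Nonempty β] (e : α ≃ β) :
    (PMF.uniformOfFintype α).map e = PMF.uniformOfFintype β := by
  classical
  ext b
  rw [PMF.map_apply, tsum_eq_single (e.symm b)]
  · simp [Fintype.card_congr e]
  · intro a ha
    rw [if_neg]
    rintro rfl
    simp at ha

/-- The observations of a fresh script with random permutations depend only on its shape. -/
theorem observe_uniformPerm_eq (E : SymEnc) {os os' : List (Op q)}
    (h : os.map Op.shape = os'.map Op.shape) {U U' : Used q} (hU : FreshScript U os)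
    (hU' : FreshScript U' os') (π π' : Perms q)
    (hπ : ∀ p ℓ, (fetched p ℓ os).map (Finset.image (permOffset (π p ℓ))) =
      (fetched p ℓ os').map (Finset.image (permOffset (π' p ℓ)))) :
    observe E uniformPerm (os.map Op.erase) π = observe E uniformPerm (os'.map Op.erase) π' := by
  induction os generalizing os' U U' π π' with
  | nil =>
    obtain rfl : os' = [] := by simpa using h.symm
    rfl
  | cons o os ih =>
    cases os' with
    | nil => simp at h
    | cons o' os' =>
      simp only [List.map_cons, List.cons.injEq] at h
      have h1 := h.1
      -- The coupling at a fresh draw: `τ` carries the sets that `os` will fetch from this level to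
      -- those that `os'` will fetch. With `σ * τ` on one side and `σ` on the other, both have the
      -- same images, which restores the hypothesis on `π` and `π'`.
      have hredraw : ∀ p ℓ, (∀ p' ℓ', ¬(p' = p ∧ ℓ' = ℓ) →
            (fetched p' ℓ' os).map (Finset.image (permOffset (π p' ℓ'))) =
            (fetched p' ℓ' os').map (Finset.image (permOffset (π' p' ℓ')))) →
          ∃ τ : Equiv.Perm (Fin (q.size ℓ)), ∀ σ,
            observe E uniformPerm (os.map Op.erase) (π.set p ℓ (σ * τ)) =
            observe E uniformPerm (os'.map Op.erase) (π'.set p ℓ σ) := by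
        intro p ℓ hother
        have hf := hU.2.fetched p ℓ
        have hf' := hU'.2.fetched p ℓ
        obtain ⟨τ, hτ⟩ := exists_perm_image_eq (m := q.size ℓ) _ _ (fun I hI => (hf.1 I hI).2)
          (fun I hI => (hf'.1 I hI).2) hf.2 hf'.2 (map_card_fetched h.2 p ℓ)
        refine ⟨τ, fun σ => ih h.2 hU.2 hU'.2 _ _ fun p' ℓ' => ?_⟩
        by_cases hp : p' = p ∧ ℓ' = ℓ
        · obtain ⟨rfl, rfl⟩ := hp
          rw [Perms.set_self, Perms.set_self, ← hτ, List.map_map]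
          refine List.map_congr_left fun I _ => ?_
          rw [Function.comp_apply, Finset.image_image]
          exact Finset.image_congr fun i _ => permOffset_mul σ τ i
        · rw [Perms.set_of_ne _ _ hp, Perms.set_of_ne _ _ hp]
          exact hother p' ℓ' hp
      -- Right multiplication preserves the uniform distribution, so replacing `σ` by `σ * τ` on one
      -- side costs nothing.
      have hbind : ∀ (ℓ) (τ : Equiv.Perm (Fin (q.size ℓ)))
          (f : Equiv.Perm (Fin (q.size ℓ)) → PMF (List Bool)),
          (uniformPerm ℓ).bind f = (uniformPerm ℓ).bind fun σ => f (σ * τ) := by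
        intro ℓ τ f
        have := PMF_map_uniformOfFintype_equiv (Equiv.mulRight τ)
        rw [uniformPerm, ← this, PMF.bind_map, this]
        rfl
      cases o <;> cases o' <;>
        simp only [Op.shape, Op.fetch.injEq, Op.write.injEq, Op.fill.injEq, Op.filling.injEq,
          Op.fetchMeta.injEq, reduceCtorEq] at h1
      · subst h1
        simp only [List.map_cons, Op.erase, observe]
        rw [ih h.2 hU.2 hU'.2 π π' hπ]
      · obtain ⟨rfl, rfl⟩ := h1
        rename_i p ℓ
        obtain ⟨τ, hτ⟩ := hredraw p ℓ fun p' ℓ' hp => by simpa [fetched, hp] using hπ p' ℓ'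
        simp only [List.map_cons, Op.erase, observe]
        rw [hbind ℓ τ]
        simp only [hτ]
      · obtain ⟨rfl, rfl⟩ := h1
        simp only [List.map_cons, Op.erase, observe]
        rw [ih h.2 hU.2 hU'.2 π π' hπ]
      · obtain ⟨rfl, rfl, -⟩ := h1
        rename_i p ℓ I I'
        have hπ' : ∀ p' ℓ', (fetched p' ℓ' os).map (Finset.image (permOffset (π p' ℓ'))) =
            (fetched p' ℓ' os').map (Finset.image (permOffset (π' p' ℓ'))) := by
          intro p' ℓ'
          have := hπ p' ℓ'
          simp only [fetched] at this
          split_ifs at this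
          · simp only [List.map_cons, List.cons.injEq] at this
            exact this.2
          · exact this
        have hI := hπ p ℓ
        simp only [fetched, and_self, if_true, List.map_cons, List.cons.injEq] at hI
        simp only [List.map_cons, Op.erase, observe]
        rw [ih h.2 hU.2 hU'.2 π π' hπ', hI.1]
      · obtain ⟨rfl, rfl, -⟩ := h1
        rename_i p ℓ _ _
        obtain ⟨τ, hτ⟩ := hredraw p ℓ fun p' ℓ' hp => by simpa [fetched, hp] using hπ p' ℓ'
        simp only [List.map_cons, Op.erase, observe]
        rw [hbind ℓ τ]
        simp only [hτ]
        rfl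

/-- Before any level is filled, no set but the empty one is fresh. -/
theorem observe_uniformPerm_eq_of_univ (E : SymEnc) {os os' : List (Op q)}
    (h : os.map Op.shape = os'.map Op.shape) (hU : FreshScript (fun _ _ => Set.univ) os)
    (hU' : FreshScript (fun _ _ => Set.univ) os') (π : Perms q) :
    observe E uniformPerm (os.map Op.erase) π = observe E uniformPerm (os'.map Op.erase) π := by
  refine observe_uniformPerm_eq E h hU hU' π π fun p ℓ => ?_
  -- When every index counts as used, only empty sets can be fetched before the first construction,
  -- so that any initial permutations satisfy the coupling hypothesis.
  have hempty : ∀ os : List (Op q), FreshScript (fun _ _ => Set.univ) os →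
      (fetched p ℓ os).map (Finset.image (permOffset (π p ℓ))) =
        List.replicate ((fetched p ℓ os).map Finset.card).length ∅ := by
    intro os hU
    rw [List.eq_replicate_iff]
    refine ⟨by simp, fun J hJ => ?_⟩
    obtain ⟨I, hI, rfl⟩ := List.mem_map.1 hJ
    have := ((hU.fetched p ℓ).1 I hI).1
    simp only [Set.disjoint_univ, Finset.coe_eq_empty] at this
    simp [this]
  rw [hempty os hU, hempty os' hU', map_card_fetched h]

end Uniform

/-! ### Separating the client's control flow from keys and cipher texts -/

section Client

variable {K : Type} {q : Params}

/-- The unread real blocks of a level; none if the level is unfilled. -/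
def State.unread (s : State K q) (p : Fin q.P) (ℓ : Fin q.L) : List (Block q × ℕ) :=
  (s.level p ℓ).elim [] (s.unreadReal p ℓ)

/-- The index of the next unread dummy of a level. -/
def State.count (s : State K q) (p : Fin q.P) (ℓ : Fin q.L) : ℕ := (s.level p ℓ).elim 0 Level.cnt

/-- The index of the block `v` in the level `ℓ` of partition `p`, if it is there. -/
def State.hit (s : State K q) (v : Option (Fin q.N)) (p : Fin q.P) (ℓ : Fin q.L) : Option ℕ :=
  match v.map s.pos with
  | some (.server p' ℓ' i) => if p' = p ∧ ℓ' = ℓ then some i else none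
  | _ => none

/-- The effect of reading the block `v` on a level that is known to be filled or not. -/
def readEffect (h : Option ℕ) (lv : Level K q) : Level K q :=
  if h.isSome then lv else { lv with cnt := lv.cnt + 1 }

/-- The levels after reading the block `v` from the levels `ls` of partition `p`. -/
def State.levelsAfterRead (s : State K q) (v : Option (Fin q.N)) (p : Fin q.P)
    (ls : List (Fin q.L)) (p' : Fin q.P) (ℓ : Fin q.L) : Option (Level K q) :=
  if p' = p ∧ ℓ ∈ ls then (s.level p ℓ).map (readEffect (s.hit v p ℓ)) else s.level p' ℓ

/-- The real blocks that are collected by a write. -/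
def State.buffer (s : State K q) (p : Fin q.P) (b : Option (Block q)) : List (Block q) :=
  ((s.run p).flatMap fun ℓ => (s.unread p ℓ).map Prod.fst) ++ b.toList

/-- The blocks that a write puts into the target level. -/
def State.kept (s : State K q) (p : Fin q.P) (b : Option (Block q)) : List (Block q) :=
  (s.buffer p b).take (q.half (s.target p))

/-- The blocks that exceed the capacity of the target level of a write. -/
def State.excess (s : State K q) (p : Fin q.P) (b : Option (Block q)) : List (Block q) :=
  (s.buffer p b).drop (q.half (s.target p))

/-- The position map after a write. -/
def State.posAfterWrite (s : State K q) (p : Fin q.P) (b : Option (Block q)) (u : Fin q.N) :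
    Loc q :=
  if u ∈ (s.kept p b).map Prod.fst then
    .server p (s.target p) (((s.kept p b).map Prod.fst).idxOf u)
  else if u ∈ (s.excess p b).map Prod.fst then .cache p
  else s.pos u

/-- The state after a write, apart from the trace; `k` is the new key. -/
def State.afterWrite (s : State K q) (p : Fin q.P) (b : Option (Block q)) (k : K) : State K q :=
  { s with
    pos := s.posAfterWrite p b
    slot := Function.update s.slot p (s.slot p ++ s.excess p b)
    level := Function.update s.level p fun ℓ =>
      if ℓ = s.target p then
        some { key := k, blocks := s.kept p b, cnt := (s.kept p b).length }
      else if ℓ ∈ s.run p then none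
      else s.level p ℓ }

/-- Remove the first block of a slot. -/
def State.pop (s : State K q) (p : Fin q.P) : State K q :=
  { s with slot := Function.update s.slot p (s.slot p).tail }

/-- The cache slots after the block `u` has been removed. -/
def State.slotWithout (s : State K q) (u : Fin q.N) : Fin q.P → List (Block q) :=
  match s.pos u with
  | .cache p => Function.update s.slot p ((s.slot p).filter fun b => decide (b.1 ≠ u))
  | .server _ _ _ => s.slot

/-- The content of the block `u`. -/
def State.dataOf (s : State K q) (u : Fin q.N) : Data q :=
  match s.pos u with
  | .cache p => s.cacheData p u
  | .server p ℓ i => s.serverData p ℓ i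

/-- The content of the block of a request after the request. -/
def Request.newData (y : Request q) (d : Data q) : Data q :=
  match y with
  | .read _ => d
  | .write _ d' => d'

/-- The state after the requested block has been moved into slot `r`. -/
def State.afterRead (s : State K q) (y : Request q) (r : Fin q.P) : State K q :=
  { s with
    pos := Function.update s.pos y.id (.cache r)
    slot := Function.update (s.slotWithout y.id) r
      (s.slotWithout y.id r ++ [(y.id, y.newData (s.dataOf y.id))])
    level := s.levelsAfterRead (some y.id) (s.pos y.id).partition (List.finRange q.L) }

/-- Fetch one set of indices from each of the levels `ls`, possibly with the metadata. -/
def fetchOps (withMeta : Bool) (p : Fin q.P) (ls : List (Fin q.L)) (I : Fin q.L → Finset ℕ) :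
    List (Op q) :=
  ls.flatMap fun ℓ => (if withMeta then [.fetchMeta p ℓ] else []) ++ [.fetch p ℓ (I ℓ)]

/-- The filled levels of a partition. -/
def State.filled (s : State K q) (p : Fin q.P) : List (Fin q.L) :=
  (List.finRange q.L).filter fun ℓ => (s.level p ℓ).isSome

/-- The accesses of reading the block `v` from partition `p`. -/
def State.readOps (s : State K q) (v : Option (Fin q.N)) (p : Fin q.P) : List (Op q) :=
  fetchOps false p (s.filled p) fun ℓ => {(s.hit v p ℓ).getD (s.count p ℓ)}

/-- The indices that are fetched from a level when it is reshuffled. -/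
def State.reshuffled (s : State K q) (p : Fin q.P) (ℓ : Fin q.L) : Finset ℕ :=
  ((s.unread p ℓ).map Prod.snd ++
    List.range' (s.count p ℓ) (q.half ℓ - (s.unread p ℓ).length)).toFinset

/-- The accesses of a write. -/
def State.writeOps (s : State K q) (p : Fin q.P) (b : Option (Block q)) : List (Op q) :=
  fetchOps true p (s.run p) (s.reshuffled p) ++ [.write p (s.target p) (s.kept p b)]

/-- The accesses of an eviction and the state after it. -/
def ctlEvict (p : Fin q.P) (c : State Unit q) : List (Op q) × State Unit q :=
  ((c.pop p).writeOps p (c.slot p).head?, (c.pop p).afterWrite p (c.slot p).head? ())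

/-- The accesses of a sequential scan and the state after it. -/
def ctlScan : ℕ → State Unit q → List (Op q) × State Unit q
  | 0, c => ([], c)
  | k + 1, c =>
    let e := ctlEvict (c.ecnt + 1) { c with ecnt := c.ecnt + 1 }
    (e.1 ++ (ctlScan k e.2).1, (ctlScan k e.2).2)

/-- The accesses of a request and the state after it, for given random choices. -/
def ctlAccess (y : Request q) (r : Fin q.P) (k : ℕ) (c : State Unit q) :
    List (Op q) × State Unit q :=
  let p := (c.pos y.id).partition
  let e := ctlEvict p (c.afterRead y r)
  (c.readOps (some y.id) p ++ (e.1 ++ (ctlScan k e.2).1), (ctlScan k e.2).2)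

/-- The random script of a sequence of requests. -/
noncomputable def ctlRun : List (Request q) → State Unit q → PMF (List (Op q))
  | [], _ => PMF.pure []
  | y :: ys, c => (PMF.uniformOfFintype (Fin q.P)).bind fun r => (boundedGeometric q).bind fun k =>
    (ctlRun ys (ctlAccess y r k c).2).map ((ctlAccess y r k c).1 ++ ·)

/-- The real blocks with which the levels are filled initially. -/
def initialLevels (f : Fin q.P → Fin q.n → Bool) (a : Fin q.N → Fin q.P) (p : Fin q.P)
    (ℓ : Fin q.L) : Option (List (Block q)) :=
  if ℓ = q.top then some ((initialBlocks a p).take (q.half q.top))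
  else if initialFilling f p ℓ then some []
  else none

/-- The position map after the setup. -/
def initialPos (a : Fin q.N → Fin q.P) (u : Fin q.N) : Loc q :=
  if ((initialBlocks a (a u)).map Prod.fst).idxOf u < q.half q.top then
    .server (a u) q.top (((initialBlocks a (a u)).map Prod.fst).idxOf u)
  else .cache (a u)

/-- The state after the setup. -/
def initialState (f : Fin q.P → Fin q.n → Bool) (a : Fin q.N → Fin q.P) : State Unit q where
  pos := initialPos a
  slot p := (initialBlocks a p).drop (q.half q.top)
  level p ℓ := (initialLevels f a p ℓ).map fun b => { key := (), blocks := b, cnt := b.length }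
  ecnt := 0
  trace := []

/-- The script of filling those of the given levels that are filled initially. -/
def fillOps (g : Fin q.P → Fin q.L → Bool) (l : List (Fin q.P × Fin q.L)) : List (Op q) :=
  (l.filter fun x => g x.1 x.2).map fun x => .fill x.1 x.2

/-- The script of the setup. -/
def setupOps (f : Fin q.P → Fin q.n → Bool) : List (Op q) :=
  .filling (initialFilling f) ::
    fillOps (initialFilling f) (List.product (List.finRange q.P) (List.finRange q.L))

/-- The random script of the setup and a sequence of requests. -/
noncomputable def script (ys : List (Request q)) : PMF (List (Op q)) :=
  (PMF.uniformOfFintype (Fin q.P → Fin q.n → Bool)).bind fun f =>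
    (PMF.uniformOfFintype (Fin q.N → Fin q.P)).bind fun a =>
      (ctlRun ys (initialState f a)).map (setupOps f ++ ·)

variable (F : KeyedPerm) (E : SymEnc)

/-- The current keys of all levels, and the sequence of observations so far. -/
abbrev Run (q : Params) := (Fin q.P → Fin q.L → F.Key) × List (Event q)

variable {F} in
/-- Replace the key of a level. -/
def setKey (k : Fin q.P → Fin q.L → F.Key) (p : Fin q.P) (ℓ : Fin q.L) (K : F.Key) :
    Fin q.P → Fin q.L → F.Key :=
  fun p' ℓ' => if p' = p ∧ ℓ' = ℓ then K else k p' ℓ'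

/-- Execute one access of a script. -/
noncomputable def execOp (x : Run F q) : Op q → PMF (Run F q)
  | .filling f => PMF.pure (x.1, x.2 ++ [.filling f])
  | .fill p ℓ => F.gen.map fun K => (setKey x.1 p ℓ K, x.2)
  | .fetchMeta p ℓ => PMF.pure (x.1, x.2 ++ [.fetchMeta p ℓ])
  | .fetch p ℓ I => PMF.pure (x.1, x.2 ++ [.fetch p ℓ (I.image (offset F ℓ (x.1 p ℓ)))])
  | .write p ℓ bs => F.gen.bind fun K => E.gen.bind fun K' =>
      (E.encAll K' (levelPlaintexts F ℓ K bs)).bind fun blocks =>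
        (E.enc K' (levelMetadata ℓ bs)).map fun metadata =>
          (setKey x.1 p ℓ K, x.2 ++ [.write p ℓ blocks metadata])

/-- Execute a script. -/
noncomputable def exec : List (Op q) → Run F q → PMF (Run F q)
  | [], x => PMF.pure x
  | o :: os, x => (execOp F E x o).bind (exec os)

variable {F} in
/-- Combine a state without keys with keys and a trace. -/
def real (c : State Unit q) (x : Run F q) : State F.Key q where
  pos := c.pos
  slot := c.slot
  level p ℓ := (c.level p ℓ).map fun lv => { key := x.1 p ℓ, blocks := lv.blocks, cnt := lv.cnt }
  ecnt := c.ecnt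
  trace := x.2

/-! ### Simulation of the client by scripts -/

theorem exec_append (os os' : List (Op q)) (x : Run F q) :
    exec F E (os ++ os') x = (exec F E os x).bind (exec F E os') := by
  induction os generalizing x with
  | nil => simp [exec]
  | cons o os ih =>
    simp only [List.cons_append, exec, PMF.bind_bind]
    congr 1
    funext y
    exact ih y

/-- The distributions of the permutations of the levels under random keys. -/
noncomputable def keyedPerm (ℓ : Fin q.L) : PMF (Equiv.Perm (Fin (q.size ℓ))) :=
  F.gen.map (F.perm (q.size ℓ))

/-- The permutations that belong to the keys of the levels. -/
def permsOf (k : Fin q.P → Fin q.L → F.Key) : Perms q := fun p ℓ => F.perm (q.size ℓ) (k p ℓ)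

theorem permsOf_setKey (k : Fin q.P → Fin q.L → F.Key) (p ℓ) (K : F.Key) :
    permsOf F (setKey k p ℓ K) = (permsOf F k).set p ℓ (F.perm (q.size ℓ) K) := by
  funext p' ℓ'
  by_cases h : p' = p ∧ ℓ' = ℓ
  · obtain ⟨rfl, rfl⟩ := h
    simp [permsOf, setKey, Perms.set_self]
  · rw [Perms.set_of_ne _ _ h]
    simp [permsOf, setKey, h]

theorem levelCipher_eq (ℓ : Fin q.L) (K : F.Key) (bs : List (Block q)) :
    levelCipher E ℓ (F.perm (q.size ℓ) K) bs =
      E.gen.bind fun K' => (E.encAll K' (levelPlaintexts F ℓ K bs)).bind fun blocks =>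
        (E.enc K' (levelMetadata ℓ bs)).map fun metadata => blocks.flatten ++ metadata := by
  unfold levelCipher
  congr 1
  funext K'
  rw [plaintexts, SymEnc.encAll_concat, PMF.map_bind]
  congr 1
  funext blocks
  rw [PMF.map_comp]
  simp [Function.comp_def]

/-- The server sees a permutation key only through the permutation it selects. Executing a prefix
with keys and observing the rest is therefore the same as observing everything, and this lets a
recursion over requests hand its prefix over to `observe`. -/
theorem exec_bind_observe (os os' : List (Op q)) (x : Run F q) :
    ((exec F E os x).bind fun y =>
      (observe E (keyedPerm F) os' (permsOf F y.1)).map (y.2.flatMap Event.encode ++ ·)) =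
    (observe E (keyedPerm F) (os ++ os') (permsOf F x.1)).map
      (x.2.flatMap Event.encode ++ ·) := by
  induction os generalizing x with
  | nil => simp [exec, PMF.pure_bind]
  | cons o os ih =>
    simp only [exec, PMF.bind_bind, ih]
    cases o with
    | filling f =>
      simp [execOp, PMF.pure_bind, observe, PMF.map_comp, Function.comp_def]
    | fetchMeta p ℓ =>
      simp [execOp, PMF.pure_bind, observe, PMF.map_comp, Function.comp_def]
    | fetch p ℓ I =>
      simp [execOp, PMF.pure_bind, observe, PMF.map_comp, Function.comp_def]
      rfl
    | fill p ℓ =>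
      simp [execOp, PMF.bind_map, observe, PMF.map_bind, Function.comp_def, permsOf_setKey,
        keyedPerm]
    | write p ℓ bs =>
      simp only [List.cons_append, execOp, PMF.bind_bind, observe, PMF.map_bind, keyedPerm,
        PMF.bind_map, Function.comp_def, permsOf_setKey, levelCipher_eq, PMF.map_comp]
      congr! 9 with K K' blocks metadata
      funext x
      simp [Event.encode]

variable {F E} in
theorem nonempty_key : Nonempty F.Key := F.gen.support_nonempty.nonempty

/-- On the state `c`, with any keys and trace, the random operation `f` amounts to executing the
script `os` and passing to the state `c'`. -/
def Simulates (f : State F.Key q → PMF (State F.Key q)) (c : State Unit q) (os : List (Op q))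
    (c' : State Unit q) : Prop :=
  ∀ x, f (real c x) = (exec F E os x).map (real c')

variable {F E}

theorem Simulates.bind {f g : State F.Key q → PMF (State F.Key q)} {c c' c'' : State Unit q}
    {os os' : List (Op q)} (hf : Simulates F E f c os c') (hg : Simulates F E g c' os' c'') :
    Simulates F E (fun s => (f s).bind g) c (os ++ os') c'' := by
  intro x
  simp only [hf x, exec_append, PMF.bind_map, PMF.map_bind]
  congr 1
  funext y
  exact hg y

theorem exec_fetchOps (m : Bool) (p : Fin q.P) (ls : List (Fin q.L)) (I : Fin q.L → Finset ℕ)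
    (x : Run F q) :
    exec F E (fetchOps m p ls I) x = PMF.pure (x.1, x.2 ++ ls.flatMap fun ℓ =>
      (if m then [.fetchMeta p ℓ] else []) ++
        [.fetch p ℓ ((I ℓ).image (offset F ℓ (x.1 p ℓ)))]) := by
  induction ls generalizing x with
  | nil => simp [fetchOps, exec]
  | cons ℓ ls ih =>
    have h : fetchOps m p (ℓ :: ls) I =
        ((if m then [.fetchMeta p ℓ] else []) ++ [.fetch p ℓ (I ℓ)]) ++ fetchOps m p ls I := by
      simp [fetchOps]
    rw [h, exec_append]
    cases m <;> simp [exec, execOp, PMF.pure_bind, ih]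

theorem State.run_real (c : State Unit q) (x : Run F q) (p : Fin q.P) :
    (real c x).run p = c.run p := by
  simp [State.run, real]

theorem State.target_real (c : State Unit q) (x : Run F q) (p : Fin q.P) :
    (real c x).target p = c.target p := by
  simp [State.target, real]

theorem State.unread_real (c : State Unit q) (x : Run F q) (p : Fin q.P) (ℓ : Fin q.L) :
    (real c x).unread p ℓ = c.unread p ℓ := by
  simp only [State.unread, real]
  cases c.level p ℓ <;> rfl

theorem State.buffer_real (c : State Unit q) (x : Run F q) (p : Fin q.P) (b) :
    (real c x).buffer p b = c.buffer p b := by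
  simp only [State.buffer, State.run_real, State.unread_real]

theorem State.kept_real (c : State Unit q) (x : Run F q) (p : Fin q.P) (b) :
    (real c x).kept p b = c.kept p b := by
  simp only [State.kept, State.target_real, State.buffer_real]

theorem State.excess_real (c : State Unit q) (x : Run F q) (p : Fin q.P) (b) :
    (real c x).excess p b = c.excess p b := by
  simp only [State.excess, State.target_real, State.buffer_real]

theorem flatMap_filterMap_map {α β γ : Type*} (l : List α) (g : α → Option β) (h : α × β → List γ) :
    (l.filterMap fun a => (g a).map fun b => (a, b)).flatMap h =
      l.flatMap fun a => (g a).elim [] fun b => h (a, b) := by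
  induction l with
  | nil => rfl
  | cons a l ih => cases hg : g a <;> simp [hg, ih]

theorem State.posAfterWrite_real (c : State Unit q) (x : Run F q) (p : Fin q.P) (b) :
    (real c x).posAfterWrite p b = c.posAfterWrite p b := by
  funext u
  simp only [State.posAfterWrite, State.target_real, State.kept_real, State.excess_real]
  rfl

/-- Keys of levels that the write empties may stay in the table of keys, as `real` consults the
table only at filled levels. -/
theorem State.afterWrite_real (c : State Unit q) (x : Run F q) (p : Fin q.P) (b) (K : F.Key)
    (t : List (Event q)) :
    ({ (real c x).afterWrite p b K with trace := t } : State F.Key q) =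
      real (c.afterWrite p b ()) (setKey x.1 p (c.target p) K, t) := by
  simp only [State.afterWrite, State.posAfterWrite_real, State.target_real, State.run_real,
    State.kept_real, State.excess_real]
  simp only [real, State.mk.injEq, true_and, and_true]
  funext p' ℓ
  by_cases hp : p' = p
  · subst hp
    by_cases hℓ : ℓ = c.target p'
    · simp [setKey, hℓ]
    · by_cases hr : ℓ ∈ c.run p'
      · simp [hℓ, hr]
      · simp [setKey, hℓ, hr]
  · simp [setKey, hp]

theorem mem_run_isSome {s : State K q} {p : Fin q.P} {ℓ : Fin q.L} (h : ℓ ∈ s.run p) :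
    (s.level p ℓ).isSome :=
  List.mem_takeWhile_imp (p := fun ℓ => (s.level p ℓ).isSome) h

theorem writePartition_eq (p : Fin q.P) (b : Option (Block q)) (s : State F.Key q) :
    writePartition F E p b s =
      F.gen.bind fun K => E.gen.bind fun K' =>
        (E.encAll K' (levelPlaintexts F (s.target p) K (s.kept p b))).bind fun blocks =>
          (E.enc K' (levelMetadata (s.target p) (s.kept p b))).map fun metadata =>
            { s.afterWrite p b K with
              trace := s.trace ++ ((s.run p).flatMap fun ℓ => (s.level p ℓ).elim [] fun lv =>
                [.fetchMeta p ℓ, .fetch p ℓ (reshuffleOffsets F s p ℓ lv)]) ++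
                  [.write p (s.target p) blocks metadata] } := by
  have hbuf : (((s.run p).filterMap fun ℓ => (s.level p ℓ).map fun lv => (ℓ, lv)).flatMap fun y =>
        (s.unreadReal p y.1 y.2).map Prod.fst) ++ b.toList = s.buffer p b := by
    rw [flatMap_filterMap_map, State.buffer]
    congr 1
    refine List.flatMap_congr fun ℓ _ => ?_
    rw [State.unread]
    cases s.level p ℓ <;> rfl
  unfold writePartition
  simp only [hbuf]
  simp only [flatMap_filterMap_map]
  rfl

theorem simulates_writePartition (p : Fin q.P) (b : Option (Block q)) (c : State Unit q) :
    Simulates F E (writePartition F E p b) c (c.writeOps p b) (c.afterWrite p b ()) := by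
  intro x
  have hfetch : (((real c x).run p).flatMap fun ℓ => ((real c x).level p ℓ).elim [] fun lv =>
        ([.fetchMeta p ℓ, .fetch p ℓ (reshuffleOffsets F (real c x) p ℓ lv)] : List (Event q))) =
      (c.run p).flatMap fun ℓ => (if true then [.fetchMeta p ℓ] else []) ++
        [.fetch p ℓ ((c.reshuffled p ℓ).image (offset F ℓ (x.1 p ℓ)))] := by
    rw [State.run_real]
    refine List.flatMap_congr fun ℓ hℓ => ?_
    have := mem_run_isSome hℓ
    rw [Option.isSome_iff_exists] at this
    obtain ⟨lv, hlv⟩ := this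
    have hr : (real c x).level p ℓ = some ⟨x.1 p ℓ, lv.blocks, lv.cnt⟩ := by simp [real, hlv]
    have hu := State.unread_real c x p ℓ
    simp only [State.unread, hr, hlv, Option.elim_some] at hu
    simp only [hr, Option.elim_some, reshuffleOffsets, hu, State.reshuffled, State.unread,
      State.count, hlv, if_true, List.cons_append, List.nil_append, List.cons.injEq, and_true,
      Event.fetch.injEq, true_and]
    ext o
    simp only [List.mem_toFinset, List.mem_map, Finset.mem_image]
  rw [writePartition_eq, State.writeOps, exec_append, exec_fetchOps, PMF.pure_bind, hfetch,
    State.target_real, State.kept_real]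
  simp only [exec, execOp, PMF.bind_bind, PMF.map_bind, PMF.bind_map, PMF.pure_map,
    Function.comp_def, State.afterWrite_real]
  rfl

theorem evict_eq (p : Fin q.P) (s : State F.Key q) :
    evict F E p s = writePartition F E p (s.slot p).head? (s.pop p) := by
  unfold evict
  split
  · rename_i h
    have : s.pop p = s := by
      have hs : Function.update s.slot p (s.slot p).tail = s.slot := by
        rw [Function.update_eq_self_iff, h]
        rfl
      unfold State.pop
      rw [hs]
    rw [h, this]
    rfl
  · rename_i h
    simp [State.pop, h]

theorem simulates_evict (p : Fin q.P) (c : State Unit q) :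
    Simulates F E (evict F E p) c (ctlEvict p c).1 (ctlEvict p c).2 := by
  intro x
  rw [evict_eq]
  exact simulates_writePartition p (c.slot p).head? (c.pop p) x

theorem simulates_scan (k : ℕ) (c : State Unit q) :
    Simulates F E (scan F E k) c (ctlScan k c).1 (ctlScan k c).2 := by
  induction k generalizing c with
  | zero =>
    intro x
    simp [scan, ctlScan, exec, PMF.pure_map]
  | succ k ih =>
    have h := Simulates.bind (simulates_evict (F := F) (E := E) (c.ecnt + 1)
      { c with ecnt := c.ecnt + 1 }) (ih _)
    intro x
    exact h x

theorem readLevel_eq (p : Fin q.P) (v : Option (Fin q.N)) (s : State F.Key q) (ℓ : Fin q.L) :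
    readLevel F p v s ℓ = (s.level p ℓ).elim s fun lv =>
      (s.setLevel p ℓ (some (readEffect (s.hit v p ℓ) lv))).emit
        [.fetch p ℓ {offset F ℓ lv.key ((s.hit v p ℓ).getD lv.cnt)}] := by
  unfold readLevel
  cases hl : s.level p ℓ with
  | none => rfl
  | some lv =>
    have hself : s.setLevel p ℓ (some lv) = s := by
      unfold State.setLevel
      rw [← hl, Function.update_eq_self, Function.update_eq_self]
    simp only [State.hit, Option.elim_some]
    cases hv : v.map s.pos with
    | none => rfl
    | some loc =>
      cases loc with
      | cache p' => rfl
      | server p' ℓ' i =>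
        by_cases h : p' = p ∧ ℓ' = ℓ
        · simp [h, readEffect, hself]
        · simp [h, readEffect]

/-- Without repetitions, each level is read in its original state, so that levels and trace can be
described by the initial state alone. -/
theorem foldl_readLevel (p : Fin q.P) (v : Option (Fin q.N)) (s : State F.Key q)
    (ls : List (Fin q.L)) (hls : ls.Nodup) :
    ls.foldl (readLevel F p v) s =
      { s with
        level := s.levelsAfterRead v p ls
        trace := s.trace ++ ls.flatMap fun ℓ => (s.level p ℓ).elim [] fun lv =>
          [.fetch p ℓ {offset F ℓ lv.key ((s.hit v p ℓ).getD lv.cnt)}] } := by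
  induction ls using List.reverseRecOn with
  | nil =>
    have : s.levelsAfterRead v p [] = s.level := by
      funext p' ℓ
      simp [State.levelsAfterRead]
    simp [this]
  | append_singleton ls ℓ ih =>
    rw [List.nodup_append] at hls
    have hnot : ℓ ∉ ls := fun h => hls.2.2 ℓ h ℓ (by simp) rfl
    rw [List.foldl_concat, ih hls.1, readLevel_eq]
    have hlev : s.levelsAfterRead v p ls p ℓ = s.level p ℓ := by simp [State.levelsAfterRead, hnot]
    simp only [hlev]
    cases hl : s.level p ℓ with
    | none =>
      have : s.levelsAfterRead v p (ls ++ [ℓ]) = s.levelsAfterRead v p ls := by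
        funext p' ℓ'
        unfold State.levelsAfterRead
        by_cases hp : p' = p
        · subst hp
          by_cases hm : ℓ' = ℓ
          · subst hm
            simp [hl]
          · simp [hm]
        · simp [hp]
      simp [this, hl]
    | some lv =>
      have : s.levelsAfterRead v p (ls ++ [ℓ]) = Function.update (s.levelsAfterRead v p ls) p
          (Function.update (s.levelsAfterRead v p ls p) ℓ
            (some (readEffect (s.hit v p ℓ) lv))) := by
        funext p' ℓ'
        by_cases hp : p' = p
        · subst hp
          by_cases hm : ℓ' = ℓ
          · subst hm
            simp [State.levelsAfterRead, hl]
          · simp [State.levelsAfterRead, hm]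
        · simp [State.levelsAfterRead, hp]
      simp only [Option.elim_some, State.setLevel, State.emit, this, List.flatMap_append,
        List.flatMap_singleton, hl, List.append_assoc]
      rfl

theorem readPartition_real (p : Fin q.P) (v : Option (Fin q.N)) (c : State Unit q)
    (x : Run F q) :
    PMF.pure (readPartition F p v (real c x)) = (exec F E (c.readOps v p) x).map
      (real { c with level := c.levelsAfterRead v p (List.finRange q.L) }) := by
  rw [State.readOps, exec_fetchOps, PMF.pure_map, readPartition,
    foldl_readLevel _ _ _ _ (List.nodup_finRange _)]
  congr 1
  simp only [real, State.mk.injEq, true_and]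
  constructor
  · funext p' ℓ
    by_cases hp : p' = p
    · subst hp
      simp only [State.levelsAfterRead, List.mem_finRange, and_self, if_true, Option.map_map]
      cases c.level p' ℓ with
      | none => rfl
      | some lv =>
        simp only [Option.map_some, Function.comp_apply, readEffect, State.hit]
        split_ifs <;> rfl
    · simp [State.levelsAfterRead, hp]
  · congr 1
    rw [State.filled]
    induction List.finRange q.L with
    | nil => rfl
    | cons ℓ ls ih =>
      cases hl : c.level p ℓ with
      | none => simpa [hl] using ih
      | some lv => simpa [hl, State.count, State.hit] using ih

/-- A cached block is found in no level, so reading it by name coincides with a dummy read. This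
merges the two branches of a request into one formula. -/
theorem State.hit_of_cache {s : State K q} {u : Fin q.N} {p : Fin q.P} (h : s.pos u = .cache p) :
    s.hit (some u) = s.hit none := by
  funext p' ℓ
  simp [State.hit, h]

theorem State.levelsAfterRead_of_cache {s : State K q} {u : Fin q.N} {p : Fin q.P}
    (h : s.pos u = .cache p) : s.levelsAfterRead (some u) = s.levelsAfterRead none := by
  funext p' ls p'' ℓ
  simp only [State.levelsAfterRead, State.hit_of_cache h]

theorem State.cacheData_real (c : State Unit q) (x : Run F q) (p : Fin q.P) (u : Fin q.N) :
    (real c x).cacheData p u = c.cacheData p u := rfl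

theorem State.serverData_real (c : State Unit q) (x : Run F q) (p ℓ) (i : ℕ) :
    (real c x).serverData p ℓ i = c.serverData p ℓ i := by
  simp only [State.serverData, real]
  cases c.level p ℓ <;> rfl

/-- The slot `r` and the number `k` of background evictions are drawn independently of keys and
ciphertexts. They can be drawn before the accesses are executed, and for fixed `r` and `k` the
control flow is deterministic. -/
theorem access_real (y : Request q) (c : State Unit q) (x : Run F q) :
    (access F E y (real c x)).map Prod.fst =
      (PMF.uniformOfFintype (Fin q.P)).bind fun r => (boundedGeometric q).bind fun k =>
        (exec F E (ctlAccess y r k c).1 x).map (real (ctlAccess y r k c).2) := by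
  unfold access
  rw [PMF.map_bind]
  congr 1
  funext r
  simp only [PMF.map_comp, Function.comp_def]
  -- The continuation `g` stands for everything after the read, so that the two places in which the
  -- block may be found are treated once.
  have hread : ∀ g : State F.Key q → PMF (State F.Key q),
      g (let u := y.id
        let found : State F.Key q × Data q :=
          match (real c x).pos u with
          | .cache p =>
            (readPartition F p none
              { real c x with
                slot := Function.update (real c x).slot p
                  (((real c x).slot p).filter fun b => decide (b.1 ≠ u)) },
              (real c x).cacheData p u)
          | .server p ℓ i => (readPartition F p (some u) (real c x), (real c x).serverData p ℓ i)
        let data : Data q := match y with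
          | .read _ => found.2
          | .write _ d => d
        { found.1 with
          pos := Function.update found.1.pos u (.cache r)
          slot := Function.update found.1.slot r (found.1.slot r ++ [(u, data)]) }) =
      (exec F E (c.readOps (some y.id) (c.pos y.id).partition) x).bind fun x' =>
        g (real (c.afterRead y r) x') := by
    intro g
    have hpos : (real c x).pos y.id = c.pos y.id := rfl
    simp only [hpos]
    cases hl : c.pos y.id with
    | cache p =>
      simp only [Loc.partition, State.cacheData_real]
      let c' : State Unit q := { c with slot := c.slotWithout y.id }
      have hc' : ({ real c x with
          slot := Function.update (real c x).slot p
            (((real c x).slot p).filter fun b => decide (b.1 ≠ y.id)) } : State F.Key q) =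
          real c' x := by
        simp only [c', State.slotWithout, hl]
        rfl
      have h := readPartition_real (E := E) p none c' x
      rw [hc']
      have hops : c'.readOps none p = c.readOps (some y.id) p := by
        simp only [State.readOps, State.hit_of_cache hl]
        rfl
      rw [hops] at h
      have h' := congrArg (fun X => PMF.bind X fun s : State F.Key q =>
        g { s with
            pos := Function.update s.pos y.id (.cache r)
            slot := Function.update s.slot r
              (s.slot r ++ [(y.id, y.newData (c.cacheData p y.id))]) }) h
      simp only [PMF.pure_bind, PMF.bind_map, Function.comp_def] at h'
      refine Eq.trans h' ?_
      congr 1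
      funext x'
      congr 1
      simp only [State.afterRead, hl, Loc.partition, State.levelsAfterRead_of_cache hl,
        State.dataOf]
      rfl
    | server p ℓ i =>
      simp only [Loc.partition, State.serverData_real]
      have h := readPartition_real (E := E) p (some y.id) c x
      have h' := congrArg (fun X => PMF.bind X fun s : State F.Key q =>
        g { s with
            pos := Function.update s.pos y.id (.cache r)
            slot := Function.update s.slot r
              (s.slot r ++ [(y.id, y.newData (c.serverData p ℓ i))]) }) h
      simp only [PMF.pure_bind, PMF.bind_map, Function.comp_def] at h'
      refine Eq.trans h' ?_
      congr 1
      funext x'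
      congr 1
      simp only [State.afterRead, hl, Loc.partition, State.dataOf, State.slotWithout]
      rfl
  have hpart : ((real c x).pos y.id).partition = (c.pos y.id).partition := rfl
  refine Eq.trans (PMF.map_id _) ?_
  refine (hread fun s₁ => (evict F E ((real c x).pos y.id).partition s₁).bind
    (seqEvict F E)).trans ?_
  rw [hpart]
  simp only [ctlAccess, exec_append, PMF.map_bind]
  rw [PMF.bind_comm]
  congr 1
  funext x'
  rw [simulates_evict _ _ x', PMF.bind_map]
  simp only [Function.comp_def, seqEvict]
  rw [PMF.bind_comm]
  congr 1
  funext k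
  congr 1
  funext x''
  exact simulates_scan _ _ x''

theorem foldlM_access (ys : List (Request q)) (c : State Unit q) (x : Run F q) :
    (ys.foldlM (m := PMF) (fun s y => (access F E y s).map Prod.fst) (real c x)).map
        (fun s => s.trace.flatMap Event.encode) =
      (ctlRun ys c).bind fun os => (observe E (keyedPerm F) os (permsOf F x.1)).map
        (x.2.flatMap Event.encode ++ ·) := by
  induction ys generalizing c x with
  | nil =>
    rw [List.foldlM_nil]
    change (PMF.pure _).map _ = _
    simp [PMF.pure_map, ctlRun, PMF.pure_bind, observe, real]
  | cons y ys ih =>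
    rw [List.foldlM_cons]
    change (PMF.bind _ _).map _ = _
    rw [access_real]
    simp only [PMF.bind_bind, PMF.map_bind, PMF.bind_map, Function.comp_def, ctlRun, ih]
    congr 1
    funext r
    congr 1
    funext k
    rw [PMF.bind_comm]
    congr 1
    funext os
    rw [exec_bind_observe]

theorem foldlM_fillLevel (bs : Fin q.P → Fin q.L → Option (List (Block q)))
    (l : List (Fin q.P × Fin q.L)) (c : State Unit q) (x : Run F q) :
    l.foldlM (m := PMF) (fillLevel F bs) (real c x) =
      (exec F E (fillOps (fun p ℓ => (bs p ℓ).isSome) l) x).map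
        (real { c with
          level := fun p ℓ =>
            if (p, ℓ) ∈ l ∧ (bs p ℓ).isSome then
              (bs p ℓ).map fun b => { key := (), blocks := b, cnt := b.length }
            else c.level p ℓ }) := by
  induction l generalizing c x with
  | nil =>
    rw [List.foldlM_nil]
    change PMF.pure _ = _
    simp [fillOps, exec, PMF.pure_map]
  | cons a l ih =>
    rw [List.foldlM_cons]
    change PMF.bind _ _ = _
    rw [fillLevel]
    cases ha : bs a.1 a.2 with
    | none =>
      have hops : fillOps (fun p ℓ => (bs p ℓ).isSome) (a :: l) =
          fillOps (fun p ℓ => (bs p ℓ).isSome) l := by simp [fillOps, ha]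
      simp only [PMF.pure_bind, ih, hops]
      congr 3
      funext p ℓ
      by_cases h : (p, ℓ) = a
      · subst h
        simp [ha]
      · simp [h]
    | some b =>
      have hops : fillOps (fun p ℓ => (bs p ℓ).isSome) (a :: l) =
          .fill a.1 a.2 :: fillOps (fun p ℓ => (bs p ℓ).isSome) l := by simp [fillOps, ha]
      simp only [hops, exec, execOp, PMF.bind_map, PMF.map_bind]
      congr 1
      funext K
      simp only [Function.comp_apply]
      have hreal : (real c x).setLevel a.1 a.2 (some { key := K, blocks := b, cnt := b.length }) =
          real (c.setLevel a.1 a.2 (some { key := (), blocks := b, cnt := b.length }))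
            (setKey x.1 a.1 a.2 K, x.2) := by
        simp only [State.setLevel, real, State.mk.injEq, true_and, and_true]
        funext p ℓ
        by_cases hp : p = a.1
        · subst hp
          by_cases hℓ : ℓ = a.2
          · subst hℓ
            simp [setKey]
          · simp [setKey, hℓ]
        · simp [setKey, hp]
      rw [hreal, ih]
      congr 3
      simp only [State.setLevel]
      funext p ℓ
      by_cases h : (p, ℓ) = a
      · subst h
        simp [ha]
      · have h' : ¬(p = a.1 ∧ ℓ = a.2) := fun h' => h (Prod.ext h'.1 h'.2)
        by_cases hp : p = a.1
        · subst hp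
          have hℓ : ℓ ≠ a.2 := fun hℓ => h' ⟨rfl, hℓ⟩
          simp [h, hℓ]
        · simp [h, hp]

theorem isSome_initialLevels (f : Fin q.P → Fin q.n → Bool) (a : Fin q.N → Fin q.P) (p : Fin q.P)
    (ℓ : Fin q.L) : (initialLevels f a p ℓ).isSome = initialFilling f p ℓ := by
  unfold initialLevels
  by_cases h : ℓ = q.top
  · subst h
    simp [initialFilling, Params.top]
  · by_cases h' : initialFilling f p ℓ <;> simp [h, h']

/-- The script is drawn without reference to keys, and only afterwards shown to the server. The keys
`k₀` merely give the levels a value before their first construction; any choice serves. -/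
theorem accessPattern_eq (ys : List (Request q)) (k₀ : Fin q.P → Fin q.L → F.Key) :
    accessPattern F E q ys =
      (script ys).bind fun os => observe E (keyedPerm F) os (permsOf F k₀) := by
  unfold accessPattern runRequests setup script
  simp only [PMF.bind_bind, PMF.map_bind, PMF.bind_map, Function.comp_def]
  congr 1
  funext f
  congr 1
  funext a
  let c₀ : State Unit q :=
    { pos := initialPos a
      slot := fun p => (initialBlocks a p).drop (q.half q.top)
      level := fun _ _ => none
      ecnt := 0
      trace := [] }
  have h₀ := foldlM_fillLevel (F := F) (E := E) (initialLevels f a)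
    (List.product (List.finRange q.P) (List.finRange q.L)) c₀ (k₀, [.filling (initialFilling f)])
  have hstate : ({ c₀ with
      level := fun p ℓ =>
        if (p, ℓ) ∈ List.product (List.finRange q.P) (List.finRange q.L) ∧
            (initialLevels f a p ℓ).isSome then
          (initialLevels f a p ℓ).map fun b => { key := (), blocks := b, cnt := b.length }
        else c₀.level p ℓ } : State Unit q) = initialState f a := by
    simp only [c₀, initialState, State.mk.injEq, true_and, and_true]
    funext p ℓ
    have : (p, ℓ) ∈ List.product (List.finRange q.P) (List.finRange q.L) := 
      List.pair_mem_product.2 ⟨List.mem_finRange p, List.mem_finRange ℓ⟩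
    cases hb : initialLevels f a p ℓ <;> simp [this]
  rw [hstate] at h₀
  simp only [isSome_initialLevels] at h₀
  refine Eq.trans (b := ((List.product (List.finRange q.P) (List.finRange q.L)).foldlM (m := PMF)
    (fillLevel F (initialLevels f a)) (real c₀ (k₀, [.filling (initialFilling f)]))).bind
      fun s => (ys.foldlM (m := PMF) (fun s y => (access F E y s).map Prod.fst) s).map
        fun s => s.trace.flatMap Event.encode) rfl ?_
  rw [h₀, PMF.bind_map]
  simp only [Function.comp_def, foldlM_access]
  rw [PMF.bind_comm]
  congr 1
  funext os
  rw [exec_bind_observe]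
  simp [setupOps, observe]

end Client

/-! ### The filling of the levels as a binary counter -/

section Filling

variable {q : Params}

/-- The consecutively filled levels from level `0` on. -/
def runLevels (g : Fin q.L → Bool) : List (Fin q.L) := (List.finRange q.L).takeWhile g

/-- The first unfilled level, or the top level. -/
def targetLevel (g : Fin q.L → Bool) : Fin q.L :=
  ((List.finRange q.L).find? fun ℓ => !g ℓ).getD q.top

/-- The filling of a partition after a write. -/
def fillingAfterWrite (g : Fin q.L → Bool) (ℓ : Fin q.L) : Bool :=
  if ℓ = targetLevel g then true else if ℓ ∈ runLevels g then false else g ℓ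

/-- The number whose binary digits are the levels below `ℓ`. -/
def lowerCount (g : Fin q.L → Bool) (ℓ : Fin q.L) : ℕ :=
  ∑ j with j < ℓ ∧ g j = true, 2 ^ (j : ℕ)

theorem mem_takeWhile_of_pairwise_lt {α : Type*} [LinearOrder α] (l : List α)
    (hl : l.Pairwise (· < ·)) (g : α → Bool) (x : α) :
    x ∈ l.takeWhile g ↔ x ∈ l ∧ ∀ y ∈ l, y ≤ x → g y = true := by
  induction l with
  | nil => simp
  | cons a l ih =>
    rw [List.pairwise_cons] at hl
    by_cases ha : g a
    · rw [List.takeWhile_cons_of_pos ha]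
      simp only [List.mem_cons, ih hl.2, forall_eq_or_imp]
      constructor
      · rintro (rfl | ⟨hx, hy⟩)
        · exact ⟨.inl rfl, fun _ => ha, fun y hy hyx => absurd (hl.1 y hy) (not_lt.2 hyx)⟩
        · exact ⟨.inr hx, fun _ => ha, hy⟩
      · rintro ⟨rfl | hx, -, hy⟩
        · exact .inl rfl
        · exact .inr ⟨hx, hy⟩
    · rw [List.takeWhile_cons_of_neg ha]
      simp only [List.not_mem_nil, List.mem_cons, forall_eq_or_imp, false_iff, not_and]
      rintro (rfl | hx) h
      · exact absurd (h le_rfl) ha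
      · exact absurd (h (hl.1 x hx).le) ha

theorem mem_runLevels {g : Fin q.L → Bool} {ℓ : Fin q.L} :
    ℓ ∈ runLevels g ↔ ∀ j ≤ ℓ, g j = true := by
  rw [runLevels, mem_takeWhile_of_pairwise_lt _ (List.pairwise_lt_finRange _)]
  simp

theorem targetLevel_spec (g : Fin q.L → Bool) :
    (g (targetLevel g) = false ∧ ∀ j < targetLevel g, g j = true) ∨
      ((∀ j, g j = true) ∧ targetLevel g = q.top) := by
  unfold targetLevel
  cases h : (List.finRange q.L).find? fun ℓ => !g ℓ with
  | none =>
    right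
    rw [List.find?_eq_none] at h
    exact ⟨fun j => by simpa using h j (List.mem_finRange j), rfl⟩
  | some t =>
    left
    rw [List.find?_eq_some_iff_append] at h
    obtain ⟨ht, as, bs, hsplit, has⟩ := h
    refine ⟨by simpa using ht, fun j hj => ?_⟩
    have hpw := List.pairwise_lt_finRange q.L
    have hmem := List.mem_finRange j
    rw [hsplit] at hpw hmem
    rw [List.pairwise_append, List.pairwise_cons] at hpw
    rcases List.mem_append.1 hmem with h | h
    · simpa using has j h
    · rcases List.mem_cons.1 h with rfl | h
      · exact absurd hj (lt_irrefl _)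
      · exact absurd hj (hpw.2.1.1 j h).not_gt

/-- A write never overwrites blocks that it has not collected: its target is either empty or among
the levels just read. -/
theorem targetLevel_mem_run_or (g : Fin q.L → Bool) :
    targetLevel g ∈ runLevels g ∨ g (targetLevel g) = false := by
  rcases targetLevel_spec g with h | h
  · exact .inr h.1
  · exact .inl (mem_runLevels.2 fun j _ => h.1 j)

theorem targetLevel_eq_top {g : Fin q.L → Bool} (h : q.top ∈ runLevels g) :
    targetLevel g = q.top := by
  rcases targetLevel_spec g with h' | h'
  · rw [mem_runLevels.1 h _ (Fin.le_last _)] at h'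
    exact absurd h'.1 (by simp)
  · exact h'.2

theorem sum_pow_two_add_one (t : Fin q.L) : ∑ j with j < t, 2 ^ (j : ℕ) + 1 = 2 ^ (t : ℕ) := by
  have h : ∀ m, ∑ k ∈ Finset.range m, 2 ^ k + 1 = 2 ^ m := by
    intro m
    induction m with
    | zero => rfl
    | succ m ih => rw [Finset.sum_range_succ, pow_succ]; omega
  rw [← h]
  congr 1
  refine Finset.sum_bij (fun j _ => (j : ℕ)) ?_ ?_ ?_ ?_
  · intro j hj
    exact Finset.mem_range.2 (Fin.lt_def.1 (Finset.mem_filter.1 hj).2)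
  · intro i _ j _ hij
    exact Fin.ext hij
  · intro k hk
    rw [Finset.mem_range] at hk
    exact ⟨⟨k, hk.trans t.2⟩, Finset.mem_filter.2 ⟨Finset.mem_univ _, hk⟩, rfl⟩
  · intro j _
    rfl

theorem lowerCount_lt (g : Fin q.L → Bool) (ℓ : Fin q.L) : lowerCount g ℓ < 2 ^ (ℓ : ℕ) := by
  rw [← sum_pow_two_add_one, Nat.lt_succ_iff]
  exact Finset.sum_le_sum_of_subset fun j hj => by
    simp only [Finset.mem_filter, Finset.mem_univ, true_and] at hj ⊢
    exact hj.1

/-- A write increments the binary counter below the levels that it does not touch. -/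
theorem lowerCount_fillingAfterWrite {g : Fin q.L → Bool} {ℓ : Fin q.L} (hr : ℓ ∉ runLevels g)
    (ht : ℓ ≠ targetLevel g) : lowerCount (fillingAfterWrite g) ℓ = lowerCount g ℓ + 1 := by
  rcases targetLevel_spec g with ⟨h₁, h₂⟩ | ⟨h₁, -⟩
  swap
  · exact absurd (mem_runLevels.2 fun j _ => h₁ j) hr
  have hlt : targetLevel g < ℓ := by
    by_contra hle
    have hlt := lt_of_le_of_ne (not_lt.1 hle) ht
    exact hr (mem_runLevels.2 fun j hj => h₂ j (hj.trans_lt hlt))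
  set t := targetLevel g with htdef
  have hrun : ∀ j, j ∈ runLevels g ↔ j < t := by
    intro j
    rw [mem_runLevels]
    refine ⟨fun h => ?_, fun h i hi => h₂ i (hi.trans_lt h)⟩
    by_contra hle
    rw [h t (not_lt.1 hle)] at h₁
    cases h₁
  -- This is the carry of a binary increment: below the target `t` all digits are 1 and become 0,
  -- digit `t` becomes 1, and the digits between `t` and `ℓ` stay. The difference is `2 ^ t` minus
  -- the sum of all smaller powers, that is, 1.
  have hA : (Finset.univ.filter fun j : Fin q.L => j < ℓ ∧ g j = true) =
      (Finset.univ.filter fun j : Fin q.L => j < t) ∪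
        Finset.univ.filter fun j : Fin q.L => t < j ∧ j < ℓ ∧ g j = true := by
    ext j
    simp only [Finset.mem_filter, Finset.mem_univ, true_and, Finset.mem_union]
    constructor
    · rintro ⟨hj, hg⟩
      rcases lt_trichotomy j t with h | rfl | h
      · exact .inl h
      · rw [h₁] at hg
        cases hg
      · exact .inr ⟨h, hj, hg⟩
    · rintro (h | h)
      · exact ⟨h.trans hlt, h₂ j h⟩
      · exact h.2
  have hB : (Finset.univ.filter fun j : Fin q.L => j < ℓ ∧ fillingAfterWrite g j = true) =
      {t} ∪ Finset.univ.filter fun j : Fin q.L => t < j ∧ j < ℓ ∧ g j = true := by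
    ext j
    simp only [Finset.mem_filter, Finset.mem_univ, true_and, Finset.mem_union,
      Finset.mem_singleton, fillingAfterWrite, ← htdef, hrun]
    rcases lt_trichotomy j t with h | rfl | h
    · simp [h.ne, h, h.not_gt]
    · simp [hlt]
    · simp [h.ne', h, h.not_gt]
  unfold lowerCount
  rw [hA, hB, Finset.sum_union, Finset.sum_union, Finset.sum_singleton, ← sum_pow_two_add_one t]
  · ring
  · rw [Finset.disjoint_left]
    intro j hj hj'
    simp only [Finset.mem_filter, Finset.mem_univ, true_and] at hj hj'
    exact hj.not_gt hj'.1
  · rw [Finset.disjoint_left]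
    intro j hj hj'
    simp only [Finset.mem_filter, Finset.mem_univ, true_and, Finset.mem_singleton] at hj hj'
    exact hj'.1.ne' hj

/-- The size is at least `2 * 2 ^ ℓ`, so the part of it left by rounding the half down has at least
`2 ^ ℓ` places. These pay for the dummies read between two constructions. -/
theorem Params.half_add_pow_le_size (ℓ : Fin q.L) : q.half ℓ + 2 ^ (ℓ : ℕ) ≤ q.size ℓ := by
  have : 2 * 2 ^ (ℓ : ℕ) ≤ q.size ℓ := Nat.le_add_right _ _
  unfold Params.half
  omega

theorem Params.half_le_size (ℓ : Fin q.L) : q.half ℓ ≤ q.size ℓ :=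
  (Nat.le_add_right _ _).trans (q.half_add_pow_le_size ℓ)

end Filling

/-! ### Invariants of the client -/

section Invariants

variable {q : Params}

/-- Whether a level is filled. -/
def State.fill {K : Type} (s : State K q) (p : Fin q.P) (ℓ : Fin q.L) : Bool :=
  (s.level p ℓ).isSome

theorem State.run_eq {K : Type} (s : State K q) (p : Fin q.P) : s.run p = runLevels (s.fill p) :=
  rfl

theorem State.target_eq {K : Type} (s : State K q) (p : Fin q.P) :
    s.target p = targetLevel (s.fill p) := by
  simp [State.target, targetLevel, State.fill]

theorem State.mem_unread {K : Type} {s : State K q} {p : Fin q.P} {ℓ : Fin q.L}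
    {b : Block q × ℕ} : b ∈ s.unread p ℓ ↔
      ∃ lv, s.level p ℓ = some lv ∧ lv.blocks[b.2]? = some b.1 ∧
        s.pos b.1.1 = .server p ℓ b.2 := by
  unfold State.unread
  cases h : s.level p ℓ with
  | none => simp
  | some lv => simp [State.unreadReal, List.mem_zipIdx_iff_getElem?]

theorem State.length_unread_le {K : Type} {s : State K q} {p : Fin q.P} {ℓ : Fin q.L}
    {lv : Level K q} (h : s.level p ℓ = some lv) : (s.unread p ℓ).length ≤ lv.blocks.length := by
  simp only [State.unread, h, Option.elim_some, State.unreadReal]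
  exact (List.length_filter_le _ _).trans (by simp)

theorem State.nodup_map_snd_unread {K : Type} (s : State K q) (p : Fin q.P) (ℓ : Fin q.L) :
    ((s.unread p ℓ).map Prod.snd).Nodup := by
  unfold State.unread
  cases s.level p ℓ with
  | none => simp
  | some lv =>
    refine List.Nodup.sublist (List.filter_sublist.map Prod.snd) ?_
    rw [List.zipIdx_map_snd]
    exact List.nodup_range'

/-- The position map of an unread block records its index, and indices are distinct. Distinct
identifiers follow, although the list of blocks of a level is not assumed to be free of duplicates.
-/
theorem State.nodup_map_loc_unread {K : Type} (s : State K q) (p : Fin q.P) (ℓ : Fin q.L) :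
    ((s.unread p ℓ).map fun b => s.pos b.1.1).Nodup := by
  have h : ((s.unread p ℓ).map fun b => s.pos b.1.1) =
      ((s.unread p ℓ).map Prod.snd).map (Loc.server p ℓ) := by
    rw [List.map_map]
    refine List.map_congr_left fun b hb => ?_
    obtain ⟨_, _, _, h⟩ := State.mem_unread.1 hb
    exact h
  rw [h]
  exact (s.nodup_map_snd_unread p ℓ).map fun i j hij => by simpa using hij

theorem State.nodup_ids_unread {K : Type} (s : State K q) (p : Fin q.P) (ℓ : Fin q.L) :
    ((s.unread p ℓ).map fun b => b.1.1).Nodup := by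
  have := s.nodup_map_loc_unread p ℓ
  rw [← Function.comp_def s.pos, ← List.map_map] at this
  exact this.of_map

theorem State.unread_eq_of_forall {K : Type} {s : State K q} {p : Fin q.P} {ℓ : Fin q.L}
    {lv : Level K q} (h : s.level p ℓ = some lv)
    (hpos : ∀ i b, lv.blocks[i]? = some b → s.pos b.1 = .server p ℓ i) :
    s.unread p ℓ = lv.blocks.zipIdx := by
  simp only [State.unread, h, Option.elim_some, State.unreadReal]
  rw [List.filter_eq_self]
  intro b hb
  simpa using hpos b.2 b.1 (List.mem_zipIdx_iff_getElem?.1 hb)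

/-- The invariants of the client's state. The function `e` says for every partition how many
accesses to it have not yet been followed by a write. -/
structure Inv (e : Fin q.P → ℕ) (c : State Unit q) : Prop where
  len : ∀ p ℓ lv, c.level p ℓ = some lv →
    lv.blocks.length ≤ q.half ℓ ∧ lv.blocks.length ≤ lv.cnt
  slot_pos : ∀ p, ∀ b ∈ c.slot p, c.pos b.1 = .cache p
  slot_nodup : ∀ p, ((c.slot p).map Prod.fst).Nodup
  server : ∀ u p ℓ i, c.pos u = .server p ℓ i →
    ∃ lv, c.level p ℓ = some lv ∧ ∃ d, lv.blocks[i]? = some (u, d)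
  budget : ∀ p ℓ, c.fill p ℓ = true →
    c.count p ℓ ≤ (c.unread p ℓ).length + lowerCount (c.fill p) ℓ + e p
  top : ∀ p, c.fill p q.top = true

/-- The indices of each level that have been fetched; everything for unfilled levels. -/
def State.used (c : State Unit q) : Used q := fun p ℓ =>
  if c.fill p ℓ = true then {i | i < c.count p ℓ ∧ i ∉ (c.unread p ℓ).map Prod.snd} else Set.univ

theorem Inv.lt_count {e : Fin q.P → ℕ} {c : State Unit q} (h : Inv e c) {p : Fin q.P}
    {ℓ : Fin q.L} {b : Block q × ℕ} (hb : b ∈ c.unread p ℓ) :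
    b.2 < c.count p ℓ ∧ b.2 < q.half ℓ := by
  obtain ⟨lv, hlv, hi, -⟩ := State.mem_unread.1 hb
  obtain ⟨hi', -⟩ := List.getElem?_eq_some_iff.1 hi
  have := h.len p ℓ lv hlv
  simp only [State.count, hlv, Option.elim_some]
  omega

theorem Inv.length_unread_le_half {e : Fin q.P → ℕ} {c : State Unit q} (h : Inv e c) (p : Fin q.P)
    (ℓ : Fin q.L) : (c.unread p ℓ).length ≤ q.half ℓ := by
  cases hl : c.level p ℓ with
  | none => simp [State.unread, hl]
  | some lv => exact (State.length_unread_le hl).trans (h.len p ℓ lv hl).1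

theorem freshScript_fetchOps (m : Bool) (p : Fin q.P) (ls : List (Fin q.L)) (hls : ls.Nodup)
    (I : Fin q.L → Finset ℕ) (U : Used q)
    (h : ∀ ℓ ∈ ls, Disjoint (I ℓ : Set ℕ) (U p ℓ) ∧ ∀ i ∈ I ℓ, i < q.size ℓ) :
    FreshScript U (fetchOps m p ls I) ∧ (fetchOps m p ls I).foldl Op.use U =
      fun p' ℓ => if p' = p ∧ ℓ ∈ ls then U p ℓ ∪ I ℓ else U p' ℓ := by
  induction ls generalizing U with
  | nil => simp [fetchOps, FreshScript]
  | cons ℓ ls ih =>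
    rw [List.nodup_cons] at hls
    have hsplit : fetchOps m p (ℓ :: ls) I =
        (if m then [.fetchMeta p ℓ] else []) ++ .fetch p ℓ (I ℓ) :: fetchOps m p ls I := by
      simp [fetchOps]
    have hset : ∀ ℓ' ∈ ls, (U.set p ℓ (U p ℓ ∪ I ℓ)) p ℓ' = U p ℓ' := by
      intro ℓ' hℓ'
      have : ℓ' ≠ ℓ := fun h => hls.1 (h ▸ hℓ')
      simp [Used.set, this]
    obtain ⟨h₁, h₂⟩ := ih hls.2 (U.set p ℓ (U p ℓ ∪ I ℓ)) fun ℓ' hℓ' => by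
      rw [hset ℓ' hℓ']
      exact h ℓ' (List.mem_cons_of_mem _ hℓ')
    have hfold : (fetchOps m p ls I).foldl Op.use (U.set p ℓ (U p ℓ ∪ I ℓ)) =
        fun p' ℓ' => if p' = p ∧ ℓ' ∈ ℓ :: ls then U p ℓ' ∪ I ℓ' else U p' ℓ' := by
      rw [h₂]
      funext p' ℓ'
      by_cases hp : p' = p
      · subst hp
        by_cases hl : ℓ' ∈ ls
        · simp only [hl, and_self, if_true, hset ℓ' hl, List.mem_cons, or_true]
        · by_cases hℓ : ℓ' = ℓ
          · subst hℓ
            simp [hl, Used.set]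
          · simp [hl, hℓ, Used.set]
      · simp [hp, Used.set]
    have hhead := h ℓ List.mem_cons_self
    rw [hsplit]
    cases m
    · exact ⟨⟨hhead, h₁⟩, hfold⟩
    · exact ⟨⟨trivial, hhead, h₁⟩, hfold⟩

/-- The script `os` is fresh and leads from the state `c` to the state `c'`. -/
structure FreshStep (c : State Unit q) (os : List (Op q)) (c' : State Unit q) : Prop where
  fresh : FreshScript c.used os
  use_le : os.foldl Op.use c.used ≤ c'.used

theorem foldl_use_mono {U V : Used q} (h : U ≤ V) (os : List (Op q)) :
    os.foldl Op.use U ≤ os.foldl Op.use V := by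
  induction os generalizing U V with
  | nil => exact h
  | cons o os ih => exact ih (Op.use_mono h o)

theorem FreshStep.trans {c c' c'' : State Unit q} {os os' : List (Op q)} (h : FreshStep c os c')
    (h' : FreshStep c' os' c'') : FreshStep c (os ++ os') c'' := by
  refine ⟨h.fresh.append (h'.fresh.anti h.use_le), ?_⟩
  rw [List.foldl_append]
  exact (foldl_use_mono h.use_le os').trans h'.use_le

/-! #### Writing -/

theorem mem_reshuffled {c : State Unit q} {p : Fin q.P} {ℓ : Fin q.L} {i : ℕ} :
    i ∈ c.reshuffled p ℓ ↔ i ∈ (c.unread p ℓ).map Prod.snd ∨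
      (c.count p ℓ ≤ i ∧ i < c.count p ℓ + (q.half ℓ - (c.unread p ℓ).length)) := by
  simp [State.reshuffled, List.mem_range'_1]

/-- Real blocks have indices below the dummy counter and the added dummies have indices from it on,
so nothing is counted twice. The server thus always sees `q.half ℓ` fetches, however many real
blocks remain. -/
theorem Inv.card_reshuffled {e : Fin q.P → ℕ} {c : State Unit q} (h : Inv e c) (p : Fin q.P)
    (ℓ : Fin q.L) : (c.reshuffled p ℓ).card = q.half ℓ := by
  unfold State.reshuffled
  rw [List.toFinset_card_of_nodup]
  · have := h.length_unread_le_half p ℓ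
    simp
    omega
  · rw [List.nodup_append]
    refine ⟨c.nodup_map_snd_unread p ℓ, List.nodup_range', fun i hi j hj => ?_⟩
    obtain ⟨b, hb, rfl⟩ := List.mem_map.1 hi
    have := (h.lt_count hb).1
    have := (List.mem_range'_1.1 hj).1
    omega

/-- The dummies end before `count + (half - unread)`, which by the budget is at most `half +
lowerCount + e p`. As `lowerCount` is at most `2 ^ ℓ - 1` and `e p` at most 1, this does not exceed
`half + 2 ^ ℓ`, hence not the size of the level. -/
theorem Inv.reshuffled_fresh {e : Fin q.P → ℕ} {c : State Unit q} (h : Inv e c) {p : Fin q.P}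
    (he : e p ≤ 1) {ℓ : Fin q.L} (hℓ : c.fill p ℓ = true) :
    Disjoint (c.reshuffled p ℓ : Set ℕ) (c.used p ℓ) ∧ ∀ i ∈ c.reshuffled p ℓ, i < q.size ℓ := by
  constructor
  · rw [Set.disjoint_left]
    intro i hi hi'
    simp only [State.used, hℓ, if_true, Set.mem_ofPred_eq] at hi'
    rcases mem_reshuffled.1 (Finset.mem_coe.1 hi) with hi | hi
    · exact hi'.2 hi
    · omega
  · intro i hi
    rcases mem_reshuffled.1 hi with hi | hi
    · obtain ⟨b, hb, rfl⟩ := List.mem_map.1 hi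
      exact (h.lt_count hb).2.trans_le (q.half_le_size ℓ)
    · have h₁ := h.budget p ℓ hℓ
      have h₂ := h.length_unread_le_half p ℓ
      have h₃ := lowerCount_lt (c.fill p) ℓ
      have hs := q.half_add_pow_le_size ℓ
      omega

/-- The block `b` that is written to partition `p` has been taken out of slot `p`. -/
def Popped (c : State Unit q) (p : Fin q.P) (b : Option (Block q)) : Prop :=
  ∀ b' ∈ b, c.pos b'.1 = .cache p ∧ b'.1 ∉ (c.slot p).map Prod.fst

/-- The locations from which a write to partition `p` collects blocks. -/
def FromBuffer (c : State Unit q) (p : Fin q.P) (u : Fin q.N) : Prop :=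
  (c.pos u = .cache p ∧ u ∉ (c.slot p).map Prod.fst) ∨
    ∃ ℓ ∈ c.run p, ∃ i, c.pos u = .server p ℓ i

theorem fromBuffer_of_mem {c : State Unit q} {p : Fin q.P} {b : Option (Block q)}
    (hb : Popped c p b) {u : Fin q.N} (hu : u ∈ (c.buffer p b).map Prod.fst) :
    FromBuffer c p u := by
  rw [List.mem_map] at hu
  obtain ⟨x, hx, rfl⟩ := hu
  rcases List.mem_append.1 hx with hx | hx
  · rw [List.mem_flatMap] at hx
    obtain ⟨ℓ, hℓ, hx⟩ := hx
    obtain ⟨y, hy, rfl⟩ := List.mem_map.1 hx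
    obtain ⟨_, _, _, hpos⟩ := State.mem_unread.1 hy
    exact .inr ⟨ℓ, hℓ, _, hpos⟩
  · exact .inl (hb x (by simpa using hx))

theorem nodup_buffer {c : State Unit q} {p : Fin q.P} {b : Option (Block q)}
    (hb : Popped c p b) : ((c.buffer p b).map Prod.fst).Nodup := by
  -- It suffices that the locations are distinct: they differ in the index within a level, in the
  -- level between levels, and the block `b` is located in the cache.
  refine List.Nodup.of_map c.pos ?_
  have hrun : (c.run p).Nodup := (List.takeWhile_sublist _).nodup (List.nodup_finRange _)
  simp only [State.buffer, List.map_append, List.map_map, List.map_flatMap]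
  rw [List.nodup_append, List.nodup_flatMap]
  refine ⟨⟨fun ℓ _ => c.nodup_map_loc_unread p ℓ, hrun.imp fun {ℓ ℓ'} hne => ?_⟩, ?_, ?_⟩
  · intro loc h h'
    obtain ⟨x, hx, rfl⟩ := List.mem_map.1 h
    obtain ⟨y, hy, hxy⟩ := List.mem_map.1 h'
    obtain ⟨_, _, _, hx⟩ := State.mem_unread.1 hx
    obtain ⟨_, _, _, hy⟩ := State.mem_unread.1 hy
    simp only [Function.comp_apply] at hxy
    rw [hx, hy] at hxy
    simp only [Loc.server.injEq] at hxy
    exact hne hxy.2.1.symm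
  · cases b <;> simp
  · intro loc h loc' h'
    obtain ⟨ℓ, -, h⟩ := List.mem_flatMap.1 h
    obtain ⟨x, hx, rfl⟩ := List.mem_map.1 h
    obtain ⟨_, _, _, hx⟩ := State.mem_unread.1 hx
    obtain ⟨y, hy, rfl⟩ := List.mem_map.1 h'
    simp only [Function.comp_apply]
    rw [hx, (hb y (by simpa using hy)).1]
    simp

theorem kept_append_excess (c : State Unit q) (p : Fin q.P) (b : Option (Block q)) :
    (c.kept p b).map Prod.fst ++ (c.excess p b).map Prod.fst = (c.buffer p b).map Prod.fst := by
  rw [← List.map_append, State.kept, State.excess, List.take_append_drop]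

theorem State.fill_afterWrite (c : State Unit q) (p : Fin q.P) (b : Option (Block q)) :
    (c.afterWrite p b ()).fill = Function.update c.fill p (fillingAfterWrite (c.fill p)) := by
  funext p' ℓ
  by_cases hp : p' = p
  · subst hp
    simp only [State.fill, State.afterWrite, Function.update_self, State.target_eq, State.run_eq,
      fillingAfterWrite]
    by_cases h₁ : ℓ = targetLevel (c.fill p')
    · simp [h₁]
    · by_cases h₂ : ℓ ∈ runLevels (c.fill p')
      · simp [h₁, h₂]
      · simp [h₁, h₂]
  · simp [State.fill, State.afterWrite, hp]

theorem level_afterWrite_of_not {c : State Unit q} {p p' : Fin q.P} {ℓ : Fin q.L}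
    (b : Option (Block q)) (h : ¬(p' = p ∧ (ℓ = c.target p ∨ ℓ ∈ c.run p))) :
    (c.afterWrite p b ()).level p' ℓ = c.level p' ℓ := by
  by_cases hp : p' = p
  · subst hp
    simp only [true_and, not_or] at h
    simp [State.afterWrite, h.1, h.2]
  · simp [State.afterWrite, hp]

/-- Only collected blocks move. They come from slot `p` or the emptied levels and go to the target
or back to the slot, so they are in an untouched level neither before nor after. -/
theorem pos_afterWrite_iff {c : State Unit q} {p p' : Fin q.P} {ℓ : Fin q.L}
    {b : Option (Block q)} (hb : Popped c p b)
    (h : ¬(p' = p ∧ (ℓ = c.target p ∨ ℓ ∈ c.run p))) (u : Fin q.N) (i : ℕ) :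
    (c.afterWrite p b ()).pos u = .server p' ℓ i ↔ c.pos u = .server p' ℓ i := by
  by_cases hu : u ∈ (c.buffer p b).map Prod.fst
  · have hfrom := fromBuffer_of_mem hb hu
    have h₁ : c.pos u ≠ .server p' ℓ i := by
      intro hpos
      rcases hfrom with h' | ⟨ℓ', hℓ', i', h'⟩
      · rw [hpos] at h'
        simp at h'
      · rw [hpos] at h'
        simp only [Loc.server.injEq] at h'
        exact h ⟨h'.1, .inr (h'.2.1 ▸ hℓ')⟩
    have h₂ : (c.afterWrite p b ()).pos u ≠ .server p' ℓ i := by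
      simp only [State.afterWrite, State.posAfterWrite]
      rw [← kept_append_excess, List.mem_append] at hu
      split_ifs with hk hx
      · intro heq
        simp only [Loc.server.injEq] at heq
        exact h ⟨heq.1.symm, .inl heq.2.1.symm⟩
      · simp
      · exact absurd hu (by simp [hk, hx])
    simp [h₁, h₂]
  · rw [← kept_append_excess, List.mem_append, not_or] at hu
    simp [State.afterWrite, State.posAfterWrite, hu.1, hu.2]

theorem unread_afterWrite_of_not {c : State Unit q} {p p' : Fin q.P} {ℓ : Fin q.L}
    {b : Option (Block q)} (hb : Popped c p b)
    (h : ¬(p' = p ∧ (ℓ = c.target p ∨ ℓ ∈ c.run p))) :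
    (c.afterWrite p b ()).unread p' ℓ = c.unread p' ℓ := by
  simp only [State.unread, level_afterWrite_of_not b h]
  cases c.level p' ℓ with
  | none => rfl
  | some lv =>
    simp only [Option.elim_some, State.unreadReal]
    refine List.filter_congr fun x _ => ?_
    rw [decide_eq_decide]
    exact pos_afterWrite_iff hb h _ _

theorem level_afterWrite_target (c : State Unit q) (p : Fin q.P) (b : Option (Block q)) :
    (c.afterWrite p b ()).level p (c.target p) =
      some { key := (), blocks := c.kept p b, cnt := (c.kept p b).length } := by
  simp [State.afterWrite]

/-- As the collected identifiers are distinct, the index that the position map assigns to a block is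
its place in the list, and all the blocks are unread. -/
theorem unread_afterWrite_target {c : State Unit q} {p : Fin q.P} {b : Option (Block q)}
    (hb : Popped c p b) :
    (c.afterWrite p b ()).unread p (c.target p) = (c.kept p b).zipIdx := by
  refine State.unread_eq_of_forall (level_afterWrite_target c p b) fun i x hx => ?_
  obtain ⟨hi, rfl⟩ := List.getElem?_eq_some_iff.1 hx
  have hnd : ((c.kept p b).map Prod.fst).Nodup := by
    have := nodup_buffer hb
    rw [← kept_append_excess, List.nodup_append] at this
    exact this.1
  have hmem : (c.kept p b)[i].1 ∈ (c.kept p b).map Prod.fst :=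
    List.mem_map_of_mem (List.getElem_mem hi)
  have hidx := hnd.idxOf_getElem i (by simpa using hi)
  rw [List.getElem_map] at hidx
  simp only [State.afterWrite, State.posAfterWrite, if_pos hmem]
  rw [hidx]

/-- Levels are of three kinds: the target, the other emptied ones, and the untouched ones. In the
target the counter equals the number of unread blocks, so the budget holds at once. For an untouched
level of partition `p`, `lowerCount` grows by 1, which pays for the pending access counted by `e p`.
-/
theorem Inv.afterWrite {e : Fin q.P → ℕ} {c : State Unit q} (h : Inv e c) {p : Fin q.P}
    (he : e p ≤ 1) {b : Option (Block q)} (hb : Popped c p b) :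
    Inv (Function.update e p 0) (c.afterWrite p b ()) := by
  have hnd := nodup_buffer hb
  rw [← kept_append_excess, List.nodup_append] at hnd
  have hrun_none : ∀ ℓ ∈ c.run p, ℓ ≠ c.target p → (c.afterWrite p b ()).level p ℓ = none := by
    intro ℓ hℓ hne
    simp [State.afterWrite, hℓ, hne]
  have hcases : ∀ p' ℓ, (p' = p ∧ ℓ = c.target p) ∨ (p' = p ∧ ℓ ≠ c.target p ∧ ℓ ∈ c.run p) ∨
      ¬(p' = p ∧ (ℓ = c.target p ∨ ℓ ∈ c.run p)) := by
    intro p' ℓ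
    tauto
  refine ⟨?_, ?_, ?_, ?_, ?_, ?_⟩
  · intro p' ℓ lv hlv
    rcases hcases p' ℓ with ⟨rfl, rfl⟩ | ⟨rfl, hne, hr⟩ | hn
    · rw [level_afterWrite_target, Option.some.injEq] at hlv
      subst hlv
      exact ⟨by simp [State.kept], le_rfl⟩
    · rw [hrun_none ℓ hr hne] at hlv
      cases hlv
    · rw [level_afterWrite_of_not b hn] at hlv
      exact h.len p' ℓ lv hlv
  · have hold : ∀ p', ∀ x ∈ c.slot p', (c.afterWrite p b ()).pos x.1 = .cache p' := by
      intro p' x hx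
      have hpos := h.slot_pos p' x hx
      have hnot : x.1 ∉ (c.buffer p b).map Prod.fst := by
        intro hmem
        rcases fromBuffer_of_mem hb hmem with ⟨h₁, h₂⟩ | ⟨_, _, _, h₁⟩
        · rw [hpos, Loc.cache.injEq] at h₁
          subst h₁
          exact h₂ (List.mem_map_of_mem hx)
        · rw [hpos] at h₁
          cases h₁
      rw [← kept_append_excess, List.mem_append, not_or] at hnot
      simp [State.afterWrite, State.posAfterWrite, hnot.1, hnot.2, hpos]
    intro p' x hx
    by_cases hp : p' = p
    · subst hp
      simp only [State.afterWrite, Function.update_self, List.mem_append] at hx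
      rcases hx with hx | hx
      · exact hold p' x hx
      · have hmem : x.1 ∈ (c.excess p' b).map Prod.fst := List.mem_map_of_mem hx
        have hnot : x.1 ∉ (c.kept p' b).map Prod.fst := fun hk => hnd.2.2 _ hk _ hmem rfl
        simp only [State.afterWrite, State.posAfterWrite, if_neg hnot, if_pos hmem]
    · simp only [State.afterWrite, Function.update_of_ne hp] at hx
      exact hold p' x hx
  · intro p'
    by_cases hp : p' = p
    · subst hp
      simp only [State.afterWrite, Function.update_self, List.map_append]
      rw [List.nodup_append]
      refine ⟨h.slot_nodup p', hnd.2.1, ?_⟩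
      rintro u hu u' hu' rfl
      obtain ⟨x, hx, rfl⟩ := List.mem_map.1 hu
      have hpos := h.slot_pos p' x hx
      have hmem : x.1 ∈ (c.buffer p' b).map Prod.fst := by
        rw [← kept_append_excess]
        exact List.mem_append_right _ hu'
      rcases fromBuffer_of_mem hb hmem with ⟨_, h₂⟩ | ⟨_, _, _, h₁⟩
      · exact h₂ hu
      · rw [hpos] at h₁
        cases h₁
    · simp only [State.afterWrite, Function.update_of_ne hp]
      exact h.slot_nodup p'
  · intro u p' ℓ i hpos
    rcases hcases p' ℓ with ⟨rfl, rfl⟩ | ⟨rfl, hne, hr⟩ | hn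
    · refine ⟨_, level_afterWrite_target c p' b, ?_⟩
      by_cases hk : u ∈ (c.kept p' b).map Prod.fst
      · simp only [State.afterWrite, State.posAfterWrite, if_pos hk, Loc.server.injEq,
          true_and] at hpos
        have hlt := List.idxOf_lt_length_iff.2 hk
        have hget := List.getElem_idxOf hlt
        rw [List.getElem_map] at hget
        subst hpos
        refine ⟨((c.kept p' b)[((c.kept p' b).map Prod.fst).idxOf u]'(by simpa using hlt)).2, ?_⟩
        rw [List.getElem?_eq_getElem (by simpa using hlt), Option.some.injEq]
        exact Prod.ext hget rfl
      -- A block that the old position map places in the target level would have been collected,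
      -- since a filled target belongs to the run; it would then be among the kept or the excess
      -- blocks.
      · exfalso
        by_cases hx : u ∈ (c.excess p' b).map Prod.fst
        · simp [State.afterWrite, State.posAfterWrite, hk, hx] at hpos
        · simp only [State.afterWrite, State.posAfterWrite, if_neg hk, if_neg hx] at hpos
          obtain ⟨lv, hlv, d, hd⟩ := h.server u _ _ i hpos
          have hmemrun : c.target p' ∈ c.run p' := by
            rw [State.target_eq, State.run_eq]
            refine (targetLevel_mem_run_or _).resolve_right ?_
            rw [← State.target_eq, State.fill, hlv]
            simp
          have hmem : u ∈ (c.buffer p' b).map Prod.fst := by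
            refine List.mem_map.2 ⟨(u, d), List.mem_append_left _ ?_, rfl⟩
            refine List.mem_flatMap.2 ⟨_, hmemrun, List.mem_map.2 ⟨((u, d), i), ?_, rfl⟩⟩
            exact State.mem_unread.2 ⟨lv, hlv, hd, hpos⟩
          rw [← kept_append_excess] at hmem
          exact (List.mem_append.1 hmem).elim hk hx
    · exfalso
      by_cases hk : u ∈ (c.kept p' b).map Prod.fst
      · simp only [State.afterWrite, State.posAfterWrite, if_pos hk, Loc.server.injEq] at hpos
        exact hne hpos.2.1.symm
      · by_cases hx : u ∈ (c.excess p' b).map Prod.fst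
        · simp [State.afterWrite, State.posAfterWrite, hk, hx] at hpos
        · simp only [State.afterWrite, State.posAfterWrite, if_neg hk, if_neg hx] at hpos
          obtain ⟨lv, hlv, d, hd⟩ := h.server u _ _ i hpos
          have hmem : u ∈ (c.buffer p' b).map Prod.fst := by
            refine List.mem_map.2 ⟨(u, d), List.mem_append_left _ ?_, rfl⟩
            refine List.mem_flatMap.2 ⟨_, hr, List.mem_map.2 ⟨((u, d), i), ?_, rfl⟩⟩
            exact State.mem_unread.2 ⟨lv, hlv, hd, hpos⟩
          rw [← kept_append_excess] at hmem
          exact (List.mem_append.1 hmem).elim hk hx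
    · rw [level_afterWrite_of_not b hn]
      exact h.server u p' ℓ i ((pos_afterWrite_iff hb hn u i).1 hpos)
  · intro p' ℓ hfill
    rcases hcases p' ℓ with ⟨rfl, rfl⟩ | ⟨rfl, hne, hr⟩ | hn
    · rw [unread_afterWrite_target hb, State.count, level_afterWrite_target]
      simp only [Option.elim_some, List.length_zipIdx]
      omega
    · rw [State.fill, hrun_none ℓ hr hne] at hfill
      cases hfill
    · have hfill' : c.fill p' ℓ = true := by
        rw [State.fill, level_afterWrite_of_not b hn] at hfill
        exact hfill
      rw [unread_afterWrite_of_not hb hn, State.count, level_afterWrite_of_not b hn,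
        State.fill_afterWrite]
      have hbud := h.budget p' ℓ hfill'
      rw [State.count] at hbud
      by_cases hp : p' = p
      · subst hp
        simp only [true_and, not_or] at hn
        rw [Function.update_self, Function.update_self,
          lowerCount_fillingAfterWrite (g := c.fill p') hn.2
            (by rw [← State.target_eq]; exact hn.1)]
        omega
      · rwa [Function.update_of_ne hp, Function.update_of_ne hp]
  · intro p'
    rw [State.fill_afterWrite]
    by_cases hp : p' = p
    · subst hp
      rw [Function.update_self, fillingAfterWrite]
      split_ifs with h₁ h₂
      · rfl
      -- If the top level is emptied, all levels were filled, and then the top level is itself the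
      -- target.
      · exact absurd (targetLevel_eq_top h₂).symm h₁
      · exact h.top p'
    · rw [Function.update_of_ne hp]
      exact h.top p'

/-- The fetched indices need no further accounting: a collected level is either the target, whose
used set is reset, or becomes unfilled, where everything counts as used. -/
theorem Inv.freshStep_write {e : Fin q.P → ℕ} {c : State Unit q} (h : Inv e c) {p : Fin q.P}
    (he : e p ≤ 1) {b : Option (Block q)} (hb : Popped c p b) :
    FreshStep c (c.writeOps p b) (c.afterWrite p b ()) := by
  have hrun : (c.run p).Nodup := (List.takeWhile_sublist _).nodup (List.nodup_finRange _)
  obtain ⟨h₁, h₂⟩ := freshScript_fetchOps true p (c.run p) hrun (c.reshuffled p) c.used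
    fun ℓ hℓ => h.reshuffled_fresh he (mem_run_isSome hℓ)
  refine ⟨h₁.append ⟨trivial, trivial⟩, ?_⟩
  rw [State.writeOps, List.foldl_append, h₂]
  intro p' ℓ
  simp only [List.foldl_cons, List.foldl_nil, Op.use, Used.set]
  split_ifs with ht hr
  · exact Set.empty_subset _
  · obtain ⟨rfl, hr⟩ := hr
    have hnone : (c.afterWrite p' b ()).fill p' ℓ = false := by
      have : ℓ ≠ c.target p' := fun h => ht ⟨rfl, h⟩
      simp [State.fill, State.afterWrite, hr, this]
    simp only [State.used, hnone]
    exact Set.subset_univ _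
  · have hn : ¬(p' = p ∧ (ℓ = c.target p ∨ ℓ ∈ c.run p)) := by tauto
    simp only [State.used, State.fill, State.count, level_afterWrite_of_not b hn,
      unread_afterWrite_of_not hb hn]
    exact le_rfl

/-- All collected blocks belong to partition `p` and end up in its target level or back in its slot.
Evictions therefore leave the random assignment of blocks to partitions alone. -/
theorem partition_afterWrite {c : State Unit q} {p : Fin q.P} {b : Option (Block q)}
    (hb : Popped c p b) (u : Fin q.N) :
    ((c.afterWrite p b ()).pos u).partition = (c.pos u).partition := by
  by_cases hu : u ∈ (c.buffer p b).map Prod.fst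
  · have hold : (c.pos u).partition = p := by
      rcases fromBuffer_of_mem hb hu with ⟨h, -⟩ | ⟨_, _, _, h⟩ <;> rw [h] <;> rfl
    rw [hold]
    rw [← kept_append_excess, List.mem_append] at hu
    simp only [State.afterWrite, State.posAfterWrite]
    split_ifs with hk hx
    · rfl
    · rfl
    · exact hold
  · rw [← kept_append_excess, List.mem_append, not_or] at hu
    simp [State.afterWrite, State.posAfterWrite, hu.1, hu.2]

/-! #### Reading -/

theorem State.partition_ne_of_isNone_hit {c : State Unit q} {u : Fin q.N} {p : Fin q.P}
    {ℓ : Fin q.L} (h : c.hit (some u) p ℓ = none) (i : ℕ) : c.pos u ≠ .server p ℓ i := by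
  intro hpos
  simp [State.hit, hpos] at h

theorem State.pos_of_hit {c : State Unit q} {u : Fin q.N} {p : Fin q.P} {ℓ : Fin q.L} {i : ℕ}
    (h : c.hit (some u) p ℓ = some i) : c.pos u = .server p ℓ i := by
  simp only [State.hit, Option.map_some] at h
  split at h
  · rename_i heq
    split_ifs at h with hc
    rw [Option.some.injEq] at heq h
    rw [heq, hc.1, hc.2, h]
  · cases h

theorem fill_afterRead (c : State Unit q) (y : Request q) (r : Fin q.P) :
    (c.afterRead y r).fill = c.fill := by
  funext p ℓ
  simp only [State.fill, State.afterRead, State.levelsAfterRead]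
  split_ifs with h
  · rw [h.1]
    simp
  · rfl

theorem unread_afterRead (c : State Unit q) (y : Request q) (r : Fin q.P) (p : Fin q.P)
    (ℓ : Fin q.L) :
    (c.afterRead y r).unread p ℓ = (c.unread p ℓ).filter fun b => decide (b.1.1 ≠ y.id) := by
  have hlev : ∀ lv, c.level p ℓ = some lv → ∃ lv', (c.afterRead y r).level p ℓ = some lv' ∧
      lv'.blocks = lv.blocks := by
    intro lv hlv
    simp only [State.afterRead, State.levelsAfterRead]
    split_ifs with h
    · rw [← h.1, hlv]
      refine ⟨_, rfl, ?_⟩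
      unfold readEffect
      split_ifs <;> rfl
    · exact ⟨lv, hlv, rfl⟩
  cases hl : c.level p ℓ with
  | none =>
    have : (c.afterRead y r).level p ℓ = none := by
      have := congrFun (congrFun (fill_afterRead c y r) p) ℓ
      simpa [State.fill, hl] using this
    simp [State.unread, hl, this]
  | some lv =>
    obtain ⟨lv', hlv', hbl⟩ := hlev lv hl
    simp only [State.unread, hl, hlv', Option.elim_some, State.unreadReal, hbl, List.filter_filter]
    refine List.filter_congr fun b _ => ?_
    by_cases hb : b.1.1 = y.id
    · simp [State.afterRead, hb]
    · simp [State.afterRead, hb]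

theorem count_afterRead {c : State Unit q} (y : Request q) (r : Fin q.P) {p : Fin q.P}
    {ℓ : Fin q.L} (hf : c.fill p ℓ = true) :
    (c.afterRead y r).count p ℓ = c.count p ℓ +
      if p = (c.pos y.id).partition ∧ c.hit (some y.id) p ℓ = none then 1 else 0 := by
  rw [State.fill, Option.isSome_iff_exists] at hf
  obtain ⟨lv, hlv⟩ := hf
  simp only [State.count, State.afterRead, State.levelsAfterRead, List.mem_finRange, and_true]
  by_cases hp : p = (c.pos y.id).partition
  · rw [if_pos hp, ← hp, hlv]
    cases hh : c.hit (some y.id) p ℓ <;> simp [readEffect]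
  · simp [hp]

theorem mem_slotWithout {e : Fin q.P → ℕ} {c : State Unit q} (h : Inv e c) {u : Fin q.N}
    {p : Fin q.P} {b : Block q} (hb : b ∈ c.slotWithout u p) : b ∈ c.slot p ∧ b.1 ≠ u := by
  unfold State.slotWithout at hb
  cases hpos : c.pos u with
  | cache p' =>
    simp only [hpos] at hb
    by_cases hp : p = p'
    · subst hp
      simpa using hb
    · rw [Function.update_of_ne hp] at hb
      refine ⟨hb, fun hu => hp ?_⟩
      have := h.slot_pos p b hb
      rw [hu, hpos, Loc.cache.injEq] at this
      exact this.symm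
  | server p' ℓ i =>
    simp only [hpos] at hb
    refine ⟨hb, fun hu => ?_⟩
    have := h.slot_pos p b hb
    rw [hu, hpos] at this
    cases this

theorem nodup_slotWithout {e : Fin q.P → ℕ} {c : State Unit q} (h : Inv e c) (u : Fin q.N)
    (p : Fin q.P) : ((c.slotWithout u p).map Prod.fst).Nodup := by
  unfold State.slotWithout
  cases hpos : c.pos u with
  | cache p' =>
    by_cases hp : p = p'
    · subst hp
      simp only [Function.update_self]
      exact (h.slot_nodup p).sublist (List.filter_sublist.map _)
    · simp only [Function.update_of_ne hp]
      exact h.slot_nodup p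
  | server p' ℓ i => exact h.slot_nodup p

/-- In each filled level of the partition, the read either advances the dummy counter by 1 or
removes one unread block. Either way the budget grows by 1, which is recorded in `e` until the
following write. -/
theorem Inv.afterRead {c : State Unit q} (h : Inv (fun _ => 0) c) (y : Request q) (r : Fin q.P) :
    Inv (Function.update (fun _ => 0) (c.pos y.id).partition 1) (c.afterRead y r) := by
  have hlev : ∀ p ℓ lv', (c.afterRead y r).level p ℓ = some lv' → ∃ lv, c.level p ℓ = some lv ∧
      lv'.blocks = lv.blocks ∧ lv.cnt ≤ lv'.cnt := by
    intro p ℓ lv' hlv'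
    simp only [State.afterRead, State.levelsAfterRead] at hlv'
    split_ifs at hlv' with hp
    · rw [Option.map_eq_some_iff] at hlv'
      obtain ⟨lv, hlv, rfl⟩ := hlv'
      refine ⟨lv, hp.1 ▸ hlv, ?_⟩
      unfold readEffect
      split_ifs
      · exact ⟨rfl, le_rfl⟩
      · exact ⟨rfl, Nat.le_succ _⟩
    · exact ⟨lv', hlv', rfl, le_rfl⟩
  refine ⟨?_, ?_, ?_, ?_, ?_, ?_⟩
  · intro p ℓ lv' hlv'
    obtain ⟨lv, hlv, hb, hc⟩ := hlev p ℓ lv' hlv'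
    have := h.len p ℓ lv hlv
    rw [hb]
    omega
  · intro p b hb
    have hold : ∀ p, ∀ b ∈ c.slotWithout y.id p, (c.afterRead y r).pos b.1 = .cache p := by
      intro p b hb
      obtain ⟨h₁, h₂⟩ := mem_slotWithout h hb
      simp only [State.afterRead, Function.update_of_ne h₂]
      exact h.slot_pos p b h₁
    by_cases hp : p = r
    · subst hp
      simp only [State.afterRead, Function.update_self, List.mem_append,
        List.mem_singleton] at hb
      rcases hb with hb | rfl
      · exact hold p b hb
      · simp [State.afterRead]
    · simp only [State.afterRead, Function.update_of_ne hp] at hb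
      exact hold p b hb
  · intro p
    by_cases hp : p = r
    · subst hp
      simp only [State.afterRead, Function.update_self, List.map_append, List.map_singleton]
      rw [List.nodup_append]
      refine ⟨nodup_slotWithout h _ _, by simp, ?_⟩
      intro u hu u' hu'
      obtain ⟨b, hb, rfl⟩ := List.mem_map.1 hu
      rw [List.mem_singleton] at hu'
      subst hu'
      exact (mem_slotWithout h hb).2
    · simp only [State.afterRead, Function.update_of_ne hp]
      exact nodup_slotWithout h _ _
  · intro u p ℓ i hpos
    by_cases hu : u = y.id
    · subst hu
      simp [State.afterRead] at hpos
    · simp only [State.afterRead, Function.update_of_ne hu] at hpos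
      obtain ⟨lv, hlv, d, hd⟩ := h.server u p ℓ i hpos
      have hf := congrFun (congrFun (fill_afterRead c y r) p) ℓ
      simp only [State.fill, hlv, Option.isSome_some] at hf
      rw [Option.isSome_iff_exists] at hf
      obtain ⟨lv', hlv'⟩ := hf
      obtain ⟨lv₂, hlv₂, hb, -⟩ := hlev p ℓ lv' hlv'
      rw [hlv, Option.some.injEq] at hlv₂
      subst hlv₂
      exact ⟨lv', hlv', d, hb ▸ hd⟩
  · intro p ℓ hf
    rw [fill_afterRead] at hf ⊢
    rw [unread_afterRead, count_afterRead y r hf]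
    have hbud := h.budget p ℓ hf
    have hself : (∀ i, c.pos y.id ≠ .server p ℓ i) →
        (c.unread p ℓ).filter (fun b => decide (b.1.1 ≠ y.id)) = c.unread p ℓ := by
      intro hne
      rw [List.filter_eq_self]
      intro b hb
      obtain ⟨_, _, _, hpos⟩ := State.mem_unread.1 hb
      have : b.1.1 ≠ y.id := fun hb => hne _ (hb ▸ hpos)
      simpa using this
    by_cases hp : p = (c.pos y.id).partition
    · rw [hp, Function.update_self, ← hp]
      cases hh : c.hit (some y.id) p ℓ with
      | none =>
        rw [hself (State.partition_ne_of_isNone_hit hh)]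
        split_ifs <;> omega
      | some i =>
        -- Identifiers of unread blocks are distinct, so the requested block accounts for at most
        -- one of them.
        have hlen : (c.unread p ℓ).length ≤
            ((c.unread p ℓ).filter fun b => decide (b.1.1 ≠ y.id)).length + 1 := by
          have h₁ := List.length_eq_length_filter_add (l := c.unread p ℓ)
            fun b => decide (b.1.1 ≠ y.id)
          have h₂ : ((c.unread p ℓ).filter fun b => !decide (b.1.1 ≠ y.id)).length ≤ 1 := by
            have h₃ := List.nodup_iff_count_le_one.1 (c.nodup_ids_unread p ℓ) y.id
            rw [List.count, List.countP_map, List.countP_eq_length_filter] at h₃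
            simpa [Function.comp_def, beq_eq_decide] using h₃
          omega
        simp only [reduceCtorEq, and_false, if_false]
        omega
    · rw [hself fun i hpos => hp (by rw [hpos]; rfl), Function.update_of_ne hp]
      simp only [hp, false_and, if_false]
      omega
  · intro p
    rw [fill_afterRead]
    exact h.top p

/-- The index fetched is that of an unread real block, which does not yet count as used, or the
dummy counter, which exceeds all used indices. Without a pending access, the counter is below `half
+ 2 ^ ℓ`, so this dummy exists. -/
theorem Inv.freshStep_read {c : State Unit q} (h : Inv (fun _ => 0) c) (y : Request q)
    (r : Fin q.P) :
    FreshStep c (c.readOps (some y.id) (c.pos y.id).partition) (c.afterRead y r) := by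
  set p := (c.pos y.id).partition with hp
  have hnd : (c.filled p).Nodup := (List.nodup_finRange _).filter _
  have hmem : ∀ ℓ, ℓ ∈ c.filled p ↔ c.fill p ℓ = true := by
    intro ℓ
    simp [State.filled, State.fill]
  have hunread : ∀ ℓ i, c.hit (some y.id) p ℓ = some i →
      ∃ d, ((y.id, d), i) ∈ c.unread p ℓ := by
    intro ℓ i hi
    have hpos := State.pos_of_hit hi
    obtain ⟨lv, hlv, d, hd⟩ := h.server _ _ _ _ hpos
    exact ⟨d, State.mem_unread.2 ⟨lv, hlv, hd, hpos⟩⟩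
  have hcount : c.used ≤ (c.afterRead y r).used := by
    intro p' ℓ
    simp only [State.used, fill_afterRead]
    split_ifs with hf
    · rw [unread_afterRead, count_afterRead y r hf]
      intro i hi
      refine ⟨lt_of_lt_of_le hi.1 (Nat.le_add_right _ _), fun hi' => hi.2 ?_⟩
      obtain ⟨b, hb, rfl⟩ := List.mem_map.1 hi'
      exact List.mem_map_of_mem (List.mem_filter.1 hb).1
    · exact le_rfl
  obtain ⟨h₁, h₂⟩ := freshScript_fetchOps false p (c.filled p) hnd
    (fun ℓ => {(c.hit (some y.id) p ℓ).getD (c.count p ℓ)}) c.used (by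
      intro ℓ hℓ
      have hf := (hmem ℓ).1 hℓ
      simp only [Finset.coe_singleton, Set.disjoint_singleton_left, Finset.mem_singleton,
        forall_eq, State.used, hf, if_true, Set.mem_ofPred_eq, not_and, not_not]
      cases hh : c.hit (some y.id) p ℓ with
      | none =>
        simp only [Option.getD_none, lt_irrefl, false_imp_iff, true_and]
        have hbud := h.budget p ℓ hf
        have := h.length_unread_le_half p ℓ
        have := lowerCount_lt (c.fill p) ℓ
        have := q.half_add_pow_le_size ℓ
        omega
      | some i =>
        obtain ⟨d, hd⟩ := hunread ℓ i hh
        refine ⟨fun _ => List.mem_map.2 ⟨_, hd, rfl⟩, ?_⟩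
        exact (h.lt_count hd).2.trans_le (q.half_le_size ℓ))
  refine ⟨h₁, ?_⟩
  rw [State.readOps, h₂]
  intro p' ℓ
  dsimp only
  split_ifs with hc
  · obtain ⟨rfl, hℓ⟩ := hc
    have hf := (hmem ℓ).1 hℓ
    refine Set.union_subset (hcount p ℓ) ?_
    simp only [Finset.coe_singleton, Set.singleton_subset_iff, State.used, fill_afterRead, hf,
      if_true, Set.mem_ofPred_eq]
    rw [unread_afterRead, count_afterRead y r hf]
    cases hh : c.hit (some y.id) p ℓ with
    | none =>
      refine ⟨by simp [← hp], fun hi => ?_⟩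
      obtain ⟨b, hb, hi⟩ := List.mem_map.1 hi
      have := (h.lt_count (List.mem_filter.1 hb).1).1
      rw [Option.getD_none] at hi
      omega
    | some i =>
      -- The index of the requested block now counts as used: another unread block with this index
      -- would be the same entry of the level, hence the requested block, which has left.
      obtain ⟨d, hd⟩ := hunread ℓ i hh
      refine ⟨(h.lt_count hd).1.trans_le (Nat.le_add_right _ _), fun hi => ?_⟩
      obtain ⟨b, hb, hi⟩ := List.mem_map.1 hi
      rw [Option.getD_some] at hi
      obtain ⟨hb, hne⟩ := List.mem_filter.1 hb
      obtain ⟨lv, hlv, hget, -⟩ := State.mem_unread.1 hb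
      obtain ⟨lv', hlv', hget', -⟩ := State.mem_unread.1 hd
      rw [hlv, Option.some.injEq] at hlv'
      subst hlv'
      rw [hi] at hget
      simp only at hget'
      rw [hget', Option.some.injEq] at hget
      simp [← hget] at hne
  · exact hcount p' ℓ

end Invariants

/-! ### The shape of a script does not depend on the requests -/

section Shape

variable {q : Params}

theorem Inv.pop {e : Fin q.P → ℕ} {c : State Unit q} (h : Inv e c) (p : Fin q.P) :
    Inv e (c.pop p) ∧ Popped (c.pop p) p (c.slot p).head? := by
  have hsub : ∀ p', ((c.pop p).slot p').Sublist (c.slot p') := by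
    intro p'
    by_cases hp : p' = p
    · subst hp
      simpa [State.pop] using List.tail_sublist _
    · simp [State.pop, hp]
  refine ⟨⟨h.len, fun p' b hb => h.slot_pos p' b ((hsub p').subset hb),
    fun p' => (h.slot_nodup p').sublist ((hsub p').map _), h.server, h.budget, h.top⟩, ?_⟩
  intro b hb
  have hnd := h.slot_nodup p
  have hpos := h.slot_pos p
  cases hs : c.slot p with
  | nil => simp [hs] at hb
  | cons b' bs =>
    rw [hs] at hb hnd hpos
    obtain rfl : b' = b := by simpa using hb
    refine ⟨hpos b' List.mem_cons_self, ?_⟩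
    simp only [State.pop, Function.update_self, hs, List.tail_cons]
    exact (List.nodup_cons.1 hnd).1

/-- The fillings of all partitions and the counter of the sequential scan. -/
abbrev Filling (q : Params) := (Fin q.P → Fin q.L → Bool) × Fin q.P

/-- The fillings of all partitions after a write to partition `p`. -/
def writeFilling (g : Fin q.P → Fin q.L → Bool) (p : Fin q.P) : Fin q.P → Fin q.L → Bool :=
  Function.update g p (fillingAfterWrite (g p))

/-- The shape of reading from a partition. -/
def readShape (g : Fin q.P → Fin q.L → Bool) (p : Fin q.P) : List (Op q) :=
  fetchOps false p ((List.finRange q.L).filter (g p)) fun _ => Finset.range 1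

/-- The shape of an eviction. -/
def evictShape (g : Fin q.P → Fin q.L → Bool) (p : Fin q.P) : List (Op q) :=
  fetchOps true p (runLevels (g p)) (fun ℓ => Finset.range (q.half ℓ)) ++
    [.write p (targetLevel (g p)) []]

/-- The shape of a sequential scan, and the filling after it. -/
def scanShape : ℕ → Filling q → List (Op q) × Filling q
  | 0, x => ([], x)
  | k + 1, x =>
    let r := scanShape k (writeFilling x.1 (x.2 + 1), x.2 + 1)
    (evictShape x.1 (x.2 + 1) ++ r.1, r.2)

/-- The shape of a request that accesses partition `p`, and the filling after it. -/
def accessShape (p : Fin q.P) (k : ℕ) (x : Filling q) : List (Op q) × Filling q :=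
  let r := scanShape k (writeFilling x.1 p, x.2)
  (readShape x.1 p ++ (evictShape x.1 p ++ r.1), r.2)

/-- The random shape of the script of a sequence of requests, for given partitions of the blocks. -/
noncomputable def runShape : List (Request q) → (Fin q.N → Fin q.P) → Filling q → PMF (List (Op q))
  | [], _, _ => PMF.pure []
  | y :: ys, a, x => (PMF.uniformOfFintype (Fin q.P)).bind fun r => (boundedGeometric q).bind fun k =>
    (runShape ys (Function.update a y.id r) (accessShape (a y.id) k x).2).map
      ((accessShape (a y.id) k x).1 ++ ·)

/-- The random shape of the script of a number of accesses to random partitions. -/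
noncomputable def randomShape : ℕ → Filling q → PMF (List (Op q))
  | 0, _ => PMF.pure []
  | T + 1, x => (PMF.uniformOfFintype (Fin q.P)).bind fun p => (boundedGeometric q).bind fun k =>
    (randomShape T (accessShape p k x).2).map ((accessShape p k x).1 ++ ·)

theorem map_shape_fetchOps (m : Bool) (p : Fin q.P) (ls : List (Fin q.L))
    (I : Fin q.L → Finset ℕ) (s : Fin q.L → ℕ) (h : ∀ ℓ, (I ℓ).card = s ℓ) :
    (fetchOps m p ls I).map Op.shape = fetchOps m p ls fun ℓ => Finset.range (s ℓ) := by
  simp only [fetchOps, List.map_flatMap, List.map_append, List.map_singleton, Op.shape, h]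
  cases m <;> rfl

/-- The script `os` from `c` to `c'` is fresh, has the given shape, and does not move blocks between
partitions. -/
structure HasShape (c : State Unit q) (os : List (Op q)) (c' : State Unit q)
    (x : List (Op q) × Filling q) : Prop where
  step : FreshStep c os c'
  inv : Inv (fun _ => 0) c'
  shape : os.map Op.shape = x.1
  filling : (c'.fill, c'.ecnt) = x.2
  partition : ∀ u, (c'.pos u).partition = (c.pos u).partition

theorem HasShape.trans {c c' c'' : State Unit q} {os os' : List (Op q)}
    {x x' : List (Op q) × Filling q} (h : HasShape c os c' x) (h' : HasShape c' os' c'' x') :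
    HasShape c (os ++ os') c'' (x.1 ++ x'.1, x'.2) :=
  ⟨h.step.trans h'.step, h'.inv, by rw [List.map_append, h.shape, h'.shape], h'.filling,
    fun u => (h'.partition u).trans (h.partition u)⟩

/-- The function `e` is left open in order to cover both kinds of eviction: the piggy-backed one,
with one pending access to `p`, and the background ones, with none. -/
theorem Inv.hasShape_evict {e : Fin q.P → ℕ} {c : State Unit q} (h : Inv e c) {p : Fin q.P}
    (he : e p ≤ 1) (he' : Function.update e p 0 = fun _ => 0) :
    HasShape c (ctlEvict p c).1 (ctlEvict p c).2
      (evictShape c.fill p, (writeFilling c.fill p, c.ecnt)) := by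
  obtain ⟨hinv, hpop⟩ := h.pop p
  have hstep := hinv.freshStep_write he hpop
  refine ⟨⟨hstep.fresh, hstep.use_le⟩, ?_, ?_, ?_, partition_afterWrite hpop⟩
  · rw [← he']
    exact hinv.afterWrite he hpop
  · rw [ctlEvict, State.writeOps, List.map_append,
      map_shape_fetchOps _ _ _ _ _ (hinv.card_reshuffled p), State.target_eq]
    rfl
  · rw [ctlEvict, State.fill_afterWrite]
    rfl

theorem Inv.hasShape_scan (k : ℕ) {c : State Unit q} (h : Inv (fun _ => 0) c) :
    HasShape c (ctlScan k c).1 (ctlScan k c).2 (scanShape k (c.fill, c.ecnt)) := by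
  induction k generalizing c with
  | zero => exact ⟨⟨trivial, le_rfl⟩, h, rfl, rfl, fun _ => rfl⟩
  | succ k ih =>
    have h' : Inv (fun _ => 0) { c with ecnt := c.ecnt + 1 } :=
      ⟨h.len, h.slot_pos, h.slot_nodup, h.server, h.budget, h.top⟩
    have h₁ := h'.hasShape_evict (p := c.ecnt + 1) (Nat.zero_le _) (by simp)
    have h₂ := ih h₁.inv
    rw [h₁.filling] at h₂
    have h₃ := h₁.trans h₂
    exact ⟨⟨h₃.step.fresh, h₃.step.use_le⟩, h₃.inv, h₃.shape, h₃.filling, h₃.partition⟩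

/-- The fresh slot `r` does not influence the shape of the current request; it only determines the
new partition of the requested block, and so becomes visible at the earliest when this block is
requested again. -/
theorem Inv.access {c : State Unit q} (h : Inv (fun _ => 0) c) (y : Request q) (r : Fin q.P)
    (k : ℕ) :
    FreshStep c (ctlAccess y r k c).1 (ctlAccess y r k c).2 ∧
    Inv (fun _ => 0) (ctlAccess y r k c).2 ∧
    (ctlAccess y r k c).1.map Op.shape =
      (accessShape (c.pos y.id).partition k (c.fill, c.ecnt)).1 ∧
    ((ctlAccess y r k c).2.fill, (ctlAccess y r k c).2.ecnt) =
      (accessShape (c.pos y.id).partition k (c.fill, c.ecnt)).2 ∧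
    (fun u => ((ctlAccess y r k c).2.pos u).partition) =
      Function.update (fun u => (c.pos u).partition) y.id r := by
  have h₁ := (h.afterRead y r).hasShape_evict (p := (c.pos y.id).partition) (by simp) (by simp)
  have h₂ := h₁.inv.hasShape_scan k
  rw [h₁.filling] at h₂
  have h₃ := h₁.trans h₂
  rw [fill_afterRead] at h₃
  refine ⟨(h.freshStep_read y r).trans h₃.step, h₃.inv, ?_, h₃.filling, ?_⟩
  · have hread : (c.readOps (some y.id) (c.pos y.id).partition).map Op.shape =
        readShape c.fill (c.pos y.id).partition :=
      map_shape_fetchOps _ _ _ _ (fun _ => 1) fun _ => Finset.card_singleton _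
    refine (List.map_append ..).trans ?_
    rw [hread, h₃.shape]
    rfl
  · funext u
    refine (h₃.partition u).trans ?_
    by_cases hu : u = y.id
    · subst hu
      simp [State.afterRead, Loc.partition]
    · simp [State.afterRead, hu]

theorem freshScript_ctlRun (ys : List (Request q)) {c : State Unit q} (h : Inv (fun _ => 0) c) :
    ∀ os ∈ (ctlRun ys c).support, FreshScript c.used os := by
  induction ys generalizing c with
  | nil =>
    intro os hos
    rw [ctlRun, PMF.mem_support_pure_iff] at hos
    subst hos
    trivial
  | cons y ys ih =>
    intro os hos
    simp only [ctlRun, PMF.mem_support_bind_iff, PMF.mem_support_map_iff] at hos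
    obtain ⟨r, -, k, -, os', hos', rfl⟩ := hos
    obtain ⟨h₁, h₂, -⟩ := h.access y r k
    exact h₁.fresh.append ((ih h₂ os' hos').anti h₁.use_le)

theorem map_shape_ctlRun (ys : List (Request q)) {c : State Unit q} (h : Inv (fun _ => 0) c) :
    (ctlRun ys c).map (List.map Op.shape) =
      runShape ys (fun u => (c.pos u).partition) (c.fill, c.ecnt) := by
  induction ys generalizing c with
  | nil => simp [ctlRun, runShape, PMF.pure_map]
  | cons y ys ih =>
    simp only [ctlRun, runShape, PMF.map_bind, PMF.map_comp]
    congr 1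
    funext r
    congr 1
    funext k
    obtain ⟨-, h₂, h₃, h₄, h₅⟩ := h.access y r k
    rw [← h₅, ← h₄, ← ih h₂, PMF.map_comp]
    congr 1
    funext os
    simp [h₃]

/-! ### Independence of the visited partitions -/

theorem uniformOfFintype_prod (α β : Type*) [Fintype α] [Nonempty α] [Fintype β] [Nonempty β] :
    (PMF.uniformOfFintype α).bind (fun a => (PMF.uniformOfFintype β).map (Prod.mk a)) =
      PMF.uniformOfFintype (α × β) := by
  classical
  ext ⟨a, b⟩
  rw [PMF.bind_apply, tsum_eq_single a]
  · rw [PMF.map_apply, tsum_eq_single b]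
    · simp only [PMF.uniformOfFintype_apply, if_true, Fintype.card_prod, Nat.cast_mul]
      rw [ENNReal.mul_inv] <;> simp
    · intro b' hb
      simp [hb.symm]
  · intro a' ha
    rw [PMF.map_apply, ENNReal.tsum_eq_zero.2, mul_zero]
    intro b'
    simp [ha.symm]

/-- Exchanging a coordinate of a random function with a fresh random value. -/
theorem bind_update_uniform {α β γ : Type*} [Fintype α] [DecidableEq α] [Fintype β] [Nonempty β]
    (u : α) (f : (α → β) → β → PMF γ) :
    ((PMF.uniformOfFintype (α → β)).bind fun a => (PMF.uniformOfFintype β).bind fun r =>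
      f (Function.update a u r) (a u)) =
    (PMF.uniformOfFintype (α → β)).bind fun a => (PMF.uniformOfFintype β).bind fun r => f a r := by
  have hprod : ∀ g : (α → β) × β → PMF γ,
      ((PMF.uniformOfFintype (α → β)).bind fun a => (PMF.uniformOfFintype β).bind fun r =>
        g (a, r)) = (PMF.uniformOfFintype ((α → β) × β)).bind g := by
    intro g
    rw [← uniformOfFintype_prod, PMF.bind_bind]
    simp only [PMF.bind_map, Function.comp_def]
  -- Swapping the value at `u` with the fresh one is an involution on pairs, and so it preserves the
  -- uniform distribution.
  have hinv : Function.Involutive fun x : (α → β) × β => (Function.update x.1 u x.2, x.1 u) := by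
    rintro ⟨a, r⟩
    simp
  rw [hprod fun x => f (Function.update x.1 u x.2) (x.1 u), hprod fun x => f x.1 x.2,
    ← PMF_map_uniformOfFintype_equiv hinv.toPerm, PMF.bind_map,
    PMF_map_uniformOfFintype_equiv hinv.toPerm]
  congr 1
  funext x
  simp

/-- By the exchange, the partition visited is uniform and independent of the updated assignment,
which is again uniform. The next request thus starts from the same situation, whichever block it
asks for. -/
theorem bind_runShape (ys : List (Request q)) (x : Filling q) :
    ((PMF.uniformOfFintype (Fin q.N → Fin q.P)).bind fun a => runShape ys a x) =
      randomShape ys.length x := by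
  induction ys generalizing x with
  | nil => simp [runShape, randomShape]
  | cons y ys ih =>
    simp only [runShape, List.length_cons, randomShape]
    rw [bind_update_uniform y.id fun a p => (boundedGeometric q).bind fun k =>
      (runShape ys a (accessShape p k x).2).map ((accessShape p k x).1 ++ ·), PMF.bind_comm]
    congr 1
    funext p
    rw [PMF.bind_comm]
    congr 1
    funext k
    rw [← PMF.map_bind, ih]

/-! #### The setup -/

theorem map_fst_initialBlocks (a : Fin q.N → Fin q.P) (p : Fin q.P) :
    (initialBlocks a p).map Prod.fst = (List.finRange q.N).filter fun u => decide (a u = p) := by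
  simp [initialBlocks, Function.comp_def]

theorem nodup_initialBlocks (a : Fin q.N → Fin q.P) (p : Fin q.P) :
    ((initialBlocks a p).map Prod.fst).Nodup := by
  rw [map_fst_initialBlocks]
  exact (List.nodup_finRange _).filter _

theorem initialPos_getElem (a : Fin q.N → Fin q.P) (p : Fin q.P) (i : ℕ)
    (hi : i < (initialBlocks a p).length) :
    initialPos a (initialBlocks a p)[i].1 =
      if i < q.half q.top then .server p q.top i else .cache p := by
  have hmem : (initialBlocks a p)[i].1 ∈ (initialBlocks a p).map Prod.fst :=
    List.mem_map_of_mem (List.getElem_mem hi)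
  have ha : a (initialBlocks a p)[i].1 = p := by
    rw [map_fst_initialBlocks, List.mem_filter] at hmem
    simpa using hmem.2
  have hidx := (nodup_initialBlocks a p).idxOf_getElem i (by simpa using hi)
  rw [List.getElem_map] at hidx
  simp only [initialPos, ha, hidx]

theorem fill_initialState (f : Fin q.P → Fin q.n → Bool) (a : Fin q.N → Fin q.P) :
    (initialState f a).fill = initialFilling f := by
  funext p ℓ
  rw [← isSome_initialLevels f a]
  simp [State.fill, initialState]

theorem partition_initialPos (a : Fin q.N → Fin q.P) (u : Fin q.N) :
    (initialPos a u).partition = a u := by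
  unfold initialPos
  split_ifs <;> rfl

/-- No dummy has been consumed and every real block is unread, so the budget holds initially for an
arbitrary filling of the lower levels. -/
theorem unread_initialState (f : Fin q.P → Fin q.n → Bool) (a : Fin q.N → Fin q.P) (p : Fin q.P)
    (ℓ : Fin q.L) : ((initialState f a).unread p ℓ).length = (initialState f a).count p ℓ := by
  cases hl : (initialState f a).level p ℓ with
  | none => simp [State.unread, State.count, hl]
  | some lv =>
    have hb : lv.cnt = lv.blocks.length ∧ initialLevels f a p ℓ = some lv.blocks := by
      simp only [initialState, Option.map_eq_some_iff] at hl
      obtain ⟨b, hb, rfl⟩ := hl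
      exact ⟨rfl, hb⟩
    rw [State.unread_eq_of_forall hl]
    · simp [State.count, hl, hb.1]
    · intro i b hib
      obtain ⟨hi, rfl⟩ := List.getElem?_eq_some_iff.1 hib
      have hb₂ := hb.2
      unfold initialLevels at hb₂
      split_ifs at hb₂ with h₁ h₂
      · rw [Option.some.injEq] at hb₂
        simp only [← hb₂, List.length_take, lt_min_iff] at hi
        simp only [← hb₂, List.getElem_take, initialState]
        rw [initialPos_getElem a p i hi.2, if_pos hi.1, h₁]
      · rw [Option.some.injEq] at hb₂
        simp [← hb₂] at hi

theorem inv_initialState (f : Fin q.P → Fin q.n → Bool) (a : Fin q.N → Fin q.P) :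
    Inv (fun _ => 0) (initialState f a) := by
  refine ⟨?_, ?_, ?_, ?_, ?_, ?_⟩
  · intro p ℓ lv hlv
    simp only [initialState, Option.map_eq_some_iff] at hlv
    obtain ⟨b, hb, rfl⟩ := hlv
    refine ⟨?_, le_rfl⟩
    unfold initialLevels at hb
    split_ifs at hb with h₁ h₂
    · rw [Option.some.injEq] at hb
      simp [← hb, h₁]
    · rw [Option.some.injEq] at hb
      simp [← hb]
  · intro p b hb
    obtain ⟨i, hi, rfl⟩ := List.mem_iff_getElem.1 hb
    simp only [initialState] at hi ⊢
    rw [List.getElem_drop, initialPos_getElem, if_neg (by omega)]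
  · intro p
    exact (nodup_initialBlocks a p).sublist ((List.drop_sublist _ _).map _)
  · intro u p ℓ i hpos
    simp only [initialState, initialPos] at hpos
    split_ifs at hpos with hc
    simp only [Loc.server.injEq] at hpos
    obtain ⟨rfl, rfl, rfl⟩ := hpos
    refine ⟨⟨(), (initialBlocks a (a u)).take (q.half q.top),
      ((initialBlocks a (a u)).take (q.half q.top)).length⟩,
      by simp [initialState, initialLevels], ?_⟩
    have hmem : u ∈ (initialBlocks a (a u)).map Prod.fst := by
      rw [map_fst_initialBlocks, List.mem_filter]
      simp
    have hlt := List.idxOf_lt_length_iff.2 hmem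
    have hget := List.getElem_idxOf hlt
    rw [List.getElem_map] at hget
    rw [List.length_map] at hlt
    refine ⟨((initialBlocks a (a u))[((initialBlocks a (a u)).map Prod.fst).idxOf u]).2, ?_⟩
    rw [List.getElem?_take_of_lt hc, List.getElem?_eq_getElem hlt, Option.some.injEq]
    exact Prod.ext hget rfl
  · intro p ℓ _
    rw [unread_initialState]
    omega
  · intro p
    rw [fill_initialState]
    simp [initialFilling, Params.top]

theorem freshScript_fillOps (g : Fin q.P → Fin q.L → Bool) (l : List (Fin q.P × Fin q.L))
    (U : Used q) : FreshScript U (fillOps g l) ∧ (fillOps g l).foldl Op.use U =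
      fun p ℓ => if (p, ℓ) ∈ l ∧ g p ℓ = true then ∅ else U p ℓ := by
  induction l generalizing U with
  | nil => simp [fillOps, FreshScript]
  | cons x l ih =>
    by_cases hx : g x.1 x.2 = true
    · have hops : fillOps g (x :: l) = .fill x.1 x.2 :: fillOps g l := by simp [fillOps, hx]
      rw [hops]
      refine ⟨⟨trivial, (ih _).1⟩, (ih (U.set x.1 x.2 ∅)).2.trans ?_⟩
      funext p ℓ
      by_cases h : (p, ℓ) = x
      · subst h
        simp [Used.set, hx]
      · have h' : ¬(p = x.1 ∧ ℓ = x.2) := fun h' => h (Prod.ext h'.1 h'.2)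
        simp [Used.set, h, h']
    · have hops : fillOps g (x :: l) = fillOps g l := by simp [fillOps, hx]
      rw [hops]
      refine ⟨(ih U).1, (ih U).2.trans ?_⟩
      funext p ℓ
      by_cases h : (p, ℓ) = x
      · subst h
        simp [hx]
      · simp [h]

theorem freshScript_script (ys : List (Request q)) :
    ∀ os ∈ (script ys).support, FreshScript (fun _ _ => Set.univ) os := by
  intro os hos
  simp only [script, PMF.mem_support_bind_iff, PMF.mem_support_map_iff] at hos
  obtain ⟨f, -, a, -, os', hos', rfl⟩ := hos
  obtain ⟨h₁, h₂⟩ := freshScript_fillOps (initialFilling f)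
    (List.product (List.finRange q.P) (List.finRange q.L)) fun _ _ => Set.univ
  refine FreshScript.append (os := setupOps f) ⟨trivial, h₁⟩
    ((freshScript_ctlRun ys (inv_initialState f a) os' hos').anti ?_)
  refine le_of_eq_of_le h₂ ?_
  intro p ℓ
  have hmem : (p, ℓ) ∈ List.product (List.finRange q.P) (List.finRange q.L) :=
    List.pair_mem_product.2 ⟨List.mem_finRange p, List.mem_finRange ℓ⟩
  simp only [hmem, true_and, State.used, fill_initialState]
  split_ifs
  · exact Set.empty_subset _
  · exact le_rfl

theorem map_shape_setupOps (f : Fin q.P → Fin q.n → Bool) :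
    (setupOps f).map Op.shape = setupOps f := by
  simp [setupOps, fillOps, Op.shape, Function.comp_def]

/-- The random shape of the script of any sequence of `T` requests. -/
noncomputable def scriptShape (q : Params) (T : ℕ) : PMF (List (Op q)) :=
  (PMF.uniformOfFintype (Fin q.P → Fin q.n → Bool)).bind fun f =>
    (randomShape T (initialFilling f, 0)).map (setupOps f ++ ·)

/-- The script of the setup reveals the filling but nothing about the assignment, which is therefore
still uniform when the requests begin. -/
theorem map_shape_script (ys : List (Request q)) :
    (script ys).map (List.map Op.shape) = scriptShape q ys.length := by
  unfold script scriptShape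
  simp only [PMF.map_bind, PMF.map_comp]
  congr 1
  funext f
  rw [← bind_runShape, PMF.map_bind]
  congr 1
  funext a
  have h := map_shape_ctlRun ys (inv_initialState f a)
  have hpart : (fun u => ((initialState f a).pos u).partition) = a := by
    funext u
    exact partition_initialPos a u
  rw [hpart, fill_initialState] at h
  refine Eq.trans ?_ (congrArg (PMF.map (setupOps f ++ ·)) h)
  rw [PMF.map_comp]
  congr 1
  funext os
  simp [map_shape_setupOps]

/-! #### The length of a script -/

theorem length_fetchOps_le (m : Bool) (p : Fin q.P) (ls : List (Fin q.L)) (I : Fin q.L → Finset ℕ) :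
    (fetchOps m p ls I).length ≤ 2 * ls.length := by
  induction ls with
  | nil => simp [fetchOps]
  | cons ℓ ls ih =>
    have hsplit : fetchOps m p (ℓ :: ls) I =
        (if m then [.fetchMeta p ℓ] else []) ++ .fetch p ℓ (I ℓ) :: fetchOps m p ls I := by
      simp [fetchOps]
    rw [hsplit]
    cases m <;> simp <;> omega

theorem length_evictShape_le (g : Fin q.P → Fin q.L → Bool) (p : Fin q.P) :
    (evictShape g p).length ≤ 2 * q.L + 1 := by
  have h₁ := length_fetchOps_le true p (runLevels (g p)) fun ℓ => Finset.range (q.half ℓ)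
  have h₂ : (runLevels (g p)).length ≤ (List.finRange q.L).length :=
    (List.takeWhile_sublist _).length_le
  rw [List.length_finRange] at h₂
  rw [evictShape, List.length_append, List.length_singleton]
  omega

theorem length_scanShape_le (k : ℕ) (x : Filling q) :
    (scanShape k x).1.length ≤ k * (2 * q.L + 1) := by
  induction k generalizing x with
  | zero => simp [scanShape]
  | succ k ih =>
    have h₁ := length_evictShape_le x.1 (x.2 + 1)
    have h₂ := ih (writeFilling x.1 (x.2 + 1), x.2 + 1)
    rw [Nat.succ_mul]
    simp only [scanShape, List.length_append]
    omega

theorem length_accessShape_le (p : Fin q.P) (k : ℕ) (hk : k ≤ q.c) (x : Filling q) :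
    (accessShape p k x).1.length ≤ (q.c + 2) * (2 * q.L + 1) := by
  have h₁ := length_evictShape_le x.1 p
  have h₂ := length_scanShape_le k (writeFilling x.1 p, x.2)
  have h₃ := length_fetchOps_le false p ((List.finRange q.L).filter (x.1 p)) fun _ => Finset.range 1
  have h₄ := List.length_filter_le (x.1 p) (List.finRange q.L)
  rw [List.length_finRange] at h₄
  have h₅ : k * (2 * q.L + 1) ≤ q.c * (2 * q.L + 1) := Nat.mul_le_mul_right _ hk
  rw [Nat.add_mul]
  simp only [accessShape, readShape, List.length_append]
  omega

theorem length_randomShape_le (T : ℕ) (x : Filling q) :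
    ∀ os ∈ (randomShape T x).support, os.length ≤ T * ((q.c + 2) * (2 * q.L + 1)) := by
  induction T generalizing x with
  | zero =>
    intro os hos
    rw [randomShape, PMF.mem_support_pure_iff] at hos
    simp [hos]
  | succ T ih =>
    intro os hos
    simp only [randomShape, PMF.mem_support_bind_iff, PMF.mem_support_map_iff] at hos
    obtain ⟨p, -, k, -, os', hos', rfl⟩ := hos
    have h₁ := length_accessShape_le p k (Nat.lt_succ_iff.1 k.2) x
    have h₂ := ih _ os' hos'
    rw [List.length_append, Nat.succ_mul]
    omega

/-- Passing to the shape preserves the length. The setup contributes at most one access per level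
besides the announcement, and each request consists of a read and at most `q.c + 1` evictions, each
of length at most `2 * q.L + 1`. -/
theorem length_script_le (ys : List (Request q)) :
    ∀ os ∈ (script ys).support,
      os.length ≤ 1 + q.P * q.L + ys.length * ((q.c + 2) * (2 * q.L + 1)) := by
  intro os hos
  have hmem : os.map Op.shape ∈ (scriptShape q ys.length).support := by
    rw [← map_shape_script, PMF.mem_support_map_iff]
    exact ⟨os, hos, rfl⟩
  simp only [scriptShape, PMF.mem_support_bind_iff, PMF.mem_support_map_iff] at hmem
  obtain ⟨f, -, os', hos', heq⟩ := hmem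
  have h₁ := length_randomShape_le _ _ os' hos'
  have h₂ : (setupOps f).length ≤ 1 + q.P * q.L := by
    have := List.length_filter_le (fun x : Fin q.P × Fin q.L => initialFilling f x.1 x.2)
      (List.product (List.finRange q.P) (List.finRange q.L))
    have hprod : (List.product (List.finRange q.P) (List.finRange q.L)).length = q.P * q.L :=
      (List.length_product _ _).trans (by simp)
    rw [hprod] at this
    simp only [setupOps, fillOps, List.length_cons, List.length_map]
    omega
  have h₃ := congrArg List.length heq
  rw [List.length_append, List.length_map] at h₃
  omega

end Shape

/-! ### Obliviousness -/

theorem PMF_bind_congr {α β : Type*} {X : PMF α} {f g : α → PMF β}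
    (h : ∀ a ∈ X.support, f a = g a) : X.bind f = X.bind g := by
  ext b
  rw [PMF.bind_apply, PMF.bind_apply]
  refine tsum_congr fun a => ?_
  by_cases ha : X a = 0
  · simp [ha]
  · rw [h a ((PMF.mem_support_iff _ _).2 ha)]

/-- The access pattern in which the permutations are uniformly random and all blocks are zero. -/
noncomputable def idealPattern (E : SymEnc) {q : Params} (π : Perms q) (ys : List (Request q)) :
    PMF (List Bool) :=
  (script ys).bind fun os => observe E uniformPerm (os.map Op.erase) π

theorem idealPattern_eq (E : SymEnc) {q : Params} (π : Perms q) {ys zs : List (Request q)}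
    (h : ys.length = zs.length) : idealPattern E π ys = idealPattern E π zs := by
  classical
  -- The view factors through the shape: any fresh script of the given shape may serve as
  -- representative, and the default for impossible shapes is never reached.
  let Ψ : List (Op q) → PMF (List Bool) := fun S =>
    if hS : ∃ os, FreshScript (fun _ _ => Set.univ) os ∧ os.map Op.shape = S then
      observe E uniformPerm (hS.choose.map Op.erase) π
    else PMF.pure []
  have key : ∀ ys : List (Request q),
      idealPattern E π ys = ((script ys).map (List.map Op.shape)).bind Ψ := by
    intro ys
    rw [PMF.bind_map]
    refine PMF_bind_congr fun os hos => ?_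
    have hfresh := freshScript_script ys os hos
    have hex : ∃ os', FreshScript (fun _ _ => Set.univ) os' ∧
      os'.map Op.shape = os.map Op.shape := ⟨os, hfresh, rfl⟩
    simp only [Function.comp_apply, Ψ, dif_pos hex]
    exact observe_uniformPerm_eq_of_univ E hex.choose_spec.2.symm hfresh hex.choose_spec.1 π
  rw [key, key, map_shape_script, map_shape_script, h]

theorem abs_acceptProb_sub_idealPattern_le {F : KeyedPerm} {E : SymEnc} {q : Params} {C : Circuit}
    {δ₁ δ₂ : ℝ} {M n : ℕ} (hδ₁ : 0 ≤ δ₁) (hδ₂ : 0 ≤ δ₂) (hM : ∀ ℓ, q.size ℓ ≤ M)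
    (h₁ : ∀ C' : Circuit, C'.length ≤ C.length + 3 → ∀ (ℓ : Fin q.L) σ bs,
      |acceptProb C' (levelCipher E ℓ σ bs) - acceptProb C' (levelCipher E ℓ σ [])| ≤ δ₁)
    (h₂ : ∀ C' : Circuit, C'.length ≤ C.length + 3 + n * M * (3 * M) → ∀ ℓ : Fin q.L,
      |acceptProb C' ((keyedPerm F ℓ).map permTable)
        - acceptProb C' ((uniformPerm ℓ).map permTable)| ≤ δ₂)
    (ys : List (Request q)) (hn : ∀ os ∈ (script ys).support, os.length ≤ n)
    (k₀ : Fin q.P → Fin q.L → F.Key) :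
    |acceptProb C (accessPattern F E q ys)
      - acceptProb C (idealPattern E (permsOf F k₀) ys)| ≤ n * (δ₁ + δ₂) := by
  rw [accessPattern_eq ys k₀]
  refine abs_prob_bind_sub_le fun os hos => ?_
  have g₁ := abs_prob_observe_erase_le (keyedPerm F) h₁ hδ₁ os (permsOf F k₀) []
  have g₂ := abs_prob_observe_perm_le (E := E) hM h₂ hδ₂ os (hn os hos) (permsOf F k₀) []
  have hlen : (os.length : ℝ) ≤ n := Nat.cast_le.2 (hn os hos)
  calc _ ≤ os.length * δ₁ + os.length * δ₂ := (abs_sub_le _ _ _).trans (add_le_add g₁ g₂)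
    _ = os.length * (δ₁ + δ₂) := by ring
    _ ≤ n * (δ₁ + δ₂) := mul_le_mul_of_nonneg_right hlen (add_nonneg hδ₁ hδ₂)

/-- The security of the encryption scheme, uniformly in the messages and the circuit. -/
theorem SecureEnc.exists_bound {E : ℕ → SymEnc} (hE : SecureEnc E) {s b : ℕ → ℕ}
    (hs : PolyBounded s) (hb : PolyBounded b) :
    ∃ δ : ℕ → ℝ, Negligible δ ∧ (∀ κ, 0 ≤ δ κ) ∧
      ∀ κ, ∀ C : Circuit, C.length ≤ s κ → ∀ ms ms' : List (List Bool),
        ms.map List.length = ms'.map List.length → ms.length ≤ b κ → ms.flatten.length ≤ b κ →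
        |acceptProb C ((E κ).gen.bind fun K => ((E κ).encAll K ms).map List.flatten)
          - acceptProb C ((E κ).gen.bind fun K => ((E κ).encAll K ms').map List.flatten)|
          ≤ δ κ := by
  obtain ⟨δ, h₁, h₂, h₃⟩ := exists_negligible_bound
    (ι := fun _ => Circuit × List (List Bool) × List (List Bool))
    (fun κ => {x | x.1.length ≤ s κ ∧ x.2.1.map List.length = x.2.2.map List.length ∧
      x.2.1.length ≤ b κ ∧ x.2.1.flatten.length ≤ b κ})
    (fun κ x => |acceptProb x.1 ((E κ).gen.bind fun K => ((E κ).encAll K x.2.1).map List.flatten)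
      - acceptProb x.1 ((E κ).gen.bind fun K => ((E κ).encAll K x.2.2).map List.flatten)|)
    (fun _ _ => abs_nonneg _) (fun _ _ => abs_prob_sub_le_one _ _ _ _)
    (fun κ => ⟨([], [], []), by simp⟩)
    fun x hx => hE (fun κ => (x κ).2.1) (fun κ => (x κ).2.2) (fun κ => (hx κ).2.1)
      (hb.mono fun κ => (hx κ).2.2.1) (hb.mono fun κ => (hx κ).2.2.2) (fun κ => (x κ).1)
      (hs.mono fun κ => (hx κ).1)
  exact ⟨δ, h₁, h₂, fun κ C hC ms ms' hms hl hl' => h₃ κ (C, ms, ms') ⟨hC, hms, hl, hl'⟩⟩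

/-- The pseudo-randomness of the permutations, uniformly in the domain and the circuit. -/
theorem Pseudorandom.exists_bound {F : ℕ → KeyedPerm} (hF : Pseudorandom F) {s b : ℕ → ℕ}
    (hs : PolyBounded s) (hb : PolyBounded b) :
    ∃ δ : ℕ → ℝ, Negligible δ ∧ (∀ κ, 0 ≤ δ κ) ∧
      ∀ κ, ∀ C : Circuit, C.length ≤ s κ → ∀ n ≤ b κ,
        |acceptProb C ((F κ).gen.map fun K => permTable ((F κ).perm n K))
          - acceptProb C ((PMF.uniformOfFintype (Equiv.Perm (Fin n))).map permTable)| ≤ δ κ := by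
  obtain ⟨δ, h₁, h₂, h₃⟩ := exists_negligible_bound (ι := fun _ => Circuit × ℕ)
    (fun κ => {x | x.1.length ≤ s κ ∧ x.2 ≤ b κ})
    (fun κ x => |acceptProb x.1 ((F κ).gen.map fun K => permTable ((F κ).perm x.2 K))
      - acceptProb x.1 ((PMF.uniformOfFintype (Equiv.Perm (Fin x.2))).map permTable)|)
    (fun _ _ => abs_nonneg _) (fun _ _ => abs_prob_sub_le_one _ _ _ _)
    (fun κ => ⟨([], 0), by simp⟩)
    fun x hx => hF (fun κ => (x κ).2) (hb.mono fun κ => (hx κ).2) (fun κ => (x κ).1)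
      (hs.mono fun κ => (hx κ).1)
  exact ⟨δ, h₁, h₂, fun κ C hC n hn => h₃ κ (C, n) ⟨hC, hn⟩⟩

theorem Params.P_le_N (q : Params) : q.P ≤ q.N := Nat.le_mul_self _

theorem Params.L_le_N (q : Params) : q.L ≤ q.N :=
  (Nat.succ_le_of_lt Nat.lt_two_pow_self).trans q.P_le_N

theorem Params.size_le (q : Params) (ℓ : Fin q.L) : q.size ℓ ≤ 2 * q.N + q.ε := by
  have h : 2 ^ (ℓ : ℕ) ≤ q.N :=
    (Nat.pow_le_pow_right two_pos (Nat.lt_succ_iff.1 ℓ.2)).trans q.P_le_N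
  unfold Params.size
  split_ifs <;> omega

end ORAM
-- Assembling the hybrid bounds
theorem mainTheorem1 (F : ℕ → ORAM.KeyedPerm) (hF : ORAM.Pseudorandom F)
    (E : ℕ → ORAM.SymEnc) (hE : ORAM.SecureEnc E)
    (q : ℕ → ORAM.Params)
    (hN : ORAM.PolyBounded fun κ => (q κ).N) (hε : ORAM.PolyBounded fun κ => (q κ).ε)
    (hB : ORAM.PolyBounded fun κ => (q κ).B) (hc : ORAM.PolyBounded fun κ => (q κ).c) :
    ORAM.Oblivious fun κ y => ORAM.accessPattern (F κ) (E κ) (q κ) y := by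
  intro y z hyz hy C hC
  -- `M` bounds the sizes of the levels and `n` the lengths of the scripts, with the numbers of
  -- partitions and of levels both estimated by `N`.
  let M : ℕ → ℕ := fun κ => 2 * (q κ).N + (q κ).ε
  let n : ℕ → ℕ := fun κ => 1 + (q κ).N * (q κ).N +
    (y κ).length * (((q κ).c + 2) * (2 * (q κ).N + 1))
  have hM : ORAM.PolyBounded M := ((ORAM.PolyBounded.const 2).mul hN).add hε
  have hn : ORAM.PolyBounded n :=
    ((ORAM.PolyBounded.const 1).add (hN.mul hN)).add
      (hy.mul ((hc.add (.const 2)).mul (((ORAM.PolyBounded.const 2).mul hN).add (.const 1))))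
  -- The bound on the messages adds their number, one per place and one for the metadata, to their
  -- total length; the identifiers take at most `N` bits each.
  obtain ⟨δ₁, hδ₁, hδ₁0, h₁⟩ := hE.exists_bound (hC.add (.const 3))
    (b := fun κ => (M κ + 1) + (M κ * (q κ).B + M κ * (q κ).N))
    ((hM.add (.const 1)).add ((hM.mul hB).add (hM.mul hN)))
  obtain ⟨δ₂, hδ₂, hδ₂0, h₂⟩ := hF.exists_bound
    (s := fun κ => (C κ).length + 3 + n κ * M κ * (3 * M κ)) (b := M)
    ((hC.add (.const 3)).add ((hn.mul hM).mul ((ORAM.PolyBounded.const 3).mul hM))) hM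
  have hδ : ORAM.Negligible fun κ => δ₁ κ + δ₂ κ := Asymptotics.SuperpolynomialDecay.add hδ₁ hδ₂
  -- The factor 2 accounts for the two passages to the ideal pattern, from `y` and from `z`.
  have hδn := hδ.poly_mul ((ORAM.PolyBounded.const 2).mul hn)
    fun κ => add_nonneg (hδ₁0 κ) (hδ₂0 κ)
  refine hδn.of_abs_le fun κ => ?_
  rw [abs_abs]
  have hsize : ∀ ℓ, (q κ).size ℓ ≤ M κ := (q κ).size_le
  have hclose : ∀ ys : List (ORAM.Request (q κ)), ys.length = (y κ).length →
      ∀ k₀, |ORAM.acceptProb (C κ) (ORAM.accessPattern (F κ) (E κ) (q κ) ys)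
        - ORAM.acceptProb (C κ) (ORAM.idealPattern (E κ) (ORAM.permsOf (F κ) k₀) ys)|
        ≤ n κ * (δ₁ κ + δ₂ κ) := by
    intro ys hys k₀
    refine ORAM.abs_acceptProb_sub_idealPattern_le (M := M κ) (hδ₁0 κ) (hδ₂0 κ) hsize ?_ ?_ ys ?_ k₀
    · intro C' hC' ℓ σ bs
      refine h₁ κ C' hC' _ _ (ORAM.map_length_plaintexts ℓ σ σ bs []) ?_ ?_
      · rw [ORAM.length_plaintexts]
        have := hsize ℓ
        omega
      · rw [ORAM.length_flatten_plaintexts]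
        have hNs : (q κ).N.size ≤ (q κ).N := Nat.size_le.2 Nat.lt_two_pow_self
        exact (Nat.add_le_add (Nat.mul_le_mul_right _ (hsize ℓ))
          (Nat.mul_le_mul (hsize ℓ) hNs)).trans (Nat.le_add_left _ _)
    · intro C' hC' ℓ
      have := h₂ κ C' hC' _ (hsize ℓ)
      rwa [ORAM.keyedPerm, PMF.map_comp]
    · intro os hos
      refine (ORAM.length_script_le ys os hos).trans ?_
      rw [hys]
      have hP := (q κ).P_le_N
      have hL := (q κ).L_le_N
      exact Nat.add_le_add (Nat.add_le_add_left (Nat.mul_le_mul hP hL) _)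
        (Nat.mul_le_mul_left _ (Nat.mul_le_mul_left _ (by omega)))
  obtain ⟨K₀⟩ := ORAM.nonempty_key (F := F κ)
  have hy' := hclose (y κ) rfl fun _ _ => K₀
  have hz' := hclose (z κ) (hyz κ).symm fun _ _ => K₀
  rw [← ORAM.idealPattern_eq (E κ) _ (hyz κ), abs_sub_comm] at hz'
  refine (abs_sub_le _ _ _).trans ((add_le_add hy' hz').trans (le_of_eq ?_))
  push_cast
  ring
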